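/- Let $\Omega\subset\mathbb{R}^3$ be a (nonempty, open) bounded convex domain whose boundary is of class $C^2$ and has positive Gaussian curvature at every point, and let $n(q)$ denote the outward unit normal at $q\in\partial\Omega$. Let $$\Gamma_-=\{(q,v)\in\partial\Omega\times\mathbb{R}^3:\ n(q)\cdot v<0\}.$$ Let $0\le\gamma\le1$ and let $B$ be a measurable cross-section with $0\le B(r,\theta)\le C_B\,r^\gamma\cos\theta\sin\theta$ for some constant $C_B$ and all $r>0$, $0\le\theta\le\pi/2$. For $v,v_*\in\mathbb{R}^3$, $v\ne v_*$, put $e_1=\frac{v_*-v}{|v_*-v|}$, complete $e_1$ to an orthonormal basis $e_1,e_2,e_3$, and set $\alpha=\cos\theta\,e_1+\sin\theta\cos\varphi\,e_2+\sin\theta\sin\varphi\,e_3$, $v'=v+((v_*-v)\cdot\alpha)\alpha$, $v_*'=v_*-((v_*-v)\cdot\alpha)\alpha$. Let $$Q(F,G)(v)=\int_{\mathbb{R}^3}\int_0^{2\pi}\int_0^{\pi/2}\bigl(F(v')G(v_*')-F(v)G(v_*)\bigr)B(|v-v_*|,\theta)\,d\theta\,d\varphi\,dv_*,$$ $M(v)=\pi^{-3/2}e^{-|v|^2}$,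 and $L(f)=M^{-1/2}\bigl(Q(M,M^{1/2}f)+Q(M^{1/2}f,M)\bigr)$. Write $L(f)=-\nu f+K(f)$, where $\nu(v)=\int_{\mathbb{R}^3}\int_0^{2\pi}\int_0^{\pi/2}M(v_*)B(|v-v_*|,\theta)\,d\theta\,d\varphi\,dv_*$ is the collision frequency and $K$ is the remaining integral operator in $v$; $K$ acts on functions of $(x,v)$ at fixed $x$. For $x\in\Omega$ and $v\ne0$ let $\tau_-(x,v)=\inf\{t>0:\ x-tv\notin\Omega\}$ and $q_-(x,v)=x-\tau_-(x,v)v$, and define $$(Jg)(x,v)=e^{-\nu(v)\tau_-(x,v)}g(q_-(x,v),v),\qquad (S_\Omega h)(x,v)=\int_0^{\tau_-(x,v)}e^{-\nu(v)s}h(x-sv,v)\,ds.$$ Let $g$ be a measurable function on $\Gamma_-$ for which there are constants $a,C>0$ with $$|g(q_1,v)|\le Ce^{-a|v|^2},\qquad |g(q_1,v)-g(q_2,v)|\le C|q_1-q_2|$$ for all $(q_1,v),(q_2,v)\in\Gamma_-$. For $i\ge0$ let $g_i=(S_\Omega K)^iJg$. Then for every $i\ge0$: (1) for every $0<\epsilon<1$,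 $g_i\in L^2_v(\mathbb{R}^3;H^{1-\epsilon}_x(\Omega))$; that is, $g_i\in L^2(\Omega\times\mathbb{R}^3)$ and, with $s=1-\epsilon$, $$\int_{\mathbb{R}^3}\int_\Omega\int_\Omega\frac{|g_i(x,v)-g_i(y,v)|^2}{|x-y|^{3+2s}}\,dx\,dy\,dv<\infty;$$ (2) for every $b$ with $0<b\le a$ and $b<\frac14$ there is a constant $C'>0$ such that $|g_i(x,v)|\le C'e^{-b|v|^2}$ for all $x\in\Omega$ and $v\ne0$. -/

import Mathlib

open MeasureTheory Set
open scoped ENNReal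

noncomputable section

namespace StationaryBoltzmann

/-- Three-dimensional Euclidean space, used both for positions and for velocities. -/
abbrev Space := EuclideanSpace ℝ (Fin 3)

/-! ### Bounded convex domains of positive curvature -/

/-- `ρ` is a `C²` defining function of `Ω` near the boundary point `q`: on an open neighbourhood `U`
of `q` it is `C²` with nonvanishing gradient, and `Ω ∩ U = {ρ < 0} ∩ U`. -/
def IsLocalDefiningFunction (Ω : Set Space) (q : Space) (ρ : Space → ℝ) : Prop :=
  ∃ U : Set Space, IsOpen U ∧ q ∈ U ∧ ContDiffOn ℝ 2 ρ U ∧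
    (∀ x ∈ U, gradient ρ x ≠ 0) ∧ Ω ∩ U = {x ∈ U | ρ x < 0}

/-- `n` is the outward unit normal of `∂Ω` at `q`, that is `n = ∇ρ(q) / |∇ρ(q)|` for a local
defining function `ρ` (the vector does not depend on the choice of `ρ`). -/
def IsOutwardUnitNormal (Ω : Set Space) (q n : Space) : Prop :=
  ∃ ρ : Space → ℝ, IsLocalDefiningFunction Ω q ρ ∧ n = ‖gradient ρ q‖⁻¹ • gradient ρ q

/-- Orthonormal basis `u, w` of the tangent plane at `q` of the level set of `ρ` through `q`. -/
def IsTangentFrame (ρ : Space → ℝ) (q u w : Space) : Prop :=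
  Orthonormal ℝ ![u, w] ∧ inner ℝ (gradient ρ q) u = 0 ∧ inner ℝ (gradient ρ q) w = 0

/-- Second fundamental form at `q` of the level set of `ρ` through `q`, on tangent vectors `u, w`:
the differential of the unit normal field `∇ρ/|∇ρ|` in direction `u`, paired with `w`, which equals
`D²ρ(q)[u, w] / |∇ρ(q)|`. -/
def secondFundamentalForm (ρ : Space → ℝ) (q u w : Space) : ℝ :=
  fderiv ℝ (fderiv ℝ ρ) q u w / ‖gradient ρ q‖

/-- Gaussian curvature at `q` of the level set of `ρ` through `q`: the determinant of the second
fundamental form, computed in an orthonormal basis `u, w` of the tangent plane. -/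
def gaussianCurvature (ρ : Space → ℝ) (q u w : Space) : ℝ :=
  secondFundamentalForm ρ q u u * secondFundamentalForm ρ q w w -
    secondFundamentalForm ρ q u w ^ 2

/-- A bounded convex domain whose boundary is `C²` and has positive Gaussian curvature everywhere. -/
structure IsPositivelyCurvedDomain (Ω : Set Space) : Prop where
  isOpen : IsOpen Ω
  nonempty : Ω.Nonempty
  isBounded : Bornology.IsBounded Ω
  convex : Convex ℝ Ω
  positive_curvature : ∀ q ∈ frontier Ω, ∃ ρ : Space → ℝ, IsLocalDefiningFunction Ω q ρ ∧
    ∀ u w : Space, IsTangentFrame ρ q u w → 0 < gaussianCurvature ρ q u w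

/-- The incoming boundary `Γ₋ = {(q, v) : q ∈ ∂Ω, n(q) · v < 0}`. -/
def incomingBoundary (Ω : Set Space) : Set (Space × Space) :=
  {p | p.1 ∈ frontier Ω ∧ ∃ n : Space, IsOutwardUnitNormal Ω p.1 n ∧ inner ℝ n p.2 < 0}

/-- Incoming data: `|g(q, v)| ≤ C exp(-a|v|²)` and `|g(q₁, v) - g(q₂, v)| ≤ C |q₁ - q₂|` on `Γ₋`,
`g` being a measurable function on `Γ₋`. Values of `g` off `Γ₋` are unrestricted. -/
structure IsIncomingData (Ω : Set Space) (g : Space → Space → ℝ) (a C : ℝ) : Prop where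
  measurable : Measurable fun p : incomingBoundary Ω => g p.1.1 p.1.2
  gaussian_bound : ∀ q v : Space, (q, v) ∈ incomingBoundary Ω →
    |g q v| ≤ C * Real.exp (-a * ‖v‖ ^ 2)
  lipschitz : ∀ q₁ q₂ v : Space, (q₁, v) ∈ incomingBoundary Ω → (q₂, v) ∈ incomingBoundary Ω →
    |g q₁ v - g q₂ v| ≤ C * ‖q₁ - q₂‖

/-! ### The linearized collision operator -/

/-- Grad's angular cutoff for the cross-section `B(r, θ)`, `r = |v - v_*|`, `0 ≤ θ ≤ π/2`:
`0 ≤ B(r, θ) ≤ C r^γ cos θ sin θ`. -/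
structure AngularCutoff (B : ℝ → ℝ → ℝ) (γ : ℝ) : Prop where
  measurable : Measurable (Function.uncurry B)
  bound : ∃ C : ℝ, ∀ r θ : ℝ, 0 < r → 0 ≤ θ → θ ≤ Real.pi / 2 →
    0 ≤ B r θ ∧ B r θ ≤ C * r ^ γ * Real.cos θ * Real.sin θ

/-- The first vector `e₂` of an orthonormal basis `e₁, e₂, e₃` completing a unit vector `e₁ = e`. -/
def frameSnd (e : Space) : Space :=
  if e 0 = 0 ∧ e 1 = 0 then !₂[1, 0, 0]
  else !₂[-e 1 / Real.sqrt (e 0 ^ 2 + e 1 ^ 2), e 0 / Real.sqrt (e 0 ^ 2 + e 1 ^ 2), 0]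

/-- The last vector `e₃ = e₁ × e₂` of the orthonormal basis. -/
def frameTrd (e : Space) : Space :=
  !₂[e 1 * frameSnd e 2 - e 2 * frameSnd e 1,
     e 2 * frameSnd e 0 - e 0 * frameSnd e 2,
     e 0 * frameSnd e 1 - e 1 * frameSnd e 0]

theorem orthonormal_frame (e : Space) (he : ‖e‖ = 1) :
    Orthonormal ℝ ![e, frameSnd e, frameTrd e] := by
  have hin : ∀ x y : Space, inner ℝ x y = x 0 * y 0 + x 1 * y 1 + x 2 * y 2 := by
    intro x y
    rw [PiLp.inner_apply, Fin.sum_univ_three]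
    simp only [RCLike.inner_apply, conj_trivial]
    ring
  have alg : ∀ a b c p q r : ℝ, a ^ 2 + b ^ 2 + c ^ 2 = 1 → p ^ 2 + q ^ 2 + r ^ 2 = 1 →
      a * p + b * q + c * r = 0 →
      Orthonormal ℝ ![(!₂[a, b, c] : Space), !₂[p, q, r],
        !₂[b * r - c * q, c * p - a * r, a * q - b * p]] := by
    intro a b c p q r h1 h2 h3
    rw [orthonormal_iff_ite]
    intro i j
    rw [hin]
    fin_cases i <;> fin_cases j <;> simp [-mul_eq_zero] <;> grind
  have hsq : e 0 ^ 2 + e 1 ^ 2 + e 2 ^ 2 = 1 := by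
    have h := EuclideanSpace.real_norm_sq_eq e
    rw [he, Fin.sum_univ_three] at h
    linarith
  have fr : ∀ a b c : ℝ, a ^ 2 + b ^ 2 + c ^ 2 = 1 → ¬(a = 0 ∧ b = 0) →
      (-b / Real.sqrt (a ^ 2 + b ^ 2)) ^ 2 + (a / Real.sqrt (a ^ 2 + b ^ 2)) ^ 2 + 0 ^ 2 = 1 ∧
      a * (-b / Real.sqrt (a ^ 2 + b ^ 2)) + b * (a / Real.sqrt (a ^ 2 + b ^ 2)) + c * 0 = 0 := by
    intro a b c _ h
    have hpos : 0 < a ^ 2 + b ^ 2 := by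
      by_contra hn
      exact h ⟨by nlinarith [sq_nonneg a, sq_nonneg b], by nlinarith [sq_nonneg a, sq_nonneg b]⟩
    have hs := Real.sq_sqrt hpos.le
    have hs0 := Real.sqrt_pos.2 hpos
    constructor
    · field_simp
      linarith
    · ring
  have he' : e = !₂[e 0, e 1, e 2] := by
    ext i; fin_cases i <;> rfl
  have main : Orthonormal ℝ ![(!₂[e 0, e 1, e 2] : Space), frameSnd e, frameTrd e] := by
    by_cases h : e 0 = 0 ∧ e 1 = 0
    · have h2 : frameSnd e = !₂[1, 0, 0] := by simp [frameSnd, h]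
      unfold frameTrd
      rw [h2]
      exact alg (e 0) (e 1) (e 2) 1 0 0 hsq (by norm_num) (by simp [h.1])
    · have h2 : frameSnd e = !₂[-e 1 / Real.sqrt (e 0 ^ 2 + e 1 ^ 2),
          e 0 / Real.sqrt (e 0 ^ 2 + e 1 ^ 2), 0] := by simp only [frameSnd, h, if_false]
      obtain ⟨h3, h4⟩ := fr (e 0) (e 1) (e 2) hsq h
      unfold frameTrd
      rw [h2]
      exact alg (e 0) (e 1) (e 2) _ _ _ hsq h3 h4
  rwa [← he'] at main

/-- `e₁ = (v_* - v) / |v_* - v|`. -/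
def relativeDirection (v vs : Space) : Space := ‖vs - v‖⁻¹ • (vs - v)

/-- `α = cos θ e₁ + sin θ cos φ e₂ + sin θ sin φ e₃`. -/
def collisionAxis (v vs : Space) (θ φ : ℝ) : Space :=
  Real.cos θ • relativeDirection v vs
    + (Real.sin θ * Real.cos φ) • frameSnd (relativeDirection v vs)
    + (Real.sin θ * Real.sin φ) • frameTrd (relativeDirection v vs)

/-- Post-collisional velocity `v' = v + ((v_* - v) · α) α`. -/
def postVelocity (v vs : Space) (θ φ : ℝ) : Space :=
  v + (inner ℝ (vs - v) (collisionAxis v vs θ φ)) • collisionAxis v vs θ φ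

/-- Post-collisional velocity `v_*' = v_* - ((v_* - v) · α) α`. -/
def postVelocityStar (v vs : Space) (θ φ : ℝ) : Space :=
  vs - (inner ℝ (vs - v) (collisionAxis v vs θ φ)) • collisionAxis v vs θ φ

/-- Gain part of the collision operator: `∫∫∫ F(v') G(v_*') B(|v - v_*|, θ) dθ dφ dv_*`. -/
def collisionGain (B : ℝ → ℝ → ℝ) (F G : Space → ℝ) (v : Space) : ℝ :=
  ∫ vs : Space, ∫ φ in (0 : ℝ)..(2 * Real.pi), ∫ θ in (0 : ℝ)..(Real.pi / 2),
    F (postVelocity v vs θ φ) * G (postVelocityStar v vs θ φ) * B ‖v - vs‖ θ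

/-- Loss part of the collision operator: `∫∫∫ F(v) G(v_*) B(|v - v_*|, θ) dθ dφ dv_*`. -/
def collisionLoss (B : ℝ → ℝ → ℝ) (F G : Space → ℝ) (v : Space) : ℝ :=
  ∫ vs : Space, ∫ _φ in (0 : ℝ)..(2 * Real.pi), ∫ θ in (0 : ℝ)..(Real.pi / 2),
    F v * G vs * B ‖v - vs‖ θ

/-- The collision operator `Q(F, G)`. Under the angular cutoff its two parts converge separately. -/
def collision (B : ℝ → ℝ → ℝ) (F G : Space → ℝ) (v : Space) : ℝ :=
  collisionGain B F G v - collisionLoss B F G v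

/-- The standard Maxwellian `M(v) = π^(-3/2) exp(-|v|²)`. -/
def maxwellian (v : Space) : ℝ := Real.pi ^ (-(3 / 2) : ℝ) * Real.exp (-‖v‖ ^ 2)

/-- `M^(1/2) f`. -/
def weighted (f : Space → ℝ) (v : Space) : ℝ := Real.sqrt (maxwellian v) * f v

/-- The linearized collision operator `L(f) = M^(-1/2) (Q(M, M^(1/2) f) + Q(M^(1/2) f, M))`. -/
def linearizedCollision (B : ℝ → ℝ → ℝ) (f : Space → ℝ) (v : Space) : ℝ :=
  (Real.sqrt (maxwellian v))⁻¹ *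
    (collision B maxwellian (weighted f) v + collision B (weighted f) maxwellian v)

/-- The collision frequency `ν(v) = ∫∫∫ M(v_*) B(|v - v_*|, θ) dθ dφ dv_*`. -/
def collisionFrequency (B : ℝ → ℝ → ℝ) (v : Space) : ℝ :=
  ∫ vs : Space, ∫ _φ in (0 : ℝ)..(2 * Real.pi), ∫ θ in (0 : ℝ)..(Real.pi / 2),
    maxwellian vs * B ‖v - vs‖ θ

/-- The integral operator `K` in `L(f) = -ν f + K(f)`, see `linearizedCollision_eq`. -/
def collisionIntegral (B : ℝ → ℝ → ℝ) (f : Space → ℝ) (v : Space) : ℝ :=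
  (Real.sqrt (maxwellian v))⁻¹ *
    (collisionGain B maxwellian (weighted f) v + collisionGain B (weighted f) maxwellian v
      - collisionLoss B maxwellian (weighted f) v)

theorem linearizedCollision_eq (B : ℝ → ℝ → ℝ) (f : Space → ℝ) (v : Space) :
    linearizedCollision B f v = -collisionFrequency B v * f v + collisionIntegral B f v := by
  have hM : 0 < Real.sqrt (maxwellian v) := by
    unfold maxwellian; positivity
  have h : collisionLoss B (weighted f) maxwellian v
      = Real.sqrt (maxwellian v) * f v * collisionFrequency B v := by
    simp only [collisionLoss, collisionFrequency, weighted, mul_assoc,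
      intervalIntegral.integral_const_mul, integral_const_mul]
  simp only [linearizedCollision, collision, collisionIntegral, h]
  field_simp
  ring

/-- `K` acting on functions of `(x, v)`, at fixed `x`. -/
def opK (B : ℝ → ℝ → ℝ) (f : Space → Space → ℝ) (x v : Space) : ℝ :=
  collisionIntegral B (f x) v

/-! ### Transport in the domain -/

/-- Backward exit time `τ₋(x, v) = inf {t > 0 : x - t v ∉ Ω}`. It is used for `x ∈ Ω` and almost
every `v`; for bounded `Ω` the set is nonempty as soon as `v ≠ 0`. -/
def exitTime (Ω : Set Space) (x v : Space) : ℝ := sInf {t : ℝ | 0 < t ∧ x - t • v ∉ Ω}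

/-- Backward exit point `q₋(x, v) = x - τ₋(x, v) v`. -/
def exitPoint (Ω : Set Space) (x v : Space) : Space := x - exitTime Ω x v • v

/-- `(J g)(x, v) = exp(-ν(v) τ₋(x, v)) g(q₋(x, v), v)`. -/
def opJ (B : ℝ → ℝ → ℝ) (Ω : Set Space) (g : Space → Space → ℝ) (x v : Space) : ℝ :=
  Real.exp (-collisionFrequency B v * exitTime Ω x v) * g (exitPoint Ω x v) v

/-- `(S_Ω h)(x, v) = ∫₀^{τ₋(x, v)} exp(-ν(v) s) h(x - s v, v) ds`. -/
def opS (B : ℝ → ℝ → ℝ) (Ω : Set Space) (h : Space → Space → ℝ) (x v : Space) : ℝ :=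
  ∫ s in (0 : ℝ)..(exitTime Ω x v), Real.exp (-collisionFrequency B v * s) * h (x - s • v) v

/-- The boundary iterate `g_i = (S_Ω K)^i J g`. -/
def boundaryIterate (B : ℝ → ℝ → ℝ) (Ω : Set Space) (g : Space → Space → ℝ) (i : ℕ) :
    Space → Space → ℝ :=
  (fun f => opS B Ω (opK B f))^[i] (opJ B Ω g)

/-! ### The mixed fractional Sobolev space -/

/-- `f ∈ L²_v(ℝ³; H^s_x(Ω))`, for `0 < s < 1`: `f ∈ L²(Ω × ℝ³)`, and the Slobodeckij integral
`∫_{ℝ³} ∫_Ω ∫_Ω |f(x, v) - f(y, v)|² / |x - y|^(3 + 2s) dx dy dv` is finite. -/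
def MemMixedSobolev (Ω : Set Space) (s : ℝ) (f : Space → Space → ℝ) : Prop :=
  MemLp (Function.uncurry f) 2 (((volume : Measure Space).restrict Ω).prod volume) ∧
    ∫⁻ v : Space, ∫⁻ y in Ω, ∫⁻ x in Ω,
      ENNReal.ofReal (|f x v - f y v| ^ 2 / ‖x - y‖ ^ (3 + 2 * s)) < ∞

end StationaryBoltzmann

end

noncomputable section

namespace StationaryBoltzmann

/-! ### Strong convexity of positively curved domains -/

/-! At a fixed velocity, regularity in `x` is lost only through the backward exit time `τ`, whose
variation is uncontrolled near grazing characteristics. The proof measures this loss by one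
quantity, `chordModulus`, and shows that a Gaussian bound and a Slobodeckij bound are both preserved
by `S_Ω K`.

Geometry. Convexity makes the second fundamental form nonnegative and positive curvature then makes
it definite. By compactness Ω lies in a paraboloid of uniform aperture at every boundary point
(`exists_quadratic_support`), so the point at parameter `t` of a chord from `x` to `y` stays at
distance at least `c t(1-t)|x-y|²` from the complement. Comparing two parallel chords gives `|τ(x,ω)
- τ(y,ω)| ≤ C|x-y|(1/L(x) + 1/L(y))` for unit `ω`, where `L` is the chord length
(`exists_exitTime_difference_bound`). Points on chords shorter than `l` fill volume `O(l²)`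
uniformly in `ω`, so `1/L` lies in `L^q` for `q < 2`. Hence for `s < p < 1` the `2p`-th power of the
exit time difference is integrable against `|x-y|^(-3-2s)` (`exists_slobodeckij_exitTime_le`); the
requirement `2p < 2` keeps the order `s` below 1. Passing from unit directions to `v`, with the
growth `ν(v) = O(1+|v|)`, costs a factor `1 + |v|^(-p)`.

Invariants. `IsWeightBounded` carries the weight `exp(-b|v|²)`, and `HasSlobodeckijBound` carries
`(1 + |v|^(-p)) exp(-b|v|²)`. The data `Jg` satisfy both: interpolating between the Lipschitz and
the Gaussian bound trades part of the decay for the power `p` of the modulus. The operator `K` is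
dominated by a measure `κ_v` that integrates the singular weight to `O((1+|v|) exp(-b|v|²))`
(`exists_lintegral_collisionKernel_le`). It thus removes the singularity at `v = 0` and costs a
factor `1+|v|`, both for the size and, by Minkowski's inequality, for the Slobodeckij seminorm. The
operator `S_Ω` recovers this factor because the damped transit time is `O(1/(1+|v|))`. Differences
of `S_Ω h` split into an interior part, handled by translation invariance and Minkowski, and a part
supported between two exit times, bounded by the chord modulus. No lower bound on `B` is assumed:
either `ν` is bounded below for `|v| ≤ 1`, or `B` vanishes almost everywhere and `S_Ω K` gives zero
(`exists_le_collisionFrequency_or`).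

Finally `2p < 3` makes the squared singular weight integrable in `v`. -/

theorem add_smul_mem_of_mem_closure {Ω : Set Space} (ho : IsOpen Ω) (hc : Convex ℝ Ω) {q y : Space}
    (hq : q ∈ closure Ω) (hy : y ∈ Ω) {t : ℝ} (h0 : 0 < t) (h1 : t ≤ 1) :
    q + t • (y - q) ∈ Ω := by
  have h := hc.combo_closure_interior_mem_interior hq (ho.interior_eq.symm ▸ hy)
    (sub_nonneg.2 h1) h0 (by ring)
  rw [ho.interior_eq] at h
  convert h using 1
  module

theorem notMem_of_mem_frontier {Ω : Set Space} (ho : IsOpen Ω) {q : Space} (hq : q ∈ frontier Ω) :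
    q ∉ Ω := by
  rw [ho.frontier_eq] at hq
  exact hq.2

namespace IsLocalDefiningFunction

variable {Ω : Set Space} {q : Space} {ρ : Space → ℝ}

theorem eq_zero (ho : IsOpen Ω) (hq : q ∈ frontier Ω) (h : IsLocalDefiningFunction Ω q ρ) :
    ρ q = 0 := by
  obtain ⟨U, hU, hqU, hρ, -, heq⟩ := h
  have hc : ContinuousAt ρ q := (hρ.continuousOn.continuousAt (hU.mem_nhds hqU))
  apply le_antisymm
  · by_contra! hpos
    have h1 : ∀ᶠ x in nhds q, 0 < ρ x ∧ x ∈ U :=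
      (hc.eventually (lt_mem_nhds hpos)).and (hU.mem_nhds hqU)
    obtain ⟨x, ⟨hx1, hx2⟩, hx3⟩ := mem_closure_iff_nhds.1 (frontier_subset_closure hq) _ h1
    have : x ∈ {x ∈ U | ρ x < 0} := heq ▸ ⟨hx3, hx2⟩
    linarith [this.2]
  · by_contra! hneg
    have : q ∈ Ω ∩ U := heq.symm ▸ ⟨hqU, hneg⟩
    exact notMem_of_mem_frontier ho hq this.1

theorem differentiableAt (h : IsLocalDefiningFunction Ω q ρ) : DifferentiableAt ℝ ρ q := by
  obtain ⟨U, hU, hqU, hρ, -, -⟩ := h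
  exact (hρ.contDiffAt (hU.mem_nhds hqU)).differentiableAt (by norm_num)

theorem gradient_ne_zero (h : IsLocalDefiningFunction Ω q ρ) : gradient ρ q ≠ 0 := by
  obtain ⟨U, hU, hqU, -, hg, -⟩ := h
  exact hg q hqU

/-- `ρ` vanishes at `q` and is negative along the segment from `q` towards `y`, so its one-sided
derivative cannot be positive: the tangent plane supports Ω. -/
theorem fderiv_nonpos (ho : IsOpen Ω) (hc : Convex ℝ Ω) (hq : q ∈ frontier Ω)
    (h : IsLocalDefiningFunction Ω q ρ) {y : Space} (hy : y ∈ Ω) :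
    fderiv ℝ ρ q (y - q) ≤ 0 := by
  have h0 := h.eq_zero ho hq
  have hd := h.differentiableAt
  obtain ⟨U, hU, hqU, hρ, -, heq⟩ := h
  have hl : HasDerivAt (fun t : ℝ => ρ (q + t • (y - q))) (fderiv ℝ ρ q (y - q)) 0 := by
    have h1 : HasDerivAt (fun t : ℝ => q + t • (y - q)) (y - q) 0 := by
      simpa using ((hasDerivAt_id (0 : ℝ)).smul_const (y - q)).const_add q
    have h2 : HasFDerivAt ρ (fderiv ℝ ρ q) (q + (0 : ℝ) • (y - q)) := by
      simpa using hd.hasFDerivAt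
    exact h2.comp_hasDerivAt 0 h1
  have ht := hl.tendsto_slope_zero_right
  refine le_of_tendsto ht ?_
  have hcont : ContinuousAt (fun t : ℝ => q + t • (y - q)) 0 := by fun_prop
  have hU' : ∀ᶠ t in nhdsWithin (0 : ℝ) (Ioi 0), q + t • (y - q) ∈ U :=
    (hcont.eventually (hU.mem_nhds (by simpa using hqU))).filter_mono nhdsWithin_le_nhds
  have h1 : ∀ᶠ t in nhdsWithin (0 : ℝ) (Ioi 0), t ∈ Ioo (0 : ℝ) 1 :=
    Ioo_mem_nhdsGT one_pos
  filter_upwards [hU', h1] with t htU ht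
  have hm : q + t • (y - q) ∈ {x ∈ U | ρ x < 0} := heq ▸
    ⟨add_smul_mem_of_mem_closure ho hc (frontier_subset_closure hq) hy ht.1 ht.2.le, htU⟩
  have : ρ (q + t • (y - q)) ≤ 0 := hm.2.le
  simp only [zero_add, zero_smul, add_zero, h0, sub_zero, smul_eq_mul]
  exact mul_nonpos_of_nonneg_of_nonpos (inv_nonneg.2 ht.1.le) this

/-- Since Ω is open, `y` may be pushed slightly along the gradient and stay in Ω. The weak
inequality at the pushed point exceeds the one at `y` by a positive multiple of `|∇ρ|²`. -/
theorem fderiv_neg (ho : IsOpen Ω) (hc : Convex ℝ Ω) (hq : q ∈ frontier Ω)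
    (h : IsLocalDefiningFunction Ω q ρ) {y : Space} (hy : y ∈ Ω) :
    fderiv ℝ ρ q (y - q) < 0 := by
  have hcont : ContinuousAt (fun t : ℝ => y + t • gradient ρ q) 0 := by fun_prop
  have hU' : ∀ᶠ t in nhdsWithin (0 : ℝ) (Ioi 0), y + t • gradient ρ q ∈ Ω :=
    (hcont.eventually (ho.mem_nhds (by simpa using hy))).filter_mono nhdsWithin_le_nhds
  obtain ⟨t, ht, ht0⟩ := (hU'.and self_mem_nhdsWithin).exists
  have h1 := h.fderiv_nonpos ho hc hq ht
  have h2 : y + t • gradient ρ q - q = (y - q) + t • gradient ρ q := by abel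
  rw [h2, map_add, map_smul, ← inner_gradient_left (y := gradient ρ q),
    real_inner_self_eq_norm_sq, smul_eq_mul] at h1
  have : 0 < t * ‖gradient ρ q‖ ^ 2 := mul_pos ht0 (by have := norm_pos_iff.2 h.gradient_ne_zero; positivity)
  linarith

end IsLocalDefiningFunction

/-- Second order Taylor lower bound along a segment. -/
theorem taylor_lower_bound {ρ : Space → ℝ} {U : Set Space} (hU : IsOpen U) (hρ : ContDiffOn ℝ 2 ρ U)
    {q w : Space} {m : ℝ} (hseg : ∀ t ∈ Icc (0 : ℝ) 1, q + t • w ∈ U)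
    (hm : ∀ t ∈ Icc (0 : ℝ) 1, m ≤ fderiv ℝ (fderiv ℝ ρ) (q + t • w) w w) :
    ρ q + fderiv ℝ ρ q w + m / 2 ≤ ρ (q + w) := by
  have hl : ∀ t : ℝ, HasDerivAt (fun t : ℝ => q + t • w) w t := fun t => by
    simpa using ((hasDerivAt_id t).smul_const w).const_add q
  have h1 : ∀ t ∈ Icc (0 : ℝ) 1, HasDerivAt (fun t : ℝ => ρ (q + t • w) - m / 2 * t ^ 2)
      (fderiv ℝ ρ (q + t • w) w - m * t) t := by
    intro t ht
    have hd := ((hρ.contDiffAt (hU.mem_nhds (hseg t ht))).differentiableAt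
      (by norm_num)).hasFDerivAt.comp_hasDerivAt t (hl t)
    refine (hd.fun_sub ((hasDerivAt_pow 2 t).const_mul (m / 2))).congr_deriv ?_
    norm_num
    ring
  have h2 : ∀ t ∈ Icc (0 : ℝ) 1, HasDerivAt (fun t : ℝ => fderiv ℝ ρ (q + t • w) w - m * t)
      (fderiv ℝ (fderiv ℝ ρ) (q + t • w) w w - m) t := by
    intro t ht
    have hd := (((hρ.fderiv_of_isOpen (m := 1) hU (by norm_num)).contDiffAt
      (hU.mem_nhds (hseg t ht))).differentiableAt
      (by norm_num)).hasFDerivAt.comp_hasDerivAt t (hl t)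
    have hd' := hd.clm_apply (hasDerivAt_const t w)
    exact (hd'.fun_sub ((hasDerivAt_id t).const_mul m)).congr_deriv (by simp)
  -- Along the segment the second derivative is at least `m`; subtracting `m t²/2` leaves a convex
  -- function, which lies above its tangent at 0.
  have hconv : ConvexOn ℝ (Icc (0 : ℝ) 1) (fun t : ℝ => ρ (q + t • w) - m / 2 * t ^ 2) := by
    refine convexOn_of_hasDerivWithinAt2_nonneg (convex_Icc _ _)
      (fun t ht => (h1 t ht).continuousAt.continuousWithinAt)
      (fun t ht => (h1 t (interior_subset ht)).hasDerivWithinAt)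
      (fun t ht => (h2 t (interior_subset ht)).hasDerivWithinAt)
      (fun t ht => by linarith [hm t (interior_subset ht)])
  have := hconv.le_slope_of_hasDerivAt (left_mem_Icc.2 zero_le_one) (right_mem_Icc.2 zero_le_one)
    one_pos (h1 0 (left_mem_Icc.2 zero_le_one))
  simp [slope_def_field] at this
  linarith

theorem taylor_upper_bound {ρ : Space → ℝ} {U : Set Space} (hU : IsOpen U) (hρ : ContDiffOn ℝ 2 ρ U)
    {q w : Space} {m : ℝ} (hseg : ∀ t ∈ Icc (0 : ℝ) 1, q + t • w ∈ U)
    (hm : ∀ t ∈ Icc (0 : ℝ) 1, fderiv ℝ (fderiv ℝ ρ) (q + t • w) w w ≤ m) :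
    ρ (q + w) ≤ ρ q + fderiv ℝ ρ q w + m / 2 := by
  have hf : fderiv ℝ (fun x => -ρ x) = fun x => -fderiv ℝ ρ x := by
    ext1 x; exact fderiv_fun_neg
  have := taylor_lower_bound (ρ := fun x => -ρ x) (m := -m) hU hρ.neg hseg (by
    intro t ht
    rw [hf, fderiv_fun_neg]
    simpa using hm t ht)
  rw [hf] at this
  simp at this
  linarith

/-- If the Hessian were negative on a tangent vector `w`, Taylor's formula would put `q + τw` and `q
- τw` in Ω for a small `τ`, and convexity would put their midpoint `q` in Ω. -/
theorem hessian_nonneg_of_tangent {Ω : Set Space} {q : Space} {ρ : Space → ℝ}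
    (ho : IsOpen Ω) (hc : Convex ℝ Ω) (hq : q ∈ frontier Ω)
    (h : IsLocalDefiningFunction Ω q ρ) {w : Space} (hw : fderiv ℝ ρ q w = 0) :
    0 ≤ fderiv ℝ (fderiv ℝ ρ) q w w := by
  have h0 := h.eq_zero ho hq
  obtain ⟨U, hU, hqU, hρ, -, heq⟩ := h
  by_contra! hneg
  have hH : ContinuousAt (fun z => fderiv ℝ (fderiv ℝ ρ) z w w) q := by
    have : ContinuousOn (fderiv ℝ (fderiv ℝ ρ)) U :=
      ((hρ.fderiv_of_isOpen (m := 1) hU (by norm_num)).continuousOn_fderiv_of_isOpen hU le_rfl)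
    have := this.continuousAt (hU.mem_nhds hqU)
    fun_prop
  have hev : ∀ᶠ z in nhds q, fderiv ℝ (fderiv ℝ ρ) z w w < fderiv ℝ (fderiv ℝ ρ) q w w / 2 ∧ z ∈ U :=
    (hH.eventually (gt_mem_nhds (by linarith))).and (hU.mem_nhds hqU)
  obtain ⟨r, hr, hball⟩ := Metric.eventually_nhds_iff_ball.1 hev
  obtain ⟨τ, hτ, hτw⟩ : ∃ τ : ℝ, 0 < τ ∧ τ * ‖w‖ < r := by
    refine ⟨r / (‖w‖ + 1) , by positivity, ?_⟩
    rw [div_mul_eq_mul_div, div_lt_iff₀ (by positivity)]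
    nlinarith [norm_nonneg w]
  have key : ∀ σ : ℝ, σ ^ 2 = τ ^ 2 → q + σ • w ∈ Ω := by
    intro σ hσ
    have habs : |σ| = τ := by rw [← abs_of_pos hτ]; exact (sq_eq_sq_iff_abs_eq_abs _ _).1 hσ
    have hin : ∀ t ∈ Icc (0 : ℝ) 1, q + t • (σ • w) ∈ Metric.ball q r := by
      intro t ht
      rw [Metric.mem_ball, dist_eq_norm, add_sub_cancel_left, norm_smul, norm_smul,
        Real.norm_eq_abs, Real.norm_eq_abs, habs, abs_of_nonneg ht.1]
      have : 0 ≤ τ * ‖w‖ := by positivity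
      nlinarith [ht.2]
    have hT := taylor_upper_bound (w := σ • w)
      (m := τ ^ 2 * (fderiv ℝ (fderiv ℝ ρ) q w w / 2)) hU hρ (fun t ht => (hball _ (hin t ht)).2)
      (by
        intro t ht
        have := (hball _ (hin t ht)).1
        simp only [map_smul, smul_apply, smul_eq_mul]
        rw [← mul_assoc, ← sq, hσ]
        exact mul_le_mul_of_nonneg_left this.le (sq_nonneg _))
    rw [map_smul, hw, h0, smul_zero] at hT
    have hlt : ρ (q + σ • w) < 0 := by
      have : τ ^ 2 * (fderiv ℝ (fderiv ℝ ρ) q w w / 2) < 0 := mul_neg_of_pos_of_neg (by positivity) (by linarith)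
      linarith
    have h1 := (hball _ (hin 1 (right_mem_Icc.2 zero_le_one))).2
    rw [one_smul] at h1
    have : q + σ • w ∈ Ω ∩ U := heq.symm ▸ ⟨h1, hlt⟩
    exact this.1
  have := hc (key τ rfl) (key (-τ) (by ring)) (by norm_num : (0:ℝ) ≤ 1/2) (by norm_num : (0:ℝ) ≤ 1/2) (by norm_num)
  refine notMem_of_mem_frontier ho hq ?_
  convert this using 1
  module

/-- In a tangent frame `u, w` with `D²ρ(u,u) = 0` the determinant of the second fundamental form is
minus a square, contradicting positive curvature. A nonnegative and nonzero value is positive. -/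
theorem hessian_pos_of_tangent {Ω : Set Space} {q : Space} {ρ : Space → ℝ}
    (ho : IsOpen Ω) (hc : Convex ℝ Ω) (hq : q ∈ frontier Ω)
    (h : IsLocalDefiningFunction Ω q ρ)
    (hk : ∀ u w : Space, IsTangentFrame ρ q u w → 0 < gaussianCurvature ρ q u w)
    {u : Space} (hu : ‖u‖ = 1) (hut : fderiv ℝ ρ q u = 0) :
    0 < fderiv ℝ (fderiv ℝ ρ) q u u := by
  -- `u` and the gradient span at most a plane in three-space, so a unit vector orthogonal to both
  -- completes the frame.
  obtain ⟨w, hw1, hwu, hwt⟩ : ∃ w : Space, ‖w‖ = 1 ∧ inner ℝ u w = 0 ∧ inner ℝ (gradient ρ q) w = 0 := by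
    set S : Submodule ℝ Space := Submodule.span ℝ {u, gradient ρ q} with hS
    have hfin : Module.finrank ℝ S ≤ 2 := by
      classical
      have := finrank_span_finset_le_card (R := ℝ) ({u, gradient ρ q} : Finset Space)
      rw [Finset.coe_pair] at this
      exact this.trans Finset.card_le_two
    have hsum := S.finrank_add_finrank_orthogonal
    have h3 : Module.finrank ℝ Space = 3 := by simp [Space]
    have hpos : 0 < Module.finrank ℝ Sᗮ := by omega
    have := Module.finrank_pos_iff.1 hpos
    obtain ⟨⟨w, hwS⟩, hw⟩ := exists_ne (0 : Sᗮ)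
    have hw0 : w ≠ 0 := fun h => hw (Subtype.ext h)
    have hin : ∀ x ∈ S, inner ℝ x w = 0 := fun x hx => (S.mem_orthogonal w).1 hwS x hx
    refine ⟨‖w‖⁻¹ • w, norm_smul_inv_norm hw0, ?_, ?_⟩
    · rw [inner_smul_right, hin u (Submodule.subset_span (by simp)), mul_zero]
    · rw [inner_smul_right, hin _ (Submodule.subset_span (by simp)), mul_zero]
  have hframe : IsTangentFrame ρ q u w := by
    refine ⟨?_, by rw [inner_gradient_left, hut], hwt⟩
    rw [orthonormal_iff_ite]
    intro i j
    fin_cases i <;> fin_cases j <;> simp [hu, hw1, hwu, real_inner_comm u w]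
  have hcurv := hk u w hframe
  have hu0 := hessian_nonneg_of_tangent ho hc hq h hut
  refine lt_of_le_of_ne hu0 fun heq => ?_
  rw [gaussianCurvature, secondFundamentalForm, ← heq, zero_div, zero_mul, zero_sub] at hcurv
  nlinarith [sq_nonneg (secondFundamentalForm ρ q u w)]

/-- A quadratic form that is positive on the kernel of `φ` becomes positive definite after adding a
large multiple of `φ²`. -/
theorem exists_pos_quadratic_lower_bound (H : Space →L[ℝ] Space →L[ℝ] ℝ) (φ : Space →L[ℝ] ℝ)
    (h : ∀ u : Space, ‖u‖ = 1 → φ u = 0 → 0 < H u u) :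
    ∃ c l : ℝ, 0 < c ∧ 0 ≤ l ∧ ∀ w : Space, c * ‖w‖ ^ 2 ≤ H w w + l * φ w ^ 2 := by
  have hS : IsCompact (Metric.sphere (0 : Space) 1) := isCompact_sphere _ _
  have hcH : Continuous fun w : Space => H w w := by fun_prop
  -- On the compact part of the sphere where `H` is nonpositive, `φ` does not vanish, so `φ² ≥ m >
  -- 0` there. The multiplier `(‖H‖ + 1)/m` then outweighs `H`.
  have hK : IsCompact (Metric.sphere (0 : Space) 1 ∩ {w | H w w ≤ 0}) :=
    hS.inter_right (isClosed_le hcH continuous_const)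
  obtain ⟨m, hm, hmK⟩ := hK.exists_forall_le' (f := fun w => φ w ^ 2) (a := 0) (by fun_prop) (by
    rintro w ⟨hw, hw2⟩
    rcases eq_or_ne (φ w) 0 with h0 | h0
    · exact absurd (h w (by simpa using hw) h0) (not_lt.2 hw2)
    · positivity)
  set M := ‖H‖ + 1 with hM
  have hpos : ∀ w ∈ Metric.sphere (0 : Space) 1, 0 < H w w + M / m * φ w ^ 2 := by
    intro w hw
    have hw1 : ‖w‖ = 1 := by simpa using hw
    by_cases hw2 : H w w ≤ 0
    · have h1 := hmK w ⟨hw, hw2⟩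
      have h2 : |H w w| ≤ ‖H‖ := by
        simpa [hw1] using H.le_opNorm₂ w w
      have h3 : M ≤ M / m * φ w ^ 2 := by
        rw [div_mul_eq_mul_div, le_div_iff₀ hm]
        exact mul_le_mul_of_nonneg_left h1 (by positivity)
      have := neg_abs_le (H w w)
      linarith
    · have : 0 ≤ M / m * φ w ^ 2 := by positivity
      push Not at hw2
      linarith
  obtain ⟨c, hc, hcS⟩ := hS.exists_forall_le' (f := fun w => H w w + M / m * φ w ^ 2) (a := 0)
    (by fun_prop) hpos
  refine ⟨c, M / m, hc, by positivity, fun w => ?_⟩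
  rcases eq_or_ne w 0 with rfl | hw
  · simp
  · have hn : 0 < ‖w‖ := norm_pos_iff.2 hw
    have := hcS (‖w‖⁻¹ • w) (by simp [norm_smul, hn.ne'])
    simp only [map_smul, smul_apply, smul_eq_mul] at this
    field_simp at this
    have h2 : H w w + M / m * φ w ^ 2 = (m * H w w + M * φ w ^ 2) / m := by field_simp
    rw [h2, le_div_iff₀ hm]
    nlinarith

theorem eventually_norm_sub_lt {X F : Type*} [TopologicalSpace X] [NormedAddCommGroup F]
    {f : X → F} {q : X} (h : ContinuousAt f q) {ε : ℝ} (hε : 0 < ε) :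
    ∀ᶠ z in nhds q, ‖f z - f q‖ < ε := by
  simpa [dist_eq_norm] using Metric.continuousAt_iff'.1 h ε hε

/-- The form `D²ρ(q₀) + l dρ(q₀)²` is positive definite, and by continuity almost the same bound
holds near `q₀` with `dρ` taken at a nearby boundary point `q`. Taylor's formula for `ρ(y) < 0` then
bounds `|y-q|²` by `-dρ(q)(y-q)`, once the square of this differential is absorbed into its first
power. -/
theorem exists_local_quadratic_support {Ω : Set Space} (hΩ : IsPositivelyCurvedDomain Ω) {q₀ : Space}
    (hq₀ : q₀ ∈ frontier Ω) :
    ∃ r c : ℝ, 0 < r ∧ 0 < c ∧ ∀ q ∈ frontier Ω, dist q q₀ < r → ∃ n : Space, ‖n‖ = 1 ∧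
      ∀ y ∈ Ω, ‖y - q‖ ≤ r → c * ‖y - q‖ ^ 2 ≤ inner ℝ n (q - y) := by
  obtain ⟨ρ, hdef, hk⟩ := hΩ.positive_curvature q₀ hq₀
  have ho := hΩ.isOpen
  have hc := hΩ.convex
  have hpos := fun (u : Space) hu hut => hessian_pos_of_tangent (u := u) ho hc hq₀ hdef hk hu hut
  obtain ⟨c, l, hc0, hl, hquad⟩ := exists_pos_quadratic_lower_bound _ _ hpos
  obtain ⟨U, hU, hqU, hρ, hgrad, heq⟩ := hdef
  have hφc : ContinuousAt (fderiv ℝ ρ) q₀ :=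
    (hρ.fderiv_of_isOpen (m := 1) hU (by norm_num)).continuousOn.continuousAt (hU.mem_nhds hqU)
  have hHc : ContinuousAt (fderiv ℝ (fderiv ℝ ρ)) q₀ :=
    ((hρ.fderiv_of_isOpen (m := 1) hU (by norm_num)).continuousOn_fderiv_of_isOpen hU
      le_rfl).continuousAt (hU.mem_nhds hqU)
  set A : Space → Space →L[ℝ] Space →L[ℝ] ℝ := fun z =>
    l • (fderiv ℝ ρ z).smulRight (fderiv ℝ ρ z) with hA
  have hAc : ContinuousAt A q₀ := by
    have h2 : ContinuousAt (fun z => ContinuousLinearMap.smulRightL ℝ Space (Space →L[ℝ] ℝ)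
        (fderiv ℝ ρ z) (fderiv ℝ ρ z)) q₀ :=
      (((ContinuousLinearMap.smulRightL ℝ Space (Space →L[ℝ] ℝ)).continuous.continuousAt).comp hφc).clm_apply hφc
    exact h2.const_smul l
  have e1 := eventually_norm_sub_lt (F := Space →L[ℝ] Space →L[ℝ] ℝ) hHc (by positivity : 0 < c / 4)
  have e2 := eventually_norm_sub_lt (F := Space →L[ℝ] Space →L[ℝ] ℝ) hAc (by positivity : 0 < c / 4)
  have e3 := (Metric.continuousAt_iff'.1 hφc) 1 one_pos
  obtain ⟨R, hR, hball⟩ := Metric.eventually_nhds_iff_ball.1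
    (((e1.and e2).and e3).and (hU.mem_nhds hqU))
  set G := ‖fderiv ℝ ρ q₀‖ + 1 with hG
  have hG0 : 0 < G := by positivity
  -- `R/2` keeps the segments inside the ball where the continuity estimates hold; `2/(lG+1)` gives
  -- `l G r ≤ 2`, which absorbs the quadratic term `l p²`.
  set r := min (R / 2) (2 / (l * G + 1)) with hr
  have hr0 : 0 < r := by positivity
  have hlr : l * G * r ≤ 2 := by
    have h1 : r ≤ 2 / (l * G + 1) := min_le_right _ _
    have h2 : 0 ≤ l * G := by positivity
    calc l * G * r ≤ (l * G + 1) * r := by nlinarith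
      _ ≤ (l * G + 1) * (2 / (l * G + 1)) := by gcongr
      _ = 2 := by field_simp
  refine ⟨r, c / (8 * G), hr0, by positivity, fun q hq hqr => ?_⟩
  have hrR : r ≤ R / 2 := min_le_left _ _
  have hqB : q ∈ Metric.ball q₀ R := by
    rw [Metric.mem_ball]; linarith
  obtain ⟨⟨⟨-, hAq⟩, hφq⟩, hqU'⟩ := hball q hqB
  have hdefq : IsLocalDefiningFunction Ω q ρ := ⟨U, hU, hqU', hρ, hgrad, heq⟩
  have hφG : ‖fderiv ℝ ρ q‖ ≤ G := by
    have := norm_sub_norm_le (fderiv ℝ ρ q) (fderiv ℝ ρ q₀)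
    rw [dist_eq_norm] at hφq
    linarith
  have hgn : ‖gradient ρ q‖ = ‖fderiv ℝ ρ q‖ := by
    rw [← toDual_gradient, LinearIsometryEquiv.norm_map]
  have hg0 : 0 < ‖gradient ρ q‖ := norm_pos_iff.2 hdefq.gradient_ne_zero
  refine ⟨‖gradient ρ q‖⁻¹ • gradient ρ q, norm_smul_inv_norm (𝕜 := ℝ) hdefq.gradient_ne_zero,
    fun y hy hyr => ?_⟩
  set w := y - q with hw
  have hneg := hdefq.fderiv_nonpos ho hc hq hy
  rw [← hw] at hneg
  set p := fderiv ℝ ρ q w with hp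
  have hseg : ∀ t ∈ Icc (0 : ℝ) 1, q + t • w ∈ Metric.ball q₀ R := by
    intro t ht
    rw [Metric.mem_ball]
    calc dist (q + t • w) q₀ ≤ dist (q + t • w) q + dist q q₀ := dist_triangle _ _ _
      _ = t * ‖w‖ + dist q q₀ := by
        rw [dist_eq_norm, add_sub_cancel_left, norm_smul, Real.norm_of_nonneg ht.1]
      _ < r + r := by nlinarith [ht.1, ht.2, norm_nonneg w]
      _ ≤ R := by linarith
  -- Replacing the Hessian at `q + tw` by the one at `q₀`, and `dρ(q)²` by `dρ(q₀)²`, costs `c/4`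
  -- each, so `c/2` of the constant `c` remains.
  have hT := taylor_lower_bound (q := q) (w := w) (m := c / 2 * ‖w‖ ^ 2 - l * p ^ 2) hU hρ
    (fun t ht => (hball _ (hseg t ht)).2) (by
      intro t ht
      obtain ⟨⟨⟨hHt, -⟩, -⟩, -⟩ := hball _ (hseg t ht)
      have b1 := (abs_le.1 ((fderiv ℝ (fderiv ℝ ρ) (q + t • w) -
        fderiv ℝ (fderiv ℝ ρ) q₀).le_opNorm₂ w w)).1
      have b2 := (abs_le.1 ((A q - A q₀).le_opNorm₂ w w)).1
      simp only [sub_apply] at b1 b2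
      have b3 : ∀ z, A z w w = l * fderiv ℝ ρ z w ^ 2 := by
        intro z
        simp only [hA, smul_apply, ContinuousLinearMap.smulRight_apply, smul_eq_mul]
        ring
      rw [b3, b3, ← hp] at b2
      have b4 := hquad w
      have b5 : ‖fderiv ℝ (fderiv ℝ ρ) (q + t • w) - fderiv ℝ (fderiv ℝ ρ) q₀‖ * ‖w‖ * ‖w‖
          ≤ c / 4 * ‖w‖ * ‖w‖ := by gcongr
      have b6 : ‖A q - A q₀‖ * ‖w‖ * ‖w‖ ≤ c / 4 * ‖w‖ * ‖w‖ := by gcongr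
      nlinarith)
  have hy0 : ρ (q + w) < 0 := by
    have h1 := (hball _ (hseg 1 (right_mem_Icc.2 zero_le_one))).2
    rw [one_smul] at h1
    have hyw : q + w = y := by rw [hw]; abel
    rw [hyw] at h1 ⊢
    have : y ∈ {x ∈ U | ρ x < 0} := heq ▸ ⟨hy, h1⟩
    exact this.2
  rw [hdefq.eq_zero ho hq, ← hp] at hT
  have hpG : -p ≤ G * r := by
    have h1 := (fderiv ℝ ρ q).le_opNorm w
    rw [← hp, Real.norm_eq_abs, abs_of_nonpos hneg] at h1
    exact h1.trans (mul_le_mul hφG hyr (norm_nonneg _) hG0.le)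
  -- With `|p| ≤ G r` one has `l p² ≤ 2(-p)`. The Taylor bound `p + (c/2 |w|² - l p²)/2 < 0` becomes
  -- `c/4 |w|² < -2p`.
  have hkey : c / 8 * ‖w‖ ^ 2 ≤ -p := by
    have : l * p ^ 2 ≤ 2 * (-p) := by
      calc l * p ^ 2 = l * (-p) * (-p) := by ring
        _ ≤ l * (G * r) * (-p) := by gcongr; linarith
        _ = (l * G * r) * (-p) := by ring
        _ ≤ 2 * (-p) := by gcongr; linarith
    nlinarith
  have hinner : inner ℝ (‖gradient ρ q‖⁻¹ • gradient ρ q) (q - y) = ‖gradient ρ q‖⁻¹ * (-p) := by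
    rw [real_inner_smul_left, inner_gradient_left, hp, ← map_neg, hw, neg_sub]
  rw [hinner]
  calc c / (8 * G) * ‖w‖ ^ 2 = G⁻¹ * (c / 8 * ‖w‖ ^ 2) := by field_simp
    _ ≤ ‖gradient ρ q‖⁻¹ * (-p) := by
      have : G⁻¹ ≤ ‖gradient ρ q‖⁻¹ := inv_anti₀ hg0 (hgn ▸ hφG)
      gcongr

/-- A positively curved domain lies, at each of its boundary points, inside a paraboloid of uniform
aperture. -/
theorem exists_quadratic_support {Ω : Set Space} (hΩ : IsPositivelyCurvedDomain Ω) :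
    ∃ c : ℝ, 0 < c ∧ ∀ q ∈ frontier Ω, ∃ n : Space, ‖n‖ = 1 ∧
      ∀ y ∈ Ω, c * ‖y - q‖ ^ 2 ≤ inner ℝ n (q - y) := by
  have ho := hΩ.isOpen
  have hcv := hΩ.convex
  have hcpt : IsCompact (frontier Ω) :=
    hΩ.isBounded.isCompact_closure.of_isClosed_subset isClosed_frontier frontier_subset_closure
  obtain ⟨d, hd⟩ := Metric.isBounded_iff.1 hΩ.isBounded.closure
  -- The repeated condition is needed by the compactness induction, where the first occurrence
  -- becomes membership in an arbitrary subset.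
  have main : ∃ c : ℝ, 0 < c ∧ ∀ q ∈ frontier Ω, q ∈ frontier Ω → ∃ n : Space, ‖n‖ = 1 ∧
      ∀ y ∈ Ω, c * ‖y - q‖ ^ 2 ≤ inner ℝ n (q - y) := by
    refine hcpt.induction_on (p := fun s => ∃ c : ℝ, 0 < c ∧ ∀ q ∈ s, q ∈ frontier Ω →
      ∃ n : Space, ‖n‖ = 1 ∧ ∀ y ∈ Ω, c * ‖y - q‖ ^ 2 ≤ inner ℝ n (q - y)) ⟨1, one_pos, by simp⟩
      ?_ ?_ ?_
    · rintro s t hst ⟨c, hc, h⟩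
      exact ⟨c, hc, fun q hq => h q (hst hq)⟩
    · rintro s t ⟨c, hc, h⟩ ⟨c', hc', h'⟩
      refine ⟨min c c', lt_min hc hc', ?_⟩
      rintro q (hq | hq) hqf
      · obtain ⟨n, hn, hy⟩ := h q hq hqf
        refine ⟨n, hn, fun y hyΩ => le_trans ?_ (hy y hyΩ)⟩
        gcongr
        exact min_le_left _ _
      · obtain ⟨n, hn, hy⟩ := h' q hq hqf
        refine ⟨n, hn, fun y hyΩ => le_trans ?_ (hy y hyΩ)⟩
        gcongr
        exact min_le_right _ _
    · intro q₀ hq₀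
      obtain ⟨r, c, hr, hc, h⟩ := exists_local_quadratic_support hΩ hq₀
      refine ⟨Metric.ball q₀ r, mem_nhdsWithin_of_mem_nhds (Metric.ball_mem_nhds _ hr),
        c * (r / (r + |d|)), by positivity, fun q hq hqf => ?_⟩
      obtain ⟨n, hn, hy⟩ := h q hqf hq
      refine ⟨n, hn, fun y hyΩ => ?_⟩
      have hle1 : r / (r + |d|) ≤ 1 := by
        rw [div_le_one (by positivity)]; linarith [abs_nonneg d]
      rcases le_or_gt ‖y - q‖ r with hyr | hyr
      · refine le_trans ?_ (hy y hyΩ hyr)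
        gcongr
        exact mul_le_of_le_one_right hc.le hle1
      -- A far point is pulled back along the segment to distance `r` from `q`. The local bound
      -- there gives `c r|y-q| ≤ n·(q-y)`, and the diameter turns this linear bound into a quadratic
      -- one.
      · have hw0 : 0 < ‖y - q‖ := hr.trans hyr
        have hwd : ‖y - q‖ ≤ |d| := by
          rw [← dist_eq_norm]
          exact (hd (subset_closure hyΩ) (frontier_subset_closure hqf)).trans (le_abs_self d)
        set t := r / ‖y - q‖ with ht
        have ht0 : 0 < t := by positivity
        have ht1 : t ≤ 1 := by rw [ht, div_le_one hw0]; exact hyr.le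
        have hmem := add_smul_mem_of_mem_closure ho hcv (frontier_subset_closure hqf) hyΩ ht0 ht1
        have hnorm : ‖q + t • (y - q) - q‖ = r := by
          rw [add_sub_cancel_left, norm_smul, Real.norm_of_nonneg ht0.le, ht]
          field_simp
        have := hy _ hmem hnorm.le
        have hin : inner ℝ n (q - (q + t • (y - q))) = t * inner ℝ n (q - y) := by
          rw [← inner_smul_right]
          congr 1
          module
        rw [hnorm, hin, ht, div_mul_eq_mul_div, le_div_iff₀ hw0] at this
        have h3 : c * r * ‖y - q‖ ≤ inner ℝ n (q - y) := by
          have : r * (c * r * ‖y - q‖) ≤ r * inner ℝ n (q - y) := by linarith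
          exact le_of_mul_le_mul_left this hr
        refine le_trans ?_ h3
        calc c * (r / (r + |d|)) * ‖y - q‖ ^ 2
            = c * r * ‖y - q‖ * (‖y - q‖ / (r + |d|)) := by ring
          _ ≤ c * r * ‖y - q‖ * 1 := by
            gcongr
            rw [div_le_one (by positivity)]
            linarith
          _ = _ := mul_one _
  obtain ⟨c, hc, h⟩ := main
  exact ⟨c, hc, fun q hq => h q hq hq⟩

/-- Strong convexity: a point of a chord is far from the complement of the domain. -/
theorem exists_strong_convexity {Ω : Set Space} (hΩ : IsPositivelyCurvedDomain Ω) :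
    ∃ c : ℝ, 0 < c ∧ ∀ x ∈ closure Ω, ∀ y ∈ closure Ω, ∀ z ∉ Ω, ∀ t ∈ Icc (0 : ℝ) 1,
      c * (t * (1 - t)) * ‖x - y‖ ^ 2 ≤ ‖(1 - t) • x + t • y - z‖ := by
  obtain ⟨c, hc, h⟩ := exists_quadratic_support hΩ
  refine ⟨c, hc, fun x hx y hy z hz t ht => ?_⟩
  set m := (1 - t) • x + t • y with hm
  -- The segment from `m` to `z` starts in the closure and ends outside Ω, so by connectedness it
  -- meets the boundary no farther from `m` than `z`.
  obtain ⟨q, hq, hqm⟩ : ∃ q ∈ frontier Ω, ‖m - q‖ ≤ ‖m - z‖ := by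
    have hmc : m ∈ closure Ω :=
      hΩ.convex.closure hx hy (sub_nonneg.2 ht.2) ht.1 (by ring)
    by_cases hmΩ : m ∈ Ω
    · have hseg : IsPreconnected (segment ℝ m z) := (convex_segment m z).isPreconnected
      have := isPreconnected_closed_iff.1 hseg (closure Ω) Ωᶜ isClosed_closure
        hΩ.isOpen.isClosed_compl (fun w _ => by
          by_cases hw : w ∈ Ω
          · exact Or.inl (subset_closure hw)
          · exact Or.inr hw)
        ⟨m, left_mem_segment _ _ _, hmc⟩ ⟨z, right_mem_segment _ _ _, hz⟩
      obtain ⟨q, hq1, hq2⟩ := this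
      refine ⟨q, by rw [hΩ.isOpen.frontier_eq]; exact hq2, ?_⟩
      obtain ⟨a, b, ha, hb, hab, rfl⟩ := hq1
      have : m - (a • m + b • z) = b • (m - z) := by
        rw [show a = 1 - b by linarith]; module
      rw [this, norm_smul, Real.norm_of_nonneg hb]
      exact mul_le_of_le_one_left (norm_nonneg _) (by linarith)
    · refine ⟨m, ?_, by simp⟩
      rw [hΩ.isOpen.frontier_eq]
      exact ⟨hmc, hmΩ⟩
  obtain ⟨n, hn, hy'⟩ := h q hq
  have hcl : ∀ y ∈ closure Ω, c * ‖y - q‖ ^ 2 ≤ inner ℝ n (q - y) := by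
    have hclosed : IsClosed {y : Space | c * ‖y - q‖ ^ 2 ≤ inner ℝ n (q - y)} :=
      isClosed_le (by fun_prop) (by fun_prop)
    exact fun y hy => closure_minimal hy' hclosed hy
  have hx1 := mul_le_mul_of_nonneg_left (hcl x hx) (sub_nonneg.2 ht.2)
  have hy1 := mul_le_mul_of_nonneg_left (hcl y hy) ht.1
  have hinn : (1 - t) * inner ℝ n (q - x) + t * inner ℝ n (q - y) = inner ℝ n (q - m) := by
    rw [← inner_smul_right, ← inner_smul_right, ← inner_add_right, hm]
    congr 1
    module
  have hle : inner ℝ n (q - m) ≤ ‖m - q‖ := by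
    have := real_inner_le_norm n (q - m)
    rwa [hn, one_mul, norm_sub_rev] at this
  -- This identity for the variance of a two-point distribution turns the averaged paraboloid bounds
  -- at `x` and `y` into the term `t(1-t)|x-y|²`.
  have hid : (1 - t) * ‖x - q‖ ^ 2 + t * ‖y - q‖ ^ 2 =
      ‖(1 - t) • (x - q) + t • (y - q)‖ ^ 2 + t * (1 - t) * ‖x - y‖ ^ 2 := by
    have hxy : x - y = (x - q) - (y - q) := by abel
    rw [hxy]
    generalize x - q = v
    generalize y - q = w
    rw [norm_add_sq_real, norm_sub_sq_real, norm_smul, norm_smul, real_inner_smul_left,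
      real_inner_smul_right, mul_pow, mul_pow, Real.norm_eq_abs, Real.norm_eq_abs, sq_abs, sq_abs]
    ring
  have h0 := mul_nonneg hc.le (sq_nonneg ‖(1 - t) • (x - q) + t • (y - q)‖)
  calc c * (t * (1 - t)) * ‖x - y‖ ^ 2
      ≤ c * ((1 - t) * ‖x - q‖ ^ 2 + t * ‖y - q‖ ^ 2) := by rw [hid]; nlinarith
    _ ≤ inner ℝ n (q - m) := by rw [← hinn]; linarith
    _ ≤ ‖m - z‖ := hle.trans hqm

/-! ### The backward exit time -/

section ExitTime

variable {Ω : Set Space} {x v : Space}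

/-- By convexity the nonnegative times spent in Ω form an interval, and by openness it excludes its
endpoint. Exit times are used below mostly through this equivalence. -/
theorem sub_smul_mem_iff_lt_exitTime (ho : IsOpen Ω) (hc : Convex ℝ Ω)
    (hb : Bornology.IsBounded Ω) (hx : x ∈ Ω) (hv : v ≠ 0) {t : ℝ} (ht : 0 ≤ t) :
    x - t • v ∈ Ω ↔ t < exitTime Ω x v := by
  have hbdd : BddBelow {t : ℝ | 0 < t ∧ x - t • v ∉ Ω} := ⟨0, fun s hs => hs.1.le⟩
  have hne : {t : ℝ | 0 < t ∧ x - t • v ∉ Ω}.Nonempty := by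
    obtain ⟨d, hd⟩ := Metric.isBounded_iff.1 hb
    have hv0 := norm_pos_iff.2 hv
    refine ⟨(|d| + 1) / ‖v‖, by positivity, fun h => ?_⟩
    have := hd hx h
    rw [dist_eq_norm, sub_sub_cancel, norm_smul, Real.norm_of_nonneg (by positivity),
      div_mul_cancel₀ _ hv0.ne'] at this
    linarith [le_abs_self d]
  constructor
  · intro h
    have hcont : ContinuousAt (fun s : ℝ => x - s • v) t := by fun_prop
    obtain ⟨ε, hε, hball⟩ := Metric.eventually_nhds_iff.1 (hcont.eventually (ho.mem_nhds h))
    refine lt_of_lt_of_le (by linarith : t < t + ε) (le_csInf hne fun s hs => ?_)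
    by_contra! hlt
    refine hs.2 ?_
    rcases le_or_gt s t with hst | hst
    · have h0 : 0 < t := hs.1.trans_le hst
      have := hc hx h (a := 1 - s / t) (b := s / t)
        (sub_nonneg.2 (div_le_one_of_le₀ hst ht)) (div_nonneg hs.1.le ht) (by ring)
      convert this using 1
      have h1 : s = s / t * t := by field_simp
      nth_rewrite 1 [h1]
      module
    · exact hball (by rw [Real.dist_eq, abs_of_pos] <;> linarith)
  · intro h
    by_contra hn
    have ht0 : 0 < t := by
      refine lt_of_le_of_ne ht fun h0 => hn ?_
      simpa [← h0] using hx
    exact absurd (csInf_le hbdd ⟨ht0, hn⟩) (not_le.2 h)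

theorem exitTime_pos (ho : IsOpen Ω) (hc : Convex ℝ Ω)
    (hb : Bornology.IsBounded Ω) (hx : x ∈ Ω) (hv : v ≠ 0) : 0 < exitTime Ω x v :=
  (sub_smul_mem_iff_lt_exitTime ho hc hb hx hv le_rfl).1 (by simpa using hx)

theorem exitTime_nonneg : 0 ≤ exitTime Ω x v := Real.sInf_nonneg fun _ ht => ht.1.le

theorem exitPoint_mem_frontier (ho : IsOpen Ω) (hc : Convex ℝ Ω)
    (hb : Bornology.IsBounded Ω) (hx : x ∈ Ω) (hv : v ≠ 0) : exitPoint Ω x v ∈ frontier Ω := by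
  have hpos := exitTime_pos ho hc hb hx hv
  rw [ho.frontier_eq]
  constructor
  · have ht : Filter.Tendsto (fun t : ℝ => x - t • v) (nhdsWithin (exitTime Ω x v) (Iio (exitTime Ω x v)))
        (nhds (exitPoint Ω x v)) := by
      have : ContinuousAt (fun t : ℝ => x - t • v) (exitTime Ω x v) := by fun_prop
      exact this.tendsto.mono_left nhdsWithin_le_nhds
    refine mem_closure_of_tendsto ht ?_
    filter_upwards [Ioo_mem_nhdsLT hpos] with t ht
    exact (sub_smul_mem_iff_lt_exitTime ho hc hb hx hv ht.1.le).2 ht.2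
  · intro h
    exact lt_irrefl _ ((sub_smul_mem_iff_lt_exitTime ho hc hb hx hv hpos.le).1 h)

theorem exitTime_mul_norm_le (ho : IsOpen Ω) (hc : Convex ℝ Ω)
    (hb : Bornology.IsBounded Ω) (hx : x ∈ Ω) (hv : v ≠ 0) {d : ℝ}
    (hd : ∀ y ∈ closure Ω, ∀ z ∈ closure Ω, ‖y - z‖ ≤ d) :
    exitTime Ω x v * ‖v‖ ≤ d := by
  have := hd x (subset_closure hx) _
    (frontier_subset_closure (exitPoint_mem_frontier ho hc hb hx hv))
  rwa [exitPoint, sub_sub_cancel, norm_smul, Real.norm_of_nonneg exitTime_nonneg] at this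

theorem exitTime_smul (ho : IsOpen Ω) (hc : Convex ℝ Ω)
    (hb : Bornology.IsBounded Ω) (hx : x ∈ Ω) (hv : v ≠ 0) {r : ℝ} (hr : 0 < r) :
    exitTime Ω x (r • v) = exitTime Ω x v / r := by
  have hrv : r • v ≠ 0 := smul_ne_zero hr.ne' hv
  have key : ∀ t : ℝ, 0 ≤ t → (t < exitTime Ω x (r • v) ↔ t < exitTime Ω x v / r) := by
    intro t ht
    rw [← sub_smul_mem_iff_lt_exitTime ho hc hb hx hrv ht, lt_div_iff₀ hr,
      ← sub_smul_mem_iff_lt_exitTime ho hc hb hx hv (by positivity), smul_smul]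
  have h1 : 0 ≤ exitTime Ω x v / r := div_nonneg exitTime_nonneg hr.le
  apply le_antisymm
  · by_contra! h
    exact lt_irrefl _ ((key _ h1).1 h)
  · by_contra! h
    exact lt_irrefl _ ((key _ exitTime_nonneg).2 h)

/-- The vector from the exit point to `x` is `τ v`, and the defining function strictly decreases
towards interior points; hence `n·v < 0`, never tangential. -/
theorem exitPoint_mem_incomingBoundary (hΩ : IsPositivelyCurvedDomain Ω) (hx : x ∈ Ω) (hv : v ≠ 0) :
    (exitPoint Ω x v, v) ∈ incomingBoundary Ω := by
  have hq := exitPoint_mem_frontier hΩ.isOpen hΩ.convex hΩ.isBounded hx hv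
  obtain ⟨ρ, hρ, -⟩ := hΩ.positive_curvature _ hq
  refine ⟨hq, _, ⟨ρ, hρ, rfl⟩, ?_⟩
  have h1 := hρ.fderiv_neg hΩ.isOpen hΩ.convex hq hx
  have h2 : x - exitPoint Ω x v = exitTime Ω x v • v := by rw [exitPoint, sub_sub_cancel]
  rw [h2, map_smul, smul_eq_mul] at h1
  have h3 : fderiv ℝ ρ (exitPoint Ω x v) v < 0 := by
    by_contra! h
    exact absurd (mul_nonneg exitTime_nonneg h) (not_le.2 h1)
  simp only [real_inner_smul_left, inner_gradient_left]
  exact mul_neg_of_pos_of_neg (inv_pos.2 (norm_pos_iff.2 hρ.gradient_ne_zero)) h3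

/-- Length of the chord of `Ω` through `x` in the direction of the unit vector `ω`. -/
def chordLength (Ω : Set Space) (ω x : Space) : ℝ := exitTime Ω x ω + exitTime Ω x (-ω)

theorem chordLength_pos (ho : IsOpen Ω) (hc : Convex ℝ Ω)
    (hb : Bornology.IsBounded Ω) (hx : x ∈ Ω) (hv : v ≠ 0) : 0 < chordLength Ω v x :=
  add_pos (exitTime_pos ho hc hb hx hv) (exitTime_pos ho hc hb hx (neg_ne_zero.2 hv))

/-- The height of the exit point along `ω` is `x·ω - τ(x,ω)`. If the chord through `y` reaches lower
by `D`, it contains a point at the height of the exit point of `x`. Strong convexity keeps this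
point away from the complement, while its distance from that exit point is only `O(|x-y|)`. -/
theorem height_difference_mul_chordLength_le (ho : IsOpen Ω) (hcv : Convex ℝ Ω)
    (hb : Bornology.IsBounded Ω) {c : ℝ} (hc : 0 < c)
    (hsc : ∀ x ∈ closure Ω, ∀ y ∈ closure Ω, ∀ z ∉ Ω, ∀ t ∈ Icc (0 : ℝ) 1,
      c * (t * (1 - t)) * ‖x - y‖ ^ 2 ≤ ‖(1 - t) • x + t • y - z‖)
    {ω y : Space} (hω : ‖ω‖ = 1) (hx : x ∈ Ω) (hy : y ∈ Ω)
    (hlt : inner ℝ y ω - exitTime Ω y ω < inner ℝ x ω - exitTime Ω x ω) :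
    ((inner ℝ x ω - exitTime Ω x ω) - (inner ℝ y ω - exitTime Ω y ω)) * chordLength Ω ω y ≤
      8 / c * ‖x - y‖ := by
  have hω0 : ω ≠ 0 := norm_ne_zero_iff.1 (by rw [hω]; exact one_ne_zero)
  have hω0' : -ω ≠ 0 := neg_ne_zero.2 hω0
  set Ax := inner ℝ x ω - exitTime Ω x ω with hAx
  set Ay := inner ℝ y ω - exitTime Ω y ω with hAy
  set D := Ax - Ay with hD
  set L := chordLength Ω ω y with hL
  have hD0 : 0 < D := sub_pos.2 hlt
  have hL0 : 0 < L := chordLength_pos ho hcv hb hy hω0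
  have hωω : inner ℝ ω ω = (1 : ℝ) := by rw [real_inner_self_eq_norm_sq, hω]; norm_num
  have hqx := exitPoint_mem_frontier ho hcv hb hx hω0
  have hqy := exitPoint_mem_frontier ho hcv hb hy hω0
  have hpy := exitPoint_mem_frontier ho hcv hb hy hω0'
  -- `P` is the component of `y - x` orthogonal to `ω`, the displacement between points of equal
  -- height on the two lines.
  set P := (y - x) - (inner ℝ y ω - inner ℝ x ω) • ω with hP
  have hPn : ‖P‖ ≤ 2 * ‖x - y‖ := by
    calc ‖P‖ ≤ ‖y - x‖ + ‖(inner ℝ y ω - inner ℝ x ω) • ω‖ := norm_sub_le _ _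
      _ = ‖y - x‖ + |inner ℝ (y - x) ω| := by
        rw [norm_smul, hω, mul_one, inner_sub_left, Real.norm_eq_abs]
      _ ≤ ‖y - x‖ + ‖y - x‖ * ‖ω‖ := by gcongr; exact abs_real_inner_le_norm _ _
      _ = 2 * ‖x - y‖ := by rw [hω, norm_sub_rev]; ring
  have hqx' : exitPoint Ω x ω = x - (inner ℝ x ω - Ax) • ω := by rw [hAx, exitPoint, sub_sub_cancel]
  have hqy' : exitPoint Ω y ω = y - (inner ℝ y ω - Ay) • ω := by rw [hAy, exitPoint, sub_sub_cancel]
  -- The midpoint of the two exit points differs by `P/2` from a point of the line through `x` below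
  -- its exit height, which lies outside Ω. This first bound does not involve `L`.
  have ha : c * D ^ 2 ≤ 4 * ‖x - y‖ := by
    have hz : x - (inner ℝ x ω - (Ax + Ay) / 2) • ω ∉ Ω := by
      have h0 : exitTime Ω x ω ≤ inner ℝ x ω - (Ax + Ay) / 2 := by linarith
      rw [sub_smul_mem_iff_lt_exitTime ho hcv hb hx hω0 (exitTime_nonneg.trans h0)]
      exact not_lt.2 h0
    have h1 := hsc _ (frontier_subset_closure hqx) _ (frontier_subset_closure hqy) _ hz (1 / 2)
      ⟨by norm_num, by norm_num⟩
    have h2 : (1 - 1 / 2 : ℝ) • exitPoint Ω x ω + (1 / 2 : ℝ) • exitPoint Ω y ω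
        - (x - (inner ℝ x ω - (Ax + Ay) / 2) • ω) = (1 / 2 : ℝ) • P := by
      rw [hqx', hqy', hP]; module
    rw [h2, norm_smul] at h1
    have h3 : D ≤ ‖exitPoint Ω x ω - exitPoint Ω y ω‖ := by
      have h4 : inner ℝ (exitPoint Ω x ω - exitPoint Ω y ω) ω = D := by
        rw [hqx', hqy']
        simp only [inner_sub_left, real_inner_smul_left, hωω]
        ring
      have := real_inner_le_norm (exitPoint Ω x ω - exitPoint Ω y ω) ω
      rwa [h4, hω, mul_one] at this
    have h5 : D ^ 2 ≤ ‖exitPoint Ω x ω - exitPoint Ω y ω‖ ^ 2 := by gcongr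
    norm_num at h1
    nlinarith
  rw [div_mul_eq_mul_div, le_div_iff₀ hc]
  -- For `D ≤ L/2` the chord through `y` is tested at parameter `D/L`, giving `c D (L-D) ≤ |P|` with
  -- `L - D ≥ L/2`. For `D > L/2` the first bound suffices, since `D L < 2D²`.
  rcases le_or_gt D (L / 2) with hDL | hDL
  · have hb' := hsc _ (frontier_subset_closure hqy) _ (frontier_subset_closure hpy) _
      (notMem_of_mem_frontier ho hqx) (D / L) ⟨by positivity, by rw [div_le_one hL0]; linarith⟩
    have h1 : exitPoint Ω y ω - exitPoint Ω y (-ω) = -(L • ω) := by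
      rw [hL, chordLength, exitPoint, exitPoint]; module
    have h2 : (1 - D / L) • exitPoint Ω y ω + (D / L) • exitPoint Ω y (-ω) - exitPoint Ω x ω = P := by
      have h3 : (1 - D / L) • exitPoint Ω y ω + (D / L) • exitPoint Ω y (-ω)
          = exitPoint Ω y ω - (D / L) • (exitPoint Ω y ω - exitPoint Ω y (-ω)) := by module
      rw [h3, h1, smul_neg, smul_smul, div_mul_cancel₀ _ hL0.ne', hqx', hqy', hP, hD]
      module
    rw [h1, h2, norm_neg, norm_smul, hω, mul_one, Real.norm_of_nonneg hL0.le] at hb'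
    have h4 : c * (D / L * (1 - D / L)) * L ^ 2 = c * D * (L - D) := by field_simp
    rw [h4] at hb'
    have : 0 ≤ c * D := by positivity
    nlinarith
  · have : 0 ≤ c * D := by positivity
    nlinarith

/-- Exit time is height of the point minus height of its exit point; the first is 1-Lipschitz and
the second is controlled in both directions. The terms `|x-y|` are absorbed because chords are at
most twice the diameter bound, so that `1 ≤ 2|d|/L`. -/
theorem exists_exitTime_difference_bound (hΩ : IsPositivelyCurvedDomain Ω) :
    ∃ C : ℝ, 0 < C ∧ ∀ ω : Space, ‖ω‖ = 1 → ∀ x ∈ Ω, ∀ y ∈ Ω,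
      |exitTime Ω x ω - exitTime Ω y ω| + ‖x - y‖ ≤
        C * ‖x - y‖ * ((chordLength Ω ω x)⁻¹ + (chordLength Ω ω y)⁻¹) := by
  obtain ⟨c, hc, hsc⟩ := exists_strong_convexity hΩ
  have ho := hΩ.isOpen
  have hcv := hΩ.convex
  have hb := hΩ.isBounded
  obtain ⟨d, hd⟩ := Metric.isBounded_iff.1 hb.closure
  have hd' : ∀ y ∈ closure Ω, ∀ z ∈ closure Ω, ‖y - z‖ ≤ |d| := fun y hy z hz => by
    rw [← dist_eq_norm]; exact (hd hy hz).trans (le_abs_self d)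
  refine ⟨8 / c + 4 * |d| , by positivity, fun ω hω x hx y hy => ?_⟩
  have hω0 : ω ≠ 0 := norm_ne_zero_iff.1 (by rw [hω]; exact one_ne_zero)
  have hLx : 0 < chordLength Ω ω x := chordLength_pos ho hcv hb hx hω0
  have hLy : 0 < chordLength Ω ω y := chordLength_pos ho hcv hb hy hω0
  have hA : ∀ x ∈ Ω, ∀ y ∈ Ω, (inner ℝ x ω - exitTime Ω x ω) - (inner ℝ y ω - exitTime Ω y ω) ≤
      8 / c * ‖x - y‖ * ((chordLength Ω ω x)⁻¹ + (chordLength Ω ω y)⁻¹) := by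
    intro x hx y hy
    have hLx : 0 < chordLength Ω ω x := chordLength_pos ho hcv hb hx hω0
    have hLy : 0 < chordLength Ω ω y := chordLength_pos ho hcv hb hy hω0
    rcases le_or_gt (inner ℝ x ω - exitTime Ω x ω) (inner ℝ y ω - exitTime Ω y ω) with h | h
    · exact (sub_nonpos.2 h).trans (by positivity)
    · have h1 := height_difference_mul_chordLength_le ho hcv hb hc hsc hω hx hy h
      rw [← le_div_iff₀ hLy, div_eq_mul_inv] at h1
      refine h1.trans ?_
      gcongr
      linarith [inv_pos.2 hLx]
  have hA' : |(inner ℝ x ω - exitTime Ω x ω) - (inner ℝ y ω - exitTime Ω y ω)| ≤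
      8 / c * ‖x - y‖ * ((chordLength Ω ω x)⁻¹ + (chordLength Ω ω y)⁻¹) := by
    rw [abs_le]
    constructor
    · have := hA y hy x hx
      rw [norm_sub_rev, add_comm (chordLength Ω ω y)⁻¹] at this
      linarith
    · exact hA x hx y hy
  have hin : |inner ℝ x ω - inner ℝ y ω| ≤ ‖x - y‖ := by
    rw [← inner_sub_left]
    simpa [hω] using abs_real_inner_le_norm (x - y) ω
  have htri : |exitTime Ω x ω - exitTime Ω y ω| ≤ |inner ℝ x ω - inner ℝ y ω| +
      |(inner ℝ x ω - exitTime Ω x ω) - (inner ℝ y ω - exitTime Ω y ω)| := by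
    have h := abs_sub (inner ℝ x ω - inner ℝ y ω)
      ((inner ℝ x ω - exitTime Ω x ω) - (inner ℝ y ω - exitTime Ω y ω))
    refine le_trans (le_of_eq ?_) h
    congr 1; ring
  have hL1 : chordLength Ω ω x ≤ 2 * |d| := by
    have h1 := exitTime_mul_norm_le ho hcv hb hx hω0 hd'
    have h2 := exitTime_mul_norm_le ho hcv hb hx (neg_ne_zero.2 hω0) hd'
    rw [norm_neg, hω, mul_one] at h2
    rw [hω, mul_one] at h1
    rw [chordLength]; linarith
  have h1 : 1 ≤ 2 * |d| * (chordLength Ω ω x)⁻¹ := by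
    rw [← div_eq_mul_inv, one_le_div hLx]; exact hL1
  have h2 : 2 * ‖x - y‖ ≤ 4 * |d| * ‖x - y‖ * ((chordLength Ω ω x)⁻¹ + (chordLength Ω ω y)⁻¹) := by
    have : 0 ≤ 4 * |d| * ‖x - y‖ * (chordLength Ω ω y)⁻¹ := by positivity
    nlinarith [norm_nonneg (x - y)]
  linarith

end ExitTime

/-! ### Short chords fill little volume -/

section Chords

open scoped Pointwise

variable {Ω : Set Space}

/-- For `t ≥ 0` the superlevel set `{τ > t}` is the open set of `(x,v)`, with `x` in Ω and `v`
nonzero, such that `x - tv` lies in Ω. -/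
theorem measurable_indicator_exitTime (ho : IsOpen Ω) (hc : Convex ℝ Ω)
    (hb : Bornology.IsBounded Ω) :
    Measurable ((Ω ×ˢ ({0}ᶜ : Set Space)).indicator fun p : Space × Space => exitTime Ω p.1 p.2) := by
  refine measurable_of_Ioi fun t => ?_
  have hW : IsOpen (Ω ×ˢ ({0}ᶜ : Set Space)) := ho.prod isOpen_compl_singleton
  rcases lt_or_ge t 0 with ht | ht
  · convert MeasurableSet.univ
    ext p
    simp only [mem_preimage, mem_Ioi, mem_univ, iff_true]
    exact ht.trans_le (indicator_nonneg (fun _ _ => exitTime_nonneg) p)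
  · have hcont : Continuous fun p : Space × Space => p.1 - t • p.2 := by fun_prop
    convert (hW.inter (ho.preimage hcont)).measurableSet
    ext p
    simp only [mem_preimage, mem_Ioi, mem_inter_iff]
    by_cases hp : p ∈ Ω ×ˢ ({0}ᶜ : Set Space)
    · rw [indicator_of_mem hp, sub_smul_mem_iff_lt_exitTime ho hc hb hp.1 hp.2 ht]
      exact ⟨fun h => ⟨hp, h⟩, fun h => h.2⟩
    · rw [indicator_of_notMem hp]
      exact ⟨fun h => absurd h (not_lt.2 ht), fun h => absurd h.1 hp⟩

theorem measurable_indicator_exitTime_right (ho : IsOpen Ω) (hc : Convex ℝ Ω)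
    (hb : Bornology.IsBounded Ω) {v : Space} (hv : v ≠ 0) :
    Measurable (Ω.indicator fun x => exitTime Ω x v) := by
  have h := (measurable_indicator_exitTime ho hc hb).comp
    (measurable_id.prodMk measurable_const : Measurable fun x : Space => (x, v))
  convert h using 1
  ext x
  by_cases hx : x ∈ Ω <;> simp [indicator, hx, hv]

theorem measurable_indicator_chordLength (ho : IsOpen Ω) (hc : Convex ℝ Ω)
    (hb : Bornology.IsBounded Ω) {ω : Space} (hω : ω ≠ 0) :
    Measurable (Ω.indicator (chordLength Ω ω)) := by
  have h := (measurable_indicator_exitTime_right ho hc hb hω).add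
    (measurable_indicator_exitTime_right ho hc hb (neg_ne_zero.2 hω))
  convert h using 1
  ext x
  by_cases hx : x ∈ Ω <;> simp [hx, chordLength]

theorem sub_le_chordLength (ho : IsOpen Ω) (hc : Convex ℝ Ω) (hb : Bornology.IsBounded Ω)
    {ω x : Space} (hω : ω ≠ 0) (hx : x ∈ Ω) {a b : ℝ} (ha : x + a • ω ∈ Ω) (hb' : x + b • ω ∈ Ω) :
    b - a ≤ chordLength Ω ω x := by
  have h1 : -a ≤ exitTime Ω x ω := by
    rcases le_or_gt 0 (-a) with h | h
    · refine ((sub_smul_mem_iff_lt_exitTime ho hc hb hx hω h).1 ?_).le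
      convert ha using 1; module
    · exact h.le.trans exitTime_nonneg
  have h2 : b ≤ exitTime Ω x (-ω) := by
    rcases le_or_gt 0 b with h | h
    · refine ((sub_smul_mem_iff_lt_exitTime ho hc hb hx (neg_ne_zero.2 hω) h).1 ?_).le
      convert hb' using 1; module
    · exact h.le.trans exitTime_nonneg
  rw [chordLength]; linarith

/-- Let `E` be the set of points on chords shorter than `l`. About `1/l` translates of `E` by
multiples of `lω` are disjoint, as no short chord contains two points at distance `l`, and they lie
in `W = Ω + [0,ω]`. They also avoid a copy of `W` shrunk by the factor `1 - l/(2r)` about `x₀`,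
whose lines in direction `ω` meet Ω in length at least `l`. So they share a volume `O(l)`, and `E`
itself has volume `O(l²)`. -/
theorem volume_short_chords_le_of_small (ho : IsOpen Ω) (hc : Convex ℝ Ω)
    (hb : Bornology.IsBounded Ω) {x₀ : Space} {r : ℝ} (hr : 0 < r) (hball : Metric.ball x₀ r ⊆ Ω)
    {R : ℝ} (hR : ∀ x ∈ Ω, ‖x‖ ≤ R) {ω : Space} (hω : ‖ω‖ = 1) {l : ℝ} (hl : 0 < l) (hl1 : l ≤ 1)
    (hlr : l < 2 * r) :
    volume.real {x ∈ Ω | chordLength Ω ω x < l} ≤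
      3 / r * volume.real (Metric.closedBall (0 : Space) (R + 1)) * l ^ 2 := by
  have hω0 : ω ≠ 0 := norm_ne_zero_iff.1 (by rw [hω]; exact one_ne_zero)
  set E := {x ∈ Ω | chordLength Ω ω x < l} with hE
  have hEm : MeasurableSet E := by
    have := measurable_indicator_chordLength ho hc hb hω0
    have h2 : E = Ω ∩ (Ω.indicator (chordLength Ω ω)) ⁻¹' (Iio l) := by
      ext x
      simp only [hE, mem_ofPred_eq, mem_inter_iff, mem_preimage, mem_Iio]
      exact and_congr_right fun hx => by rw [indicator_of_mem hx]
    rw [h2]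
    exact ho.measurableSet.inter (this measurableSet_Iio)
  set W : Set Space := Ω + segment ℝ 0 ω with hW
  have hWo : IsOpen W := ho.add_right
  have hWc : Convex ℝ W := hc.add (convex_segment _ _)
  have hmemW : ∀ x ∈ Ω, ∀ s ∈ Icc (0 : ℝ) 1, x + s • ω ∈ W := fun x hx s hs =>
    add_mem_add hx ⟨1 - s, s, sub_nonneg.2 hs.2, hs.1, by ring, by simp⟩
  have hWB : W ⊆ Metric.closedBall (0 : Space) (R + 1) := by
    rintro _ ⟨x, hx, _, ⟨a, b, ha, hb, hab, rfl⟩, rfl⟩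
    rw [mem_closedBall_zero_iff]
    have h1 : ‖a • (0 : Space) + b • ω‖ ≤ 1 := by
      rw [smul_zero, zero_add, norm_smul, hω, mul_one, Real.norm_of_nonneg hb]; linarith
    exact (norm_add_le _ _).trans (add_le_add (hR x hx) h1)
  set η := l / (2 * r) with hη
  have hη0 : 0 < η := by positivity
  have hη1 : η < 1 := by rw [hη, div_lt_one (by positivity)]; exact hlr
  have hx₀ : x₀ ∈ Ω := hball (Metric.mem_ball_self hr)
  set F : Set Space := AffineMap.homothety x₀ (1 - η) '' W with hF
  have hFW : F ⊆ W := by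
    rintro _ ⟨z, hz, rfl⟩
    have hx₀W : x₀ ∈ W := by simpa using hmemW x₀ hx₀ 0 ⟨le_rfl, zero_le_one⟩
    have := hWc hz hx₀W (sub_nonneg.2 hη1.le) hη0.le (by ring)
    convert this using 1
    simp only [AffineMap.homothety_apply, vsub_eq_sub, vadd_eq_add]
    module
  -- The number of translates satisfies `1/(2l) ≤ n ≤ 1/l`: they stay within unit displacement, and
  -- enough of them fit.
  set n := ⌊1 / l⌋₊ with hn
  have hn1 : (1 : ℝ) ≤ n := by
    rw [hn, Nat.one_le_cast]
    exact Nat.le_floor (by rw [Nat.cast_one, one_le_div hl]; exact hl1)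
  have hnl : n * l ≤ 1 := by
    have := Nat.floor_le (a := 1 / l) (by positivity)
    rw [← hn, le_div_iff₀ hl] at this
    exact this
  have hn2 : 1 ≤ 2 * n * l := by
    have := Nat.lt_floor_add_one (1 / l)
    rw [← hn, div_lt_iff₀ hl] at this
    nlinarith
  set T : ℕ → Set Space := fun k => (fun x => x + (-((k : ℝ) * l) • ω)) ⁻¹' E with hT
  have hTm : ∀ k, MeasurableSet (T k) := fun k => hEm.preimage (by fun_prop)
  have hTv : ∀ k, volume (T k) = volume E := fun k => measure_preimage_add_right _ _ _
  have hdisj : Pairwise (Function.onFun Disjoint T) := by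
    have key : ∀ j k : ℕ, j < k → ∀ z, z ∈ T j → z ∈ T k → False := by
      intro j k hjk z hj hk
      simp only [hT, hE, mem_preimage, mem_ofPred_eq] at hj hk
      have h1 := sub_le_chordLength ho hc hb (a := -(((k : ℝ) - j) * l)) (b := 0) hω0 hj.1
        (by convert hk.1 using 1; module) (by simpa using hj.1)
      have h2 : (1 : ℝ) ≤ (k : ℝ) - j := by
        have : (j : ℝ) + 1 ≤ k := by exact_mod_cast hjk
        linarith
      nlinarith [hj.2]
    intro j k hjk
    refine Set.disjoint_left.2 fun z hj hk => ?_
    rcases lt_or_gt_of_ne hjk with h | h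
    · exact key j k h z hj hk
    · exact key k j h z hk hj
  set S := ⋃ k ∈ Finset.range n, T k with hS
  have hSm : MeasurableSet S := Finset.measurableSet_biUnion _ fun k _ => hTm k
  have hSv : volume S = n * volume E := by
    rw [hS, measure_biUnion_finset (fun j _ k _ h => hdisj h) (fun k _ => hTm k)]
    simp [hTv]
  have hkl : ∀ k ∈ Finset.range n, (k : ℝ) * l ∈ Icc (0 : ℝ) 1 := by
    intro k hk
    have : (k : ℝ) ≤ n := by exact_mod_cast (Finset.mem_range.1 hk).le
    exact ⟨by positivity, by nlinarith⟩
  have hSW : S ⊆ W := by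
    intro z hz
    simp only [hS, mem_iUnion] at hz
    obtain ⟨k, hk, hz⟩ := hz
    have := hmemW _ hz.1 _ (hkl k hk)
    convert this using 1
    module
  have hSF : Disjoint S F := by
    refine Set.disjoint_left.2 fun z hz hzF => ?_
    simp only [hS, mem_iUnion] at hz
    obtain ⟨k, hk, hz⟩ := hz
    obtain ⟨_, ⟨z₀, hz₀, _, ⟨a, s, -, -, -, rfl⟩, rfl⟩, rfl⟩ := hzF
    simp only [AffineMap.homothety_apply, vsub_eq_sub, vadd_eq_add, smul_zero, zero_add] at hz
    set x := (1 - η) • (z₀ + s • ω - x₀) + x₀ + -((k : ℝ) * l) • ω with hx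
    obtain ⟨hxΩ, hxl⟩ := hz
    -- The convex combination of `z₀` with points of the ball around `x₀` produces an interval of
    -- length `2ηr = l` on the line through `x`.
    have hin : ∀ u : ℝ, |u| < η * r → x + (k * l - (1 - η) * s + u) • ω ∈ Ω := by
      intro u hu
      have h1 : x₀ + (u / η) • ω ∈ Ω := by
        refine hball ?_
        rw [mem_ball_iff_norm, add_sub_cancel_left, norm_smul, hω, mul_one, Real.norm_eq_abs,
          abs_div, abs_of_pos hη0, div_lt_iff₀ hη0]
        linarith
      have := hc hz₀ h1 (sub_nonneg.2 hη1.le) hη0.le (by ring)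
      convert this using 1
      rw [smul_add η, smul_smul, mul_div_cancel₀ _ hη0.ne', hx]
      module
    have hηr : l = 2 * (η * r) := by rw [hη]; field_simp
    obtain ⟨u, hu1, hu2⟩ : ∃ u, chordLength Ω ω x / 2 < u ∧ u < η * r :=
      exists_between (by linarith)
    have hu0 : 0 < u := (half_pos (chordLength_pos ho hc hb hxΩ hω0)).trans hu1
    have := sub_le_chordLength ho hc hb hω0 hxΩ (hin (-u) (by rwa [abs_neg, abs_of_pos hu0]))
      (hin u (by rwa [abs_of_pos hu0]))
    linarith
  have hfin : volume W ≠ ∞ := ((measure_mono hWB).trans_lt (isCompact_closedBall _ _).measure_lt_top).ne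
  have hsum : volume S + volume F ≤ volume W := by
    rw [← measure_union' hSF hSm]
    exact measure_mono (union_subset hSW hFW)
  have hFv : volume F = ENNReal.ofReal ((1 - η) ^ 3) * volume W := by
    rw [hF, Measure.addHaar_image_homothety]
    have h3 : Module.finrank ℝ Space = 3 := by simp [Space]
    rw [h3, abs_of_pos (by have := sub_pos.2 hη1; positivity)]
  rw [hSv, hFv] at hsum
  have hEfin : volume E ≠ ∞ := by
    have h : volume E ≤ volume W := by
      refine measure_mono fun x hx => ?_
      simpa using hmemW x hx.1 0 ⟨le_rfl, zero_le_one⟩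
    exact (h.trans_lt (lt_top_iff_ne_top.2 hfin)).ne
  have hreal : n * volume.real E + (1 - η) ^ 3 * volume.real W ≤ volume.real W := by
    have := ENNReal.toReal_mono hfin hsum
    rw [ENNReal.toReal_add (ENNReal.mul_ne_top (by simp) hEfin)
      (ENNReal.mul_ne_top (by simp) hfin), ENNReal.toReal_mul, ENNReal.toReal_mul,
      ENNReal.toReal_ofReal (by have := sub_pos.2 hη1; positivity)] at this
    simpa [Measure.real] using this
  have hVW : volume.real W ≤ volume.real (Metric.closedBall (0 : Space) (R + 1)) :=
    measureReal_mono hWB (isCompact_closedBall _ _).measure_lt_top.ne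
  set V := volume.real (Metric.closedBall (0 : Space) (R + 1)) with hV
  set e := volume.real E with he
  have he0 : 0 ≤ e := measureReal_nonneg
  have hW0 : 0 ≤ volume.real W := measureReal_nonneg
  have h1 : n * e ≤ 3 * η * V := by
    have h2 : 1 - (1 - η) ^ 3 ≤ 3 * η := by nlinarith [sq_nonneg η, mul_nonneg hη0.le (sq_nonneg η)]
    calc n * e ≤ (1 - (1 - η) ^ 3) * volume.real W := by linarith
      _ ≤ 3 * η * V := by gcongr
  calc e ≤ (2 * n * l) * e := by nlinarith
    _ = 2 * l * (n * e) := by ring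
    _ ≤ 2 * l * (3 * η * V) := by gcongr
    _ = 3 / r * V * l ^ 2 := by rw [hη]; field_simp

theorem exists_volume_short_chords_le (ho : IsOpen Ω) (hc : Convex ℝ Ω)
    (hb : Bornology.IsBounded Ω) (hne : Ω.Nonempty) :
    ∃ K : ℝ, 0 ≤ K ∧ ∀ ω : Space, ‖ω‖ = 1 → ∀ l : ℝ, 0 < l →
      volume {x ∈ Ω | chordLength Ω ω x < l} ≤ ENNReal.ofReal (K * l ^ 2) := by
  obtain ⟨x₀, hx₀⟩ := hne
  obtain ⟨r, hr, hball⟩ := Metric.isOpen_iff.1 ho x₀ hx₀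
  obtain ⟨R, hR⟩ := hb.exists_norm_le
  set V := volume.real (Metric.closedBall (0 : Space) (R + 1)) with hV
  have hV0 : 0 ≤ V := measureReal_nonneg
  refine ⟨3 / r * V + V + V / (2 * r) ^ 2, by positivity, fun ω hω l hl => ?_⟩
  have hsub : {x ∈ Ω | chordLength Ω ω x < l} ⊆ Metric.closedBall (0 : Space) (R + 1) := by
    intro x hx
    rw [mem_closedBall_zero_iff]
    linarith [hR x hx.1]
  have hfin : volume (Metric.closedBall (0 : Space) (R + 1)) ≠ ∞ :=
    (isCompact_closedBall _ _).measure_lt_top.ne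
  have hVle : volume.real {x ∈ Ω | chordLength Ω ω x < l} ≤ V := measureReal_mono hsub hfin
  rw [← ofReal_measureReal (measure_ne_top_of_subset hsub hfin)]
  refine ENNReal.ofReal_le_ofReal ?_
  have e1 : 0 ≤ 3 / r * V * l ^ 2 := by positivity
  have e2 : 0 ≤ V * l ^ 2 := by positivity
  have e3 : 0 ≤ V / (2 * r) ^ 2 * l ^ 2 := by positivity
  rcases le_or_gt l 1 with hl1 | hl1
  · rcases lt_or_ge l (2 * r) with hlr | hlr
    · have := volume_short_chords_le_of_small ho hc hb hr hball hR hω hl hl1 hlr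
      linarith
    · have : V ≤ V / (2 * r) ^ 2 * l ^ 2 := by
        rw [div_mul_eq_mul_div, le_div_iff₀ (by positivity)]
        gcongr
      linarith
  · have : V ≤ V * l ^ 2 := by
      have : 1 ≤ l ^ 2 := by nlinarith
      nlinarith
    linarith

/-- Layer-cake formula for `1/L`: levels `t ≤ 1` contribute at most `|Ω| t^(q-1)`, and levels `t >
1` at most `K t^(q-3)`, integrable at infinity precisely because `q < 2`. -/
theorem exists_lintegral_chordLength_le (ho : IsOpen Ω) (hc : Convex ℝ Ω)
    (hb : Bornology.IsBounded Ω) (hne : Ω.Nonempty) {q : ℝ} (hq0 : 0 < q) (hq2 : q < 2) :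
    ∃ K : ℝ≥0∞, K < ∞ ∧ ∀ ω : Space, ‖ω‖ = 1 →
      ∫⁻ x in Ω, ENNReal.ofReal ((chordLength Ω ω x)⁻¹ ^ q) ≤ K := by
  obtain ⟨K, hK0, hK⟩ := exists_volume_short_chords_le ho hc hb hne
  have i1 : ∫⁻ t in Ioc (0 : ℝ) 1, ENNReal.ofReal (t ^ (q - 1)) < ∞ := by
    refine IntegrableOn.setLIntegral_lt_top ?_
    have := intervalIntegral.intervalIntegrable_rpow' (a := 0) (b := 1) (r := q - 1) (by linarith)
    rwa [intervalIntegrable_iff_integrableOn_Ioc_of_le zero_le_one] at this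
  have i2 : ∫⁻ t in Ioi (1 : ℝ), ENNReal.ofReal (t ^ (q - 3)) < ∞ :=
    IntegrableOn.setLIntegral_lt_top (integrableOn_Ioi_rpow_of_lt (by linarith) one_pos)
  refine ⟨ENNReal.ofReal q * (volume Ω * (∫⁻ t in Ioc (0 : ℝ) 1, ENNReal.ofReal (t ^ (q - 1)))
    + ENNReal.ofReal K * ∫⁻ t in Ioi (1 : ℝ), ENNReal.ofReal (t ^ (q - 3))), ?_, fun ω hω => ?_⟩
  · exact ENNReal.mul_lt_top ENNReal.ofReal_lt_top (ENNReal.add_lt_top.2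
      ⟨ENNReal.mul_lt_top hb.measure_lt_top i1, ENNReal.mul_lt_top ENNReal.ofReal_lt_top i2⟩)
  have hω0 : ω ≠ 0 := norm_ne_zero_iff.1 (by rw [hω]; exact one_ne_zero)
  have hLm : AEMeasurable (fun x => (chordLength Ω ω x)⁻¹) (volume.restrict Ω) :=
    ((aemeasurable_indicator_iff ho.measurableSet).1
      (measurable_indicator_chordLength ho hc hb hω0).aemeasurable).inv
  rw [lintegral_rpow_eq_lintegral_meas_lt_mul (f := fun x => (chordLength Ω ω x)⁻¹) _ (.of_forall fun x =>
    inv_nonneg.2 (add_nonneg exitTime_nonneg exitTime_nonneg)) hLm hq0]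
  gcongr
  rw [← Ioc_union_Ioi_eq_Ioi (zero_le_one (α := ℝ)),
    lintegral_union measurableSet_Ioi (Set.disjoint_left.2 fun t h1 h2 => not_lt.2 h1.2 h2)]
  gcongr
  · rw [← lintegral_const_mul' _ _ hb.measure_lt_top.ne]
    refine lintegral_mono fun t => ?_
    exact mul_le_mul' ((measure_mono (subset_univ _)).trans_eq (Measure.restrict_apply_univ _)) le_rfl
  · rw [← lintegral_const_mul' _ _ ENNReal.ofReal_ne_top]
    refine setLIntegral_mono' measurableSet_Ioi fun t ht => ?_
    have ht0 : (0 : ℝ) < t := zero_lt_one.trans ht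
    have h1 : volume.restrict Ω {x | t < (chordLength Ω ω x)⁻¹} ≤ ENNReal.ofReal (K * t⁻¹ ^ 2) := by
      rw [Measure.restrict_apply' ho.measurableSet]
      refine le_trans (measure_mono ?_) (hK ω hω t⁻¹ (inv_pos.2 ht0))
      rintro x ⟨hx1, hx2⟩
      refine ⟨hx2, ?_⟩
      have hpos := chordLength_pos ho hc hb hx2 hω0
      exact (lt_inv_comm₀ ht0 hpos).1 hx1
    calc _ ≤ ENNReal.ofReal (K * t⁻¹ ^ 2) * ENNReal.ofReal (t ^ (q - 1)) := by gcongr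
      _ = ENNReal.ofReal K * ENNReal.ofReal (t ^ (q - 3)) := by
        rw [← ENNReal.ofReal_mul (by positivity), ← ENNReal.ofReal_mul hK0]
        congr 1
        rw [mul_assoc]
        congr 1
        rw [show q - 3 = q - 1 - 2 by ring, Real.rpow_sub ht0 (q - 1) 2, Real.rpow_two]
        field_simp

end Chords

/-! ### The Slobodeckij integral of the exit time -/

theorem lintegral_ball_rpow_lt_top {k R : ℝ} (hk : k < 3) :
    ∫⁻ u in Metric.ball (0 : Space) R, ENNReal.ofReal (‖u‖ ^ (-k)) < ∞ := by
  refine IntegrableOn.setLIntegral_lt_top ?_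
  have h3 : Module.finrank ℝ Space = 3 := by simp [Space]
  refine integrableOn_ball_of_norm_le_rpow (C := 1) (α := k) (by rw [h3]; norm_num)
    (by rw [h3]; exact_mod_cast hk) (.of_forall fun x => ?_)
    (by fun_prop : Measurable fun u : Space => ‖u‖ ^ (-k)).aestronglyMeasurable
  rw [one_mul, Real.norm_of_nonneg (by positivity)]

theorem lintegral_sub_rpow_le {Ω : Set Space} {R : ℝ} {y : Space}
    (hR : ∀ x ∈ Ω, ‖x - y‖ < R) (k : ℝ) :
    ∫⁻ x in Ω, ENNReal.ofReal (‖x - y‖ ^ (-k)) ≤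
      ∫⁻ u in Metric.ball (0 : Space) R, ENNReal.ofReal (‖u‖ ^ (-k)) := by
  have hm : MeasurableSet (Metric.ball (0 : Space) R) := measurableSet_ball
  have hmb : MeasurableSet (Metric.ball y R) := measurableSet_ball
  calc ∫⁻ x in Ω, ENNReal.ofReal (‖x - y‖ ^ (-k))
      ≤ ∫⁻ x in Metric.ball y R, ENNReal.ofReal (‖x - y‖ ^ (-k)) := by
        refine lintegral_mono_set fun x hx => ?_
        rw [mem_ball_iff_norm]; exact hR x hx
    _ = ∫⁻ x, (Metric.ball (0 : Space) R).indicator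
          (fun u => ENNReal.ofReal (‖u‖ ^ (-k))) (x - y) := by
        rw [← lintegral_indicator hmb]
        refine lintegral_congr fun x => ?_
        simp only [indicator, mem_ball_iff_norm, sub_zero]
    _ = _ := by rw [lintegral_sub_right_eq_self, lintegral_indicator hm]

/-- The exit time difference bound reduces the integrand to `|x-y|^(-k)` times `L(x)^(-2p) +
L(y)^(-2p)`. The first factor is uniformly integrable in either variable because `s < p` gives `k <
3`; the second is integrable because `2p < 2`. -/
theorem exists_slobodeckij_exitTime_le {Ω : Set Space} (hΩ : IsPositivelyCurvedDomain Ω) {s p : ℝ}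
    (hs : 0 < s) (hsp : s < p) (hp : p < 1) :
    ∃ G : ℝ≥0∞, G < ∞ ∧ ∀ ω : Space, ‖ω‖ = 1 → ∫⁻ y in Ω, ∫⁻ x in Ω,
      ENNReal.ofReal ((|exitTime Ω x ω - exitTime Ω y ω| + ‖x - y‖) ^ (2 * p) / ‖x - y‖ ^ (3 + 2 * s))
        ≤ G := by
  have ho := hΩ.isOpen
  have hcv := hΩ.convex
  have hb := hΩ.isBounded
  obtain ⟨C, hC, hdiff⟩ := exists_exitTime_difference_bound hΩ
  obtain ⟨K, hK, hint⟩ := exists_lintegral_chordLength_le ho hcv hb hΩ.nonempty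
    (q := 2 * p) (by linarith) (by linarith)
  obtain ⟨d, hd⟩ := Metric.isBounded_iff.1 hb
  set k := 3 + 2 * s - 2 * p with hk
  set N := ∫⁻ u in Metric.ball (0 : Space) (d + 1), ENNReal.ofReal (‖u‖ ^ (-k)) with hN
  have hN0 : N < ∞ := lintegral_ball_rpow_lt_top (by rw [hk]; linarith)
  set A := (C * 2) ^ (2 * p) with hA
  have hA0 : 0 ≤ A := by positivity
  refine ⟨ENNReal.ofReal A * (N * K + N * K), ENNReal.mul_lt_top ENNReal.ofReal_lt_top
    (ENNReal.add_lt_top.2 ⟨ENNReal.mul_lt_top hN0 hK, ENNReal.mul_lt_top hN0 hK⟩), fun ω hω => ?_⟩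
  have hω0 : ω ≠ 0 := norm_ne_zero_iff.1 (by rw [hω]; exact one_ne_zero)
  have hR : ∀ y ∈ Ω, ∀ x ∈ Ω, ‖x - y‖ < d + 1 := fun y hy x hx => by
    rw [← dist_eq_norm]; linarith [hd hx hy]
  set L := chordLength Ω ω with hL
  have hLm : AEMeasurable (fun x => ENNReal.ofReal ((L x)⁻¹ ^ (2 * p))) (volume.restrict Ω) :=
    (((aemeasurable_indicator_iff ho.measurableSet).1
      (measurable_indicator_chordLength ho hcv hb hω0).aemeasurable).inv.pow_const _).ennreal_ofReal
  have hpt : ∀ y ∈ Ω, ∀ x ∈ Ω,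
      ENNReal.ofReal ((|exitTime Ω x ω - exitTime Ω y ω| + ‖x - y‖) ^ (2 * p) / ‖x - y‖ ^ (3 + 2 * s)) ≤
      ENNReal.ofReal A * (ENNReal.ofReal (‖x - y‖ ^ (-k)) * ENNReal.ofReal ((L x)⁻¹ ^ (2 * p)) +
        ENNReal.ofReal (‖x - y‖ ^ (-k)) * ENNReal.ofReal ((L y)⁻¹ ^ (2 * p))) := by
    intro y hy x hx
    have hLx := chordLength_pos ho hcv hb hx hω0
    have hLy := chordLength_pos ho hcv hb hy hω0
    rw [← hL] at hLx hLy
    rw [← mul_add, ← ENNReal.ofReal_add (by positivity) (by positivity),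
      ← ENNReal.ofReal_mul (by positivity), ← ENNReal.ofReal_mul hA0]
    refine ENNReal.ofReal_le_ofReal ?_
    rcases eq_or_lt_of_le (norm_nonneg (x - y)) with h0 | h0
    -- On the diagonal the quotient has denominator zero and takes the value 0.
    · have : (0 : ℝ) ^ (3 + 2 * s) = 0 := Real.zero_rpow (by linarith)
      rw [← h0, this, div_zero]
      positivity
    · have h1 := hdiff ω hω x hx y hy
      rw [← hL] at h1
      have h2 : (L x)⁻¹ + (L y)⁻¹ ≤ 2 * max (L x)⁻¹ (L y)⁻¹ := by
        linarith [le_max_left (L x)⁻¹ (L y)⁻¹, le_max_right (L x)⁻¹ (L y)⁻¹]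
      have hmax : max (L x)⁻¹ (L y)⁻¹ ^ (2 * p) ≤ (L x)⁻¹ ^ (2 * p) + (L y)⁻¹ ^ (2 * p) := by
        have e1 : 0 ≤ (L x)⁻¹ ^ (2 * p) := by positivity
        have e2 : 0 ≤ (L y)⁻¹ ^ (2 * p) := by positivity
        rcases max_cases (L x)⁻¹ (L y)⁻¹ with h | h <;> rw [h.1] <;> linarith
      have hmax0 : 0 ≤ max (L x)⁻¹ (L y)⁻¹ := le_max_of_le_left (inv_pos.2 hLx).le
      calc (|exitTime Ω x ω - exitTime Ω y ω| + ‖x - y‖) ^ (2 * p) / ‖x - y‖ ^ (3 + 2 * s)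
          ≤ (C * ‖x - y‖ * (2 * max (L x)⁻¹ (L y)⁻¹)) ^ (2 * p) / ‖x - y‖ ^ (3 + 2 * s) := by
            have hp0 : 0 ≤ 2 * p := by linarith
            gcongr
            exact h1.trans (by gcongr)
        _ = A * (‖x - y‖ ^ (-k) * max (L x)⁻¹ (L y)⁻¹ ^ (2 * p)) := by
            have e : C * ‖x - y‖ * (2 * max (L x)⁻¹ (L y)⁻¹) = C * 2 * (‖x - y‖ * max (L x)⁻¹ (L y)⁻¹) := by ring
            rw [e, Real.mul_rpow (by positivity) (by positivity), Real.mul_rpow h0.le hmax0, ← hA,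
              show -k = 2 * p - (3 + 2 * s) by rw [hk]; ring, Real.rpow_sub h0]
            ring
        _ ≤ _ := by gcongr
  have hnm : Measurable fun z : Space × Space => ENNReal.ofReal (‖z.2 - z.1‖ ^ (-k)) := by fun_prop
  have m1 : AEMeasurable (Function.uncurry fun y x : Space =>
      ENNReal.ofReal (‖x - y‖ ^ (-k)) * ENNReal.ofReal ((L x)⁻¹ ^ (2 * p)))
      ((volume.restrict Ω).prod (volume.restrict Ω)) :=
    hnm.aemeasurable.mul hLm.comp_snd
  have m2 : AEMeasurable (fun y : Space => ∫⁻ x in Ω, ENNReal.ofReal (‖x - y‖ ^ (-k)) *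
      ENNReal.ofReal ((L x)⁻¹ ^ (2 * p))) (volume.restrict Ω) := m1.lintegral_prod_right'
  have I2 : ∫⁻ y in Ω, ∫⁻ x in Ω, ENNReal.ofReal (‖x - y‖ ^ (-k)) * ENNReal.ofReal ((L y)⁻¹ ^ (2 * p))
      ≤ N * K := by
    calc _ ≤ ∫⁻ y in Ω, N * ENNReal.ofReal ((L y)⁻¹ ^ (2 * p)) := by
          refine setLIntegral_mono' ho.measurableSet fun y hy => ?_
          rw [lintegral_mul_const' _ _ ENNReal.ofReal_ne_top]
          gcongr
          exact lintegral_sub_rpow_le (hR y hy) k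
      _ ≤ N * K := by
          rw [lintegral_const_mul' _ _ hN0.ne]
          gcongr
          exact hint ω hω
  have I1 : ∫⁻ y in Ω, ∫⁻ x in Ω, ENNReal.ofReal (‖x - y‖ ^ (-k)) * ENNReal.ofReal ((L x)⁻¹ ^ (2 * p))
      ≤ N * K := by
    rw [lintegral_lintegral_swap m1]
    simpa only [norm_sub_rev] using I2
  calc _ ≤ ∫⁻ y in Ω, ENNReal.ofReal A *
        ((∫⁻ x in Ω, ENNReal.ofReal (‖x - y‖ ^ (-k)) * ENNReal.ofReal ((L x)⁻¹ ^ (2 * p))) +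
        ∫⁻ x in Ω, ENNReal.ofReal (‖x - y‖ ^ (-k)) * ENNReal.ofReal ((L y)⁻¹ ^ (2 * p))) := by
        refine setLIntegral_mono' ho.measurableSet fun y hy => ?_
        rw [← lintegral_add_right _ (by fun_prop), ← lintegral_const_mul' _ _ ENNReal.ofReal_ne_top]
        exact setLIntegral_mono' ho.measurableSet fun x hx => hpt y hy x hx
    _ ≤ ENNReal.ofReal A * (N * K + N * K) := by
        rw [lintegral_const_mul' _ _ ENNReal.ofReal_ne_top, lintegral_add_left' m2]
        gcongr

/-! ### Minkowski's integral inequality in `L²` -/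

/-- Cauchy–Schwarz with `F = w^(1/2) · F w^(-1/2)` gives `(∫F)² ≤ ∫w · ∫F²/w`; integration in `b`
then uses `∫F² ≤ w²`. An explicit majorant `w` replaces the `L²` norm, and it must be nonzero for `w
w⁻¹ = 1`. -/
theorem lintegral_sq_lintegral_le {α β : Type*} [MeasurableSpace α] [MeasurableSpace β]
    {μ : Measure α} {ν : Measure β} [SFinite μ] [SFinite ν] {F : α → β → ℝ≥0∞}
    (hF : Measurable (Function.uncurry F)) {w : α → ℝ≥0∞} (hw : AEMeasurable w μ)
    (hw0 : ∀ a, w a ≠ 0) (h : ∀ᵐ a ∂μ, ∫⁻ b, F a b ^ 2 ∂ν ≤ w a ^ 2) :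
    ∫⁻ b, (∫⁻ a, F a b ∂μ) ^ 2 ∂ν ≤ (∫⁻ a, w a ∂μ) ^ 2 := by
  rcases eq_or_ne (∫⁻ a, w a ∂μ) ∞ with htop | htop
  · simp [htop]
  have hfin := ae_lt_top' hw htop
  have hcs : ∀ b, (∫⁻ a, F a b ∂μ) ^ 2 ≤ (∫⁻ a, w a ∂μ) * ∫⁻ a, F a b ^ 2 * (w a)⁻¹ ∂μ := by
    intro b
    have hb : Measurable fun a => F a b := hF.comp measurable_prodMk_right
    have h1 := ENNReal.lintegral_mul_norm_pow_le (μ := μ) hw (g := fun a => F a b ^ 2 * (w a)⁻¹)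
      ((hb.pow_const 2).aemeasurable.mul hw.inv) (p := 1 / 2) (q := 1 / 2) (by norm_num) (by norm_num) (by norm_num)
    have h2 : ∫⁻ a, F a b ∂μ = ∫⁻ a, w a ^ (1 / 2 : ℝ) *
        (F a b ^ 2 * (w a)⁻¹) ^ (1 / 2 : ℝ) ∂μ := by
      refine lintegral_congr_ae ?_
      filter_upwards [hfin] with a ha
      rw [← ENNReal.mul_rpow_of_nonneg _ _ (by norm_num), mul_comm (F a b ^ 2),
        ← mul_assoc, ENNReal.mul_inv_cancel (hw0 a) ha.ne, one_mul, ← ENNReal.rpow_natCast,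
        ← ENNReal.rpow_mul]
      norm_num
    rw [← h2] at h1
    calc (∫⁻ a, F a b ∂μ) ^ 2 ≤ _ := pow_le_pow_left' h1 2
      _ = _ := by
        rw [mul_pow, ← ENNReal.rpow_natCast, ← ENNReal.rpow_natCast, ← ENNReal.rpow_mul,
          ← ENNReal.rpow_mul]
        norm_num
  have hm : AEMeasurable (Function.uncurry fun a b => F a b ^ 2 * (w a)⁻¹) (μ.prod ν) :=
    (hF.pow_const 2).aemeasurable.mul hw.inv.comp_fst
  calc ∫⁻ b, (∫⁻ a, F a b ∂μ) ^ 2 ∂ν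
      ≤ ∫⁻ b, (∫⁻ a, w a ∂μ) * ∫⁻ a, F a b ^ 2 * (w a)⁻¹ ∂μ ∂ν := lintegral_mono hcs
    _ = (∫⁻ a, w a ∂μ) * ∫⁻ a, ∫⁻ b, F a b ^ 2 * (w a)⁻¹ ∂ν ∂μ := by
      rw [lintegral_const_mul' _ _ htop, lintegral_lintegral_swap hm]
    _ ≤ (∫⁻ a, w a ∂μ) * ∫⁻ a, w a ∂μ := by
      refine mul_le_mul' le_rfl (lintegral_mono_ae ?_)
      filter_upwards [h, hfin] with a ha hfa
      rw [lintegral_mul_const' _ _ (ENNReal.inv_ne_top.2 (hw0 a))]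
      calc _ ≤ w a ^ 2 * (w a)⁻¹ := by gcongr
        _ = w a := by
          rw [sq, mul_assoc, ENNReal.mul_inv_cancel (hw0 a) hfa.ne, mul_one]
    _ = _ := (sq _).symm

/-! ### A weakly singular angular integral -/

theorem lintegral_abs_rpow_lt_top {p : ℝ} (hp1 : p < 1) :
    ∫⁻ t in Icc (-1 : ℝ) 1, ‖t‖ₑ ^ (-p) < ∞ := by
  have h1 : IntegrableOn (fun t : ℝ => |t| ^ (-p)) (Icc (-1 : ℝ) 1) := by
    rw [integrableOn_Icc_iff_integrableOn_Ioc,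
      ← intervalIntegrable_iff_integrableOn_Ioc_of_le (by norm_num)]
    have h0 : IntervalIntegrable (fun t : ℝ => |t| ^ (-p)) volume 0 1 := by
      refine (intervalIntegral.intervalIntegrable_rpow' (a := 0) (b := 1) (r := -p)
        (by linarith)).congr ?_
      intro t ht
      rw [uIoc_of_le zero_le_one] at ht
      simp only [abs_of_pos ht.1]
    have h2 : IntervalIntegrable (fun t : ℝ => |t| ^ (-p)) volume (-1) 0 := by
      rw [IntervalIntegrable.iff_comp_neg]
      simpa using h0.symm
    exact h2.trans h0
  refine lt_of_le_of_lt (lintegral_mono_ae ?_) h1.setLIntegral_lt_top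
  refine ae_restrict_of_ae ?_
  filter_upwards [compl_mem_ae_iff.2 (measure_singleton (0 : ℝ))] with t ht
  rw [Real.enorm_eq_ofReal_abs, ENNReal.ofReal_rpow_of_pos (abs_pos.2 ht)]

/-- Within distance 1 of `c` the integrand is a translate of `|t|^(-p)`, elsewhere it is at most 1;
hence the uniformity in `c`. -/
theorem lintegral_sub_rpow_unit_le {p : ℝ} (hp0 : 0 ≤ p) (c : ℝ) :
    ∫⁻ t in Icc (0 : ℝ) 1, ‖t - c‖ₑ ^ (-p) ≤ (∫⁻ t in Icc (-1 : ℝ) 1, ‖t‖ₑ ^ (-p)) + 1 := by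
  have hm : MeasurableSet (Icc (-1 : ℝ) 1) := measurableSet_Icc
  have hpt : ∀ t : ℝ, ‖t - c‖ₑ ^ (-p) ≤
      (Icc (-1 : ℝ) 1).indicator (fun t => ‖t‖ₑ ^ (-p)) (t - c) + 1 := by
    intro t
    by_cases h : t - c ∈ Icc (-1 : ℝ) 1
    · rw [indicator_of_mem h]; exact le_self_add
    · have h1 : 1 ≤ ‖t - c‖ₑ := by
        rw [Real.enorm_eq_ofReal_abs, ← ENNReal.ofReal_one]
        refine ENNReal.ofReal_le_ofReal ?_
        by_contra! hlt
        exact h (abs_le.1 hlt.le)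
      refine le_trans ?_ le_add_self
      rcases hp0.eq_or_lt with rfl | hp
      · simp
      · rw [ENNReal.rpow_neg]
        exact ENNReal.inv_le_one.2 (ENNReal.one_le_rpow h1 hp)
  calc _ ≤ ∫⁻ t in Icc (0 : ℝ) 1, ((Icc (-1 : ℝ) 1).indicator (fun t => ‖t‖ₑ ^ (-p)) (t - c) + 1) :=
        lintegral_mono hpt
    _ = (∫⁻ t in Icc (0 : ℝ) 1, (Icc (-1 : ℝ) 1).indicator (fun t => ‖t‖ₑ ^ (-p)) (t - c)) + 1 := by
        rw [lintegral_add_right _ measurable_const]; simp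
    _ ≤ (∫⁻ t, (Icc (-1 : ℝ) 1).indicator (fun t => ‖t‖ₑ ^ (-p)) (t - c)) + 1 := by
        gcongr
        exact Measure.restrict_le_self
    _ = _ := by rw [lintegral_sub_right_eq_self, lintegral_indicator hm]

theorem lintegral_mul_sub_rpow_unit_le {p : ℝ} (hp0 : 0 ≤ p) {r : ℝ} (hr : 0 < r) (c : ℝ) :
    ∫⁻ t in Icc (0 : ℝ) 1, ‖r * t - c‖ₑ ^ (-p) ≤
      ‖r‖ₑ ^ (-p) * ((∫⁻ t in Icc (-1 : ℝ) 1, ‖t‖ₑ ^ (-p)) + 1) := by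
  have h : ∀ t : ℝ, ‖r * t - c‖ₑ ^ (-p) = ‖r‖ₑ ^ (-p) * ‖t - c / r‖ₑ ^ (-p) := by
    intro t
    have h1 : r * t - c = r * (t - c / r) := by field_simp
    rw [h1, enorm_mul, ENNReal.mul_rpow_of_ne_top enorm_ne_top enorm_ne_top]
  simp_rw [h]
  rw [lintegral_const_mul']
  · gcongr
    exact lintegral_sub_rpow_unit_le hp0 _
  · exact ENNReal.rpow_ne_top_of_ne_zero (by simpa using hr.ne') (by simp)

/-- Substitute `t = sin θ`: the factor `cos θ` is the Jacobian and `sin θ ≤ 1` is discarded. The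
cosine version exchanges the roles of the two factors. -/
theorem lintegral_sin_angle_le {p : ℝ} (hp0 : 0 ≤ p) {r : ℝ} (hr : 0 < r) (c : ℝ) :
    ∫⁻ θ in Ioc (0 : ℝ) (Real.pi / 2), ENNReal.ofReal (Real.cos θ * Real.sin θ) *
        ‖r * Real.sin θ - c‖ₑ ^ (-p) ≤
      ‖r‖ₑ ^ (-p) * ((∫⁻ t in Icc (-1 : ℝ) 1, ‖t‖ₑ ^ (-p)) + 1) := by
  refine le_trans ?_ (lintegral_mul_sub_rpow_unit_le hp0 hr c)
  have hinj : InjOn Real.sin (Ioc (0 : ℝ) (Real.pi / 2)) :=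
    fun θ hθ η hη h => Real.injOn_sin ⟨by linarith [hθ.1, Real.pi_pos], hθ.2⟩
      ⟨by linarith [hη.1, Real.pi_pos], hη.2⟩ h
  have hsub : Real.sin '' Ioc (0 : ℝ) (Real.pi / 2) ⊆ Icc 0 1 := by
    rintro _ ⟨θ, hθ, rfl⟩
    exact ⟨Real.sin_nonneg_of_nonneg_of_le_pi hθ.1.le (by linarith [hθ.2, Real.pi_pos]), Real.sin_le_one _⟩
  refine le_trans ?_ (lintegral_mono_set hsub)
  rw [lintegral_image_eq_lintegral_abs_deriv_mul measurableSet_Ioc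
    (fun θ _ => (Real.hasDerivAt_sin θ).hasDerivWithinAt) hinj]
  refine setLIntegral_mono' measurableSet_Ioc fun θ hθ => ?_
  gcongr
  have hc : 0 ≤ Real.cos θ := Real.cos_nonneg_of_mem_Icc ⟨by linarith [hθ.1, Real.pi_pos], hθ.2⟩
  rw [abs_of_nonneg hc]
  exact mul_le_of_le_one_right hc (Real.sin_le_one θ)

theorem lintegral_cos_angle_le {p : ℝ} (hp0 : 0 ≤ p) {r : ℝ} (hr : 0 < r) (c : ℝ) :
    ∫⁻ θ in Ioc (0 : ℝ) (Real.pi / 2), ENNReal.ofReal (Real.cos θ * Real.sin θ) *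
        ‖r * Real.cos θ - c‖ₑ ^ (-p) ≤
      ‖r‖ₑ ^ (-p) * ((∫⁻ t in Icc (-1 : ℝ) 1, ‖t‖ₑ ^ (-p)) + 1) := by
  refine le_trans ?_ (lintegral_mul_sub_rpow_unit_le hp0 hr c)
  have hinj : InjOn Real.cos (Ioc (0 : ℝ) (Real.pi / 2)) :=
    fun θ hθ η hη h => Real.injOn_cos ⟨hθ.1.le, by linarith [hθ.2, Real.pi_pos]⟩
      ⟨hη.1.le, by linarith [hη.2, Real.pi_pos]⟩ h
  have hcos : ∀ θ ∈ Ioc (0 : ℝ) (Real.pi / 2), 0 ≤ Real.cos θ := fun θ hθ =>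
    Real.cos_nonneg_of_mem_Icc ⟨by linarith [hθ.1, Real.pi_pos], hθ.2⟩
  have hsub : Real.cos '' Ioc (0 : ℝ) (Real.pi / 2) ⊆ Icc 0 1 := by
    rintro _ ⟨θ, hθ, rfl⟩
    exact ⟨hcos θ hθ, Real.cos_le_one _⟩
  refine le_trans ?_ (lintegral_mono_set hsub)
  rw [lintegral_image_eq_lintegral_abs_deriv_mul measurableSet_Ioc
    (fun θ _ => (Real.hasDerivAt_cos θ).hasDerivWithinAt) hinj]
  refine setLIntegral_mono' measurableSet_Ioc fun θ hθ => ?_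
  gcongr
  have hs : 0 ≤ Real.sin θ :=
    Real.sin_nonneg_of_nonneg_of_le_pi hθ.1.le (by linarith [hθ.2, Real.pi_pos])
  rw [abs_neg, abs_of_nonneg hs]
  exact mul_le_of_le_one_left hs (Real.cos_le_one θ)

/-! ### Collision kinematics -/

theorem norm_collisionAxis {v vs : Space} (h : vs ≠ v) (θ φ : ℝ) :
    ‖collisionAxis v vs θ φ‖ = 1 ∧ inner ℝ (vs - v) (collisionAxis v vs θ φ) =
      ‖vs - v‖ * Real.cos θ := by
  have hne : vs - v ≠ 0 := sub_ne_zero.2 h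
  have he : ‖relativeDirection v vs‖ = 1 := norm_smul_inv_norm (𝕜 := ℝ) hne
  have horth := orthonormal_frame _ he
  have hu : vs - v = ‖vs - v‖ • relativeDirection v vs := by
    rw [relativeDirection, smul_smul, mul_inv_cancel₀ (norm_ne_zero_iff.2 hne), one_smul]
  rw [collisionAxis]
  set e := relativeDirection v vs
  have h11 : inner ℝ e e = (1 : ℝ) := by rw [real_inner_self_eq_norm_sq, he]; norm_num
  have h22 : inner ℝ (frameSnd e) (frameSnd e) = (1 : ℝ) := by
    rw [real_inner_self_eq_norm_sq, show ‖frameSnd e‖ = 1 from horth.1 1]; norm_num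
  have h33 : inner ℝ (frameTrd e) (frameTrd e) = (1 : ℝ) := by
    rw [real_inner_self_eq_norm_sq, show ‖frameTrd e‖ = 1 from horth.1 2]; norm_num
  have h12 : inner ℝ e (frameSnd e) = (0 : ℝ) := horth.2 (i := 0) (j := 1) (by decide)
  have h13 : inner ℝ e (frameTrd e) = (0 : ℝ) := horth.2 (i := 0) (j := 2) (by decide)
  have h23 : inner ℝ (frameSnd e) (frameTrd e) = (0 : ℝ) := horth.2 (i := 1) (j := 2) (by decide)
  have h21 : inner ℝ (frameSnd e) e = (0 : ℝ) := by rw [real_inner_comm, h12]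
  have h31 : inner ℝ (frameTrd e) e = (0 : ℝ) := by rw [real_inner_comm, h13]
  have h32 : inner ℝ (frameTrd e) (frameSnd e) = (0 : ℝ) := by rw [real_inner_comm, h23]
  constructor
  · have : ‖Real.cos θ • e + (Real.sin θ * Real.cos φ) • frameSnd e +
        (Real.sin θ * Real.sin φ) • frameTrd e‖ ^ 2 = 1 := by
      rw [← real_inner_self_eq_norm_sq]
      simp only [inner_add_left, inner_add_right, real_inner_smul_left, real_inner_smul_right,
        h11, h12, h13, h21, h22, h23, h31, h32, h33]
      nlinarith [Real.sin_sq_add_cos_sq θ, Real.sin_sq_add_cos_sq φ]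
    exact (pow_eq_one_iff_of_nonneg (norm_nonneg _) two_ne_zero).1 this
  · nth_rewrite 1 [hu]
    simp only [inner_add_right, real_inner_smul_left, real_inner_smul_right, h11, h12, h13]
    ring

theorem norm_sq_postVelocity_add {v vs : Space} (h : vs ≠ v) (θ φ : ℝ) :
    ‖postVelocity v vs θ φ‖ ^ 2 + ‖postVelocityStar v vs θ φ‖ ^ 2 = ‖v‖ ^ 2 + ‖vs‖ ^ 2 := by
  obtain ⟨h1, -⟩ := norm_collisionAxis h θ φ
  rw [postVelocity, postVelocityStar]
  set α := collisionAxis v vs θ φ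
  rw [norm_add_sq_real, norm_sub_sq_real, norm_smul, h1, real_inner_smul_right,
    real_inner_smul_right, inner_sub_left, Real.norm_eq_abs, mul_one, sq_abs]
  ring

theorem norm_postVelocity_sub {v vs : Space} (h : vs ≠ v) (θ φ : ℝ) :
    ‖postVelocity v vs θ φ - v‖ = ‖vs - v‖ * |Real.cos θ| := by
  obtain ⟨h1, h2⟩ := norm_collisionAxis h θ φ
  rw [postVelocity, add_sub_cancel_left, norm_smul, h1, h2, mul_one, Real.norm_eq_abs, abs_mul,
    abs_norm]

theorem norm_postVelocityStar_sub {v vs : Space} (h : vs ≠ v) (θ φ : ℝ) :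
    ‖postVelocityStar v vs θ φ - v‖ = ‖vs - v‖ * |Real.sin θ| := by
  obtain ⟨h1, h2⟩ := norm_collisionAxis h θ φ
  rw [← abs_norm (vs - v), ← abs_mul, ← abs_norm (postVelocityStar v vs θ φ - v), ← sq_eq_sq_iff_abs_eq_abs,
    postVelocityStar]
  set α := collisionAxis v vs θ φ
  have : vs - (inner ℝ (vs - v) α) • α - v = (vs - v) - (inner ℝ (vs - v) α) • α := by abel
  rw [this, norm_sub_sq_real, norm_smul, h1, real_inner_smul_right, h2, Real.norm_eq_abs, mul_one,
    sq_abs]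
  nlinarith [Real.sin_sq_add_cos_sq θ]

/-- Since `|v' - v| = |v_* - v| cos θ`, the reverse triangle inequality bounds `|v'|` below by a
function of `θ` alone. Negative powers of `|v'|` thus reduce to one-dimensional angular integrals,
with no change of variables `v_* ↦ v'`. -/
theorem abs_sub_le_norm_postVelocity {v vs : Space} (h : vs ≠ v) {θ : ℝ} (hθ : 0 ≤ Real.cos θ) (φ : ℝ) :
    ‖‖vs - v‖ * Real.cos θ - ‖v‖‖ₑ ≤ ‖postVelocity v vs θ φ‖ₑ := by
  have h1 := norm_postVelocity_sub h θ φ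
  rw [abs_of_nonneg hθ] at h1
  rw [enorm_le_iff_norm_le, ← h1, Real.norm_eq_abs, ← norm_neg v]
  refine (abs_norm_sub_norm_le _ _).trans_eq ?_
  congr 1; abel

theorem abs_sub_le_norm_postVelocityStar {v vs : Space} (h : vs ≠ v) {θ : ℝ} (hθ : 0 ≤ Real.sin θ)
    (φ : ℝ) : ‖‖vs - v‖ * Real.sin θ - ‖v‖‖ₑ ≤ ‖postVelocityStar v vs θ φ‖ₑ := by
  have h1 := norm_postVelocityStar_sub h θ φ
  rw [abs_of_nonneg hθ] at h1
  rw [enorm_le_iff_norm_le, ← h1, Real.norm_eq_abs, ← norm_neg v]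
  refine (abs_norm_sub_norm_le _ _).trans_eq ?_
  congr 1; abel

theorem measurable_toSpace {X : Type*} [MeasurableSpace X] {f g h : X → ℝ} (hf : Measurable f)
    (hg : Measurable g) (hh : Measurable h) :
    Measurable fun x => (!₂[f x, g x, h x] : Space) := by
  have h1 : Measurable fun x => ![f x, g x, h x] := by
    refine measurable_pi_iff.2 fun i => ?_
    fin_cases i <;> simpa
  exact (PiLp.continuous_toLp 2 _).measurable.comp h1

theorem measurable_coord (i : Fin 3) : Measurable fun e : Space => e i := by
  fun_prop

theorem measurable_frameSnd : Measurable frameSnd := by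
  unfold frameSnd
  have h0 := measurable_coord 0
  have h1 := measurable_coord 1
  refine Measurable.ite ?_ measurable_const (measurable_toSpace (by fun_prop) (by fun_prop) measurable_const)
  exact (h0 (measurableSet_singleton 0)).inter (h1 (measurableSet_singleton 0))

theorem measurable_frameTrd : Measurable frameTrd := by
  unfold frameTrd
  have h := measurable_frameSnd
  have hc : ∀ i, Measurable fun e : Space => frameSnd e i := fun i => (measurable_coord i).comp h
  have hd : ∀ i, Measurable fun e : Space => e i := measurable_coord
  exact measurable_toSpace (((hd 1).mul (hc 2)).sub ((hd 2).mul (hc 1)))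
    (((hd 2).mul (hc 0)).sub ((hd 0).mul (hc 2))) (((hd 0).mul (hc 1)).sub ((hd 1).mul (hc 0)))

theorem measurable_collisionAxis {X : Type*} [MeasurableSpace X] {v vs : X → Space} {θ φ : X → ℝ}
    (hv : Measurable v) (hvs : Measurable vs) (hθ : Measurable θ) (hφ : Measurable φ) :
    Measurable fun x => collisionAxis (v x) (vs x) (θ x) (φ x) := by
  have he : Measurable fun x => relativeDirection (v x) (vs x) := by
    unfold relativeDirection
    exact (hvs.sub hv).norm.inv.smul (hvs.sub hv)
  unfold collisionAxis
  exact (((Real.measurable_cos.comp hθ).smul he).add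
    (((Real.measurable_sin.comp hθ).mul (Real.measurable_cos.comp hφ)).smul
      (measurable_frameSnd.comp he))).add
    (((Real.measurable_sin.comp hθ).mul (Real.measurable_sin.comp hφ)).smul
      (measurable_frameTrd.comp he))

theorem measurable_postVelocity {X : Type*} [MeasurableSpace X] {v vs : X → Space} {θ φ : X → ℝ}
    (hv : Measurable v) (hvs : Measurable vs) (hθ : Measurable θ) (hφ : Measurable φ) :
    Measurable fun x => postVelocity (v x) (vs x) (θ x) (φ x) := by
  have h := measurable_collisionAxis hv hvs hθ hφ
  have hi : Measurable fun x => inner ℝ (vs x - v x) (collisionAxis (v x) (vs x) (θ x) (φ x)) :=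
    (hvs.sub hv).inner h
  exact hv.add (hi.smul h)

theorem measurable_postVelocityStar {X : Type*} [MeasurableSpace X] {v vs : X → Space} {θ φ : X → ℝ}
    (hv : Measurable v) (hvs : Measurable vs) (hθ : Measurable θ) (hφ : Measurable φ) :
    Measurable fun x => postVelocityStar (v x) (vs x) (θ x) (φ x) := by
  have h := measurable_collisionAxis hv hvs hθ hφ
  have hi : Measurable fun x => inner ℝ (vs x - v x) (collisionAxis (v x) (vs x) (θ x) (φ x)) :=
    (hvs.sub hv).inner h
  exact hvs.sub (hi.smul h)

/-! ### The collision integral as an integral against a family of measures -/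

theorem integrable_gaussian {b : ℝ} (hb : 0 < b) :
    Integrable fun v : Space => Real.exp (-b * ‖v‖ ^ 2) := by
  -- The integral of a non-integrable function is 0, whereas the Gaussian formula gives a positive
  -- value.
  by_contra h
  have h1 := GaussianFourier.integral_rexp_neg_mul_sq_norm (V := Space) hb
  rw [integral_undef h] at h1
  have : 0 < (Real.pi / b) ^ ((Module.finrank ℝ Space : ℝ) / 2) := by positivity
  linarith

/-- The square root of the Maxwellian. -/
def rootMaxwellian (v : Space) : ℝ := Real.sqrt (maxwellian v)

theorem maxwellian_pos (v : Space) : 0 < maxwellian v := by unfold maxwellian; positivity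

theorem rootMaxwellian_pos (v : Space) : 0 < rootMaxwellian v := Real.sqrt_pos.2 (maxwellian_pos v)

theorem rootMaxwellian_mul_self (v : Space) : rootMaxwellian v * rootMaxwellian v = maxwellian v :=
  Real.mul_self_sqrt (maxwellian_pos v).le

theorem rootMaxwellian_eq (v : Space) :
    rootMaxwellian v = Real.sqrt (Real.pi ^ (-(3 / 2) : ℝ)) * Real.exp (-(1 / 2) * ‖v‖ ^ 2) := by
  rw [rootMaxwellian, maxwellian, Real.sqrt_mul (by positivity)]
  rw [← Real.exp_half]
  congr 2
  ring

theorem rootMaxwellian_le_exp (v : Space) : rootMaxwellian v ≤ Real.exp (-(1 / 2) * ‖v‖ ^ 2) := by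
  rw [rootMaxwellian_eq]
  refine mul_le_of_le_one_left (Real.exp_pos _).le ?_
  refine Real.sqrt_le_iff.2 ⟨zero_le_one, ?_⟩
  rw [one_pow]
  refine Real.rpow_le_one_of_one_le_of_nonpos ?_ (by norm_num)
  linarith [Real.pi_gt_three]

theorem rootMaxwellian_le_gaussian {b : ℝ} (hb : b ≤ 1 / 2) (v : Space) :
    rootMaxwellian v ≤ Real.exp (-b * ‖v‖ ^ 2) := by
  refine (rootMaxwellian_le_exp v).trans (Real.exp_le_exp.2 ?_)
  nlinarith [sq_nonneg ‖v‖]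

theorem rootMaxwellian_le_one (v : Space) : rootMaxwellian v ≤ 1 := by
  simpa using rootMaxwellian_le_gaussian (b := 0) (by norm_num) v

theorem continuous_maxwellian : Continuous maxwellian := by unfold maxwellian; fun_prop

theorem continuous_rootMaxwellian : Continuous rootMaxwellian :=
  continuous_maxwellian.sqrt

/-- Energy conservation. It cancels the factor `M^(-1/2)(v)` in `K` and leaves the bounded kernels
in `collisionIntegral_eq`. -/
theorem rootMaxwellian_conservation {v vs : Space} (h : vs ≠ v) (θ φ : ℝ) :
    rootMaxwellian (postVelocity v vs θ φ) * rootMaxwellian (postVelocityStar v vs θ φ) =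
      rootMaxwellian v * rootMaxwellian vs := by
  have h1 := norm_sq_postVelocity_add h θ φ
  simp only [rootMaxwellian_eq]
  rw [mul_mul_mul_comm, ← Real.exp_add, mul_mul_mul_comm, ← Real.exp_add, ← mul_add, ← mul_add, h1]

/-- Weight that dominates the dependence of all collision kernels on `v_*`. -/
def velocityWeight (v : Space) : ℝ := rootMaxwellian v * (1 + ‖v‖)

theorem velocityWeight_nonneg (v : Space) : 0 ≤ velocityWeight v :=
  mul_nonneg (rootMaxwellian_pos v).le (by positivity)

theorem continuous_velocityWeight : Continuous velocityWeight := by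
  have := continuous_rootMaxwellian
  unfold velocityWeight; fun_prop

theorem velocityWeight_le (v : Space) : velocityWeight v ≤ 2 * Real.exp (-(1 / 4) * ‖v‖ ^ 2) := by
  have h1 := rootMaxwellian_le_exp v
  have h2 : 1 + ‖v‖ ≤ 2 * Real.exp (1 / 4 * ‖v‖ ^ 2) := by
    have := Real.add_one_le_exp (1 / 4 * ‖v‖ ^ 2)
    nlinarith [sq_nonneg (‖v‖ - 1)]
  calc velocityWeight v ≤ Real.exp (-(1 / 2) * ‖v‖ ^ 2) * (2 * Real.exp (1 / 4 * ‖v‖ ^ 2)) := by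
        unfold velocityWeight; gcongr
    _ = 2 * Real.exp (-(1 / 4) * ‖v‖ ^ 2) := by
        rw [mul_left_comm, ← Real.exp_add]; congr 2; ring

theorem velocityWeight_le_two (v : Space) : velocityWeight v ≤ 2 := by
  refine (velocityWeight_le v).trans ?_
  have : Real.exp (-(1 / 4) * ‖v‖ ^ 2) ≤ 1 := Real.exp_le_one_iff.2 (by nlinarith [sq_nonneg ‖v‖])
  linarith

theorem integrable_velocityWeight : Integrable velocityWeight := by
  refine Integrable.mono' ((integrable_gaussian (b := 1 / 4) (by norm_num)).const_mul 2)
    continuous_velocityWeight.aestronglyMeasurable (.of_forall fun v => ?_)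
  rw [Real.norm_of_nonneg (velocityWeight_nonneg v)]
  exact velocityWeight_le v

/-- Lebesgue measure on the range of the angles `(φ, θ)`. -/
abbrev angleMeasure : Measure (ℝ × ℝ) :=
  (volume.restrict (Ioc 0 (2 * Real.pi))).prod (volume.restrict (Ioc 0 (Real.pi / 2)))

/-- Lebesgue measure on the range of the collision parameters `(v_*, φ, θ)`. -/
abbrev paramMeasure : Measure (Space × ℝ × ℝ) := volume.prod angleMeasure

theorem ae_paramMeasure (v : Space) :
    ∀ᵐ p ∂paramMeasure, p.1 ≠ v ∧ p.2.2 ∈ Ioc 0 (Real.pi / 2) := by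
  have h1 : ∀ᵐ p ∂paramMeasure, p.1 ≠ v :=
    Measure.quasiMeasurePreserving_fst.ae (compl_mem_ae_iff.2 (measure_singleton v))
  have h2 : ∀ᵐ p ∂paramMeasure, p.2.2 ∈ Ioc 0 (Real.pi / 2) :=
    Measure.quasiMeasurePreserving_snd.ae
      (Measure.quasiMeasurePreserving_snd.ae (ae_restrict_mem measurableSet_Ioc))
  exact h1.and h2

theorem intervalIntegral_eq_integral_paramMeasure {H : Space → ℝ → ℝ → ℝ}
    (h : Integrable (fun p : Space × ℝ × ℝ => H p.1 p.2.1 p.2.2) paramMeasure) :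
    ∫ vs : Space, ∫ φ in (0 : ℝ)..(2 * Real.pi), ∫ θ in (0 : ℝ)..(Real.pi / 2), H vs φ θ =
      ∫ p, H p.1 p.2.1 p.2.2 ∂paramMeasure := by
  rw [integral_prod _ h]
  refine integral_congr_ae ?_
  filter_upwards [h.prod_right_ae] with vs hvs
  rw [intervalIntegral.integral_of_le (by positivity), integral_prod _ hvs]
  refine integral_congr_ae (.of_forall fun φ => ?_)
  exact intervalIntegral.integral_of_le (by positivity)

section Cutoff

variable {B : ℝ → ℝ → ℝ} {γ : ℝ}

/-- For `0 ≤ γ ≤ 1` one has `r^γ ≤ 1 + r ≤ (1+|v|)(1+|v_*|)`, so the dependence on `v` and `v_*`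
separates and `γ` disappears from the estimates. -/
theorem AngularCutoff.exists_bound (hB : AngularCutoff B γ) (hγ₀ : 0 ≤ γ) (hγ₁ : γ ≤ 1) :
    ∃ C : ℝ, 0 ≤ C ∧ ∀ v vs : Space, vs ≠ v → ∀ θ ∈ Ioc 0 (Real.pi / 2),
      0 ≤ B ‖v - vs‖ θ ∧
      B ‖v - vs‖ θ ≤ C * ((1 + ‖v‖) * (1 + ‖vs‖)) * (Real.cos θ * Real.sin θ) := by
  obtain ⟨C, hC⟩ := hB.bound
  refine ⟨|C|, abs_nonneg _, fun v vs hne θ hθ => ?_⟩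
  have hr : 0 < ‖v - vs‖ := norm_pos_iff.2 (sub_ne_zero.2 hne.symm)
  obtain ⟨h1, h2⟩ := hC _ θ hr hθ.1.le hθ.2
  refine ⟨h1, h2.trans ?_⟩
  have hc : 0 ≤ Real.cos θ := Real.cos_nonneg_of_mem_Icc ⟨by linarith [hθ.1, Real.pi_pos], hθ.2⟩
  have hs : 0 ≤ Real.sin θ :=
    Real.sin_nonneg_of_nonneg_of_le_pi hθ.1.le (by linarith [hθ.2, Real.pi_pos])
  rw [mul_assoc]
  gcongr
  · exact le_abs_self C
  · have h3 : ‖v - vs‖ ^ γ ≤ 1 + ‖v - vs‖ := by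
      rcases le_or_gt ‖v - vs‖ 1 with h | h
      · exact (Real.rpow_le_one hr.le h hγ₀).trans (by linarith)
      · have := Real.rpow_le_rpow_of_exponent_le h.le hγ₁
        rw [Real.rpow_one] at this
        linarith
    have h4 := norm_sub_le v vs
    nlinarith [mul_nonneg (norm_nonneg v) (norm_nonneg vs)]

theorem cos_mul_sin_mem {θ : ℝ} (hθ : θ ∈ Ioc 0 (Real.pi / 2)) :
    0 ≤ Real.cos θ * Real.sin θ ∧ Real.cos θ * Real.sin θ ≤ 1 := by
  have hc : 0 ≤ Real.cos θ := Real.cos_nonneg_of_mem_Icc ⟨by linarith [hθ.1, Real.pi_pos], hθ.2⟩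
  have hs : 0 ≤ Real.sin θ :=
    Real.sin_nonneg_of_nonneg_of_le_pi hθ.1.le (by linarith [hθ.2, Real.pi_pos])
  exact ⟨mul_nonneg hc hs, mul_le_one₀ (Real.cos_le_one θ) hs (Real.sin_le_one θ)⟩

theorem measurable_crossSection {X : Type*} [MeasurableSpace X] (hB : Measurable (Function.uncurry B))
    {v vs : X → Space} {θ : X → ℝ} (hv : Measurable v) (hvs : Measurable vs) (hθ : Measurable θ) :
    Measurable fun x => B ‖v x - vs x‖ (θ x) :=
  hB.comp ((hv.sub hvs).norm.prodMk hθ)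

/-- A function on the parameters that is dominated by the velocity weight and the cross-section is
integrable. -/
theorem integrable_paramMeasure_of_bound (hB : AngularCutoff B γ) (hγ₀ : 0 ≤ γ) (hγ₁ : γ ≤ 1)
    (v : Space) {H : Space × ℝ × ℝ → ℝ} (hH : Measurable H) {c : ℝ}
    (hb : ∀ p, p.1 ≠ v → |H p| ≤ c * rootMaxwellian p.1 * |B ‖v - p.1‖ p.2.2|) :
    Integrable H paramMeasure := by
  obtain ⟨C, hC0, hC⟩ := hB.exists_bound hγ₀ hγ₁
  refine Integrable.mono' ((integrable_velocityWeight.comp_fst angleMeasure).const_mul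
    (|c| * C * (1 + ‖v‖))) hH.aestronglyMeasurable ?_
  filter_upwards [ae_paramMeasure v] with p hp
  obtain ⟨h1, h2⟩ := hC v p.1 hp.1 _ hp.2
  obtain ⟨h3, h4⟩ := cos_mul_sin_mem hp.2
  have hm := (rootMaxwellian_pos p.1).le
  calc ‖H p‖ ≤ c * rootMaxwellian p.1 * |B ‖v - p.1‖ p.2.2| := hb p hp.1
    _ ≤ |c| * rootMaxwellian p.1 * |B ‖v - p.1‖ p.2.2| := by gcongr; exact le_abs_self c
    _ ≤ |c| * rootMaxwellian p.1 * (C * ((1 + ‖v‖) * (1 + ‖p.1‖)) * 1) := by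
      rw [abs_of_nonneg h1]
      gcongr
      exact h2.trans (by gcongr)
    _ = |c| * C * (1 + ‖v‖) * velocityWeight p.1 := by rw [velocityWeight]; ring

/-- Kernel of the first gain term, where `f` is evaluated at `v_*'`. -/
def gainStarKernel (B : ℝ → ℝ → ℝ) (v : Space) (p : Space × ℝ × ℝ) : ℝ :=
  rootMaxwellian (postVelocity v p.1 p.2.2 p.2.1) * rootMaxwellian p.1 * B ‖v - p.1‖ p.2.2

/-- Kernel of the second gain term, where `f` is evaluated at `v'`. -/
def gainKernel (B : ℝ → ℝ → ℝ) (v : Space) (p : Space × ℝ × ℝ) : ℝ :=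
  rootMaxwellian (postVelocityStar v p.1 p.2.2 p.2.1) * rootMaxwellian p.1 * B ‖v - p.1‖ p.2.2

/-- Kernel of the loss term, where `f` is evaluated at `v_*`. -/
def lossKernel (B : ℝ → ℝ → ℝ) (v : Space) (p : Space × ℝ × ℝ) : ℝ :=
  rootMaxwellian v * rootMaxwellian p.1 * B ‖v - p.1‖ p.2.2

/-- The integrand of the collision integral `K(f)(v)`. -/
def collisionIntegrand (B : ℝ → ℝ → ℝ) (f : Space → ℝ) (v : Space) (p : Space × ℝ × ℝ) : ℝ :=
  gainStarKernel B v p * f (postVelocityStar v p.1 p.2.2 p.2.1) +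
    gainKernel B v p * f (postVelocity v p.1 p.2.2 p.2.1) - lossKernel B v p * f p.1

theorem measurable_star {X : Type*} [MeasurableSpace X] {v : X → Space} {p : X → Space × ℝ × ℝ}
    (hv : Measurable v) (hp : Measurable p) :
    Measurable fun x => postVelocityStar (v x) (p x).1 (p x).2.2 (p x).2.1 :=
  measurable_postVelocityStar hv hp.fst hp.snd.snd hp.snd.fst

theorem measurable_post {X : Type*} [MeasurableSpace X] {v : X → Space} {p : X → Space × ℝ × ℝ}
    (hv : Measurable v) (hp : Measurable p) :
    Measurable fun x => postVelocity (v x) (p x).1 (p x).2.2 (p x).2.1 :=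
  measurable_postVelocity hv hp.fst hp.snd.snd hp.snd.fst

theorem measurable_gainStarKernel (hB : Measurable (Function.uncurry B)) :
    Measurable (Function.uncurry (gainStarKernel B)) := by
  have hm := continuous_rootMaxwellian.measurable
  exact ((hm.comp (measurable_post measurable_fst measurable_snd)).mul
    (hm.comp measurable_snd.fst)).mul
    (measurable_crossSection hB measurable_fst measurable_snd.fst measurable_snd.snd.snd)

theorem measurable_gainKernel (hB : Measurable (Function.uncurry B)) :
    Measurable (Function.uncurry (gainKernel B)) := by
  have hm := continuous_rootMaxwellian.measurable
  exact ((hm.comp (measurable_star measurable_fst measurable_snd)).mul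
    (hm.comp measurable_snd.fst)).mul
    (measurable_crossSection hB measurable_fst measurable_snd.fst measurable_snd.snd.snd)

theorem measurable_lossKernel (hB : Measurable (Function.uncurry B)) :
    Measurable (Function.uncurry (lossKernel B)) := by
  have hm := continuous_rootMaxwellian.measurable
  exact ((hm.comp measurable_fst).mul (hm.comp measurable_snd.fst)).mul
    (measurable_crossSection hB measurable_fst measurable_snd.fst measurable_snd.snd.snd)

theorem integrable_kernel_mul (hB : AngularCutoff B γ) (hγ₀ : 0 ≤ γ) (hγ₁ : γ ≤ 1)
    {f : Space → ℝ} (hf : Measurable f) {C : ℝ} (hC : ∀ w, |f w| ≤ C) (v : Space) :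
    Integrable (fun p => gainStarKernel B v p * f (postVelocityStar v p.1 p.2.2 p.2.1)) paramMeasure ∧
    Integrable (fun p => gainKernel B v p * f (postVelocity v p.1 p.2.2 p.2.1)) paramMeasure ∧
    Integrable (fun p => lossKernel B v p * f p.1) paramMeasure := by
  have hm := hB.measurable
  have bound : ∀ (a w vs : Space) (θ : ℝ), |rootMaxwellian a * rootMaxwellian vs * B ‖v - vs‖ θ * f w| ≤
      C * rootMaxwellian vs * |B ‖v - vs‖ θ| := by
    intro a w vs θ
    rw [abs_mul, abs_mul, abs_mul, abs_of_pos (rootMaxwellian_pos a), abs_of_pos (rootMaxwellian_pos vs)]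
    have h1 := rootMaxwellian_le_one a
    have h2 := (rootMaxwellian_pos vs).le
    have h3 := (rootMaxwellian_pos a).le
    have hC0 : 0 ≤ C := (abs_nonneg _).trans (hC w)
    calc rootMaxwellian a * rootMaxwellian vs * |B ‖v - vs‖ θ| * |f w|
        ≤ 1 * rootMaxwellian vs * |B ‖v - vs‖ θ| * C := by gcongr; exact hC w
      _ = _ := by ring
  have hs : Measurable fun p : Space × ℝ × ℝ => postVelocityStar v p.1 p.2.2 p.2.1 :=
    measurable_star measurable_const measurable_id
  have hp : Measurable fun p : Space × ℝ × ℝ => postVelocity v p.1 p.2.2 p.2.1 :=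
    measurable_post measurable_const measurable_id
  exact ⟨integrable_paramMeasure_of_bound hB hγ₀ hγ₁ v
      (((measurable_gainStarKernel hm).of_uncurry_left).mul (hf.comp hs))
      fun p _ => bound _ _ _ _,
    integrable_paramMeasure_of_bound hB hγ₀ hγ₁ v
      (((measurable_gainKernel hm).of_uncurry_left).mul (hf.comp hp))
      fun p _ => bound _ _ _ _,
    integrable_paramMeasure_of_bound hB hγ₀ hγ₁ v
      (((measurable_lossKernel hm).of_uncurry_left).mul (hf.comp measurable_fst))
      fun p _ => bound _ _ _ _⟩

theorem integrable_collisionIntegrand (hB : AngularCutoff B γ) (hγ₀ : 0 ≤ γ) (hγ₁ : γ ≤ 1)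
    {f : Space → ℝ} (hf : Measurable f) {C : ℝ} (hC : ∀ w, |f w| ≤ C) (v : Space) :
    Integrable (collisionIntegrand B f v) paramMeasure := by
  obtain ⟨i1, i2, i3⟩ := integrable_kernel_mul hB hγ₀ hγ₁ hf hC v
  exact (i1.add i2).sub i3

theorem collisionIntegral_eq (hB : AngularCutoff B γ) (hγ₀ : 0 ≤ γ) (hγ₁ : γ ≤ 1)
    {f : Space → ℝ} (hf : Measurable f) {C : ℝ} (hC : ∀ w, |f w| ≤ C) (v : Space) :
    collisionIntegral B f v = ∫ p, collisionIntegrand B f v p ∂paramMeasure := by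
  obtain ⟨i1, i2, i3⟩ := integrable_kernel_mul hB hγ₀ hγ₁ hf hC v
  have hm0 := (rootMaxwellian_pos v).ne'
  have e1 : (fun p : Space × ℝ × ℝ => maxwellian (postVelocity v p.1 p.2.2 p.2.1) *
      weighted f (postVelocityStar v p.1 p.2.2 p.2.1) * B ‖v - p.1‖ p.2.2) =ᵐ[paramMeasure]
      fun p => rootMaxwellian v *
        (gainStarKernel B v p * f (postVelocityStar v p.1 p.2.2 p.2.1)) := by
    filter_upwards [ae_paramMeasure v] with p hp
    have h := rootMaxwellian_conservation hp.1 p.2.2 p.2.1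
    rw [weighted, ← rootMaxwellian, ← rootMaxwellian_mul_self, gainStarKernel]
    linear_combination (rootMaxwellian (postVelocity v p.1 p.2.2 p.2.1) *
      f (postVelocityStar v p.1 p.2.2 p.2.1) * B ‖v - p.1‖ p.2.2) * h
  have e2 : (fun p : Space × ℝ × ℝ => weighted f (postVelocity v p.1 p.2.2 p.2.1) *
      maxwellian (postVelocityStar v p.1 p.2.2 p.2.1) * B ‖v - p.1‖ p.2.2) =ᵐ[paramMeasure]
      fun p => rootMaxwellian v *
        (gainKernel B v p * f (postVelocity v p.1 p.2.2 p.2.1)) := by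
    filter_upwards [ae_paramMeasure v] with p hp
    have h := rootMaxwellian_conservation hp.1 p.2.2 p.2.1
    rw [weighted, ← rootMaxwellian, ← rootMaxwellian_mul_self, gainKernel]
    linear_combination (rootMaxwellian (postVelocityStar v p.1 p.2.2 p.2.1) *
      f (postVelocity v p.1 p.2.2 p.2.1) * B ‖v - p.1‖ p.2.2) * h
  have e3 : (fun p : Space × ℝ × ℝ => maxwellian v * weighted f p.1 * B ‖v - p.1‖ p.2.2)
      =ᵐ[paramMeasure] fun p => rootMaxwellian v * (lossKernel B v p * f p.1) := by
    refine .of_forall fun p => ?_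
    have h : weighted f p.1 = rootMaxwellian p.1 * f p.1 := rfl
    simp only [h, lossKernel]
    rw [← rootMaxwellian_mul_self]
    ring
  have j1 := (i1.const_mul (rootMaxwellian v)).congr e1.symm
  have j2 := (i2.const_mul (rootMaxwellian v)).congr e2.symm
  have j3 := (i3.const_mul (rootMaxwellian v)).congr e3.symm
  rw [collisionIntegral, collisionGain, collisionGain, collisionLoss,
    intervalIntegral_eq_integral_paramMeasure (H := fun vs φ θ => maxwellian (postVelocity v vs θ φ) *
      weighted f (postVelocityStar v vs θ φ) * B ‖v - vs‖ θ) j1,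
    intervalIntegral_eq_integral_paramMeasure (H := fun vs φ θ => weighted f (postVelocity v vs θ φ) *
      maxwellian (postVelocityStar v vs θ φ) * B ‖v - vs‖ θ) j2,
    intervalIntegral_eq_integral_paramMeasure (H := fun vs φ θ => maxwellian v * weighted f vs *
      B ‖v - vs‖ θ) j3,
    integral_congr_ae e1, integral_congr_ae e2, integral_congr_ae e3,
    integral_const_mul, integral_const_mul, integral_const_mul, ← rootMaxwellian, ← mul_add, ← mul_sub,
    inv_mul_cancel_left₀ hm0, ← integral_add i1 i2]
  exact (integral_sub (i1.add i2) i3).symm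

theorem measurable_collisionIntegral (hB : AngularCutoff B γ) (hγ₀ : 0 ≤ γ) (hγ₁ : γ ≤ 1)
    {f : Space → Space → ℝ} (hf : Measurable (Function.uncurry f)) {C : ℝ} (hC : ∀ x w, |f x w| ≤ C) :
    Measurable fun z : Space × Space => collisionIntegral B (f z.1) z.2 := by
  have h : (fun z : Space × Space => collisionIntegral B (f z.1) z.2) =
      fun z => ∫ p, collisionIntegrand B (f z.1) z.2 p ∂paramMeasure := by
    ext z
    exact collisionIntegral_eq hB hγ₀ hγ₁ (hf.comp measurable_prodMk_left) (hC z.1) z.2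
  rw [h]
  have hm := hB.measurable
  have hv : Measurable fun q : (Space × Space) × Space × ℝ × ℝ => q.1.2 := measurable_fst.snd
  have hx : Measurable fun q : (Space × Space) × Space × ℝ × ℝ => q.1.1 := measurable_fst.fst
  have hvp := hv.prodMk (measurable_snd (α := Space × Space) (β := Space × ℝ × ℝ))
  have hmeas : Measurable fun q : (Space × Space) × Space × ℝ × ℝ =>
      collisionIntegrand B (f q.1.1) q.1.2 q.2 :=
    ((((measurable_gainStarKernel hm).comp hvp).mul
      (hf.comp (hx.prodMk (measurable_star hv measurable_snd)))).add
    (((measurable_gainKernel hm).comp hvp).mul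
      (hf.comp (hx.prodMk (measurable_post hv measurable_snd))))).sub
    (((measurable_lossKernel hm).comp hvp).mul (hf.comp (hx.prodMk measurable_snd.fst)))
  exact (hmeas.stronglyMeasurable.integral_prod_right').measurable

/-- The measure `κ_v` with `|K(f)(v)| ≤ ∫ |f| dκ_v`. -/
def collisionKernel (B : ℝ → ℝ → ℝ) (v : Space) : Measure Space :=
  (paramMeasure.withDensity fun p => ‖gainStarKernel B v p‖ₑ).map
      (fun p => postVelocityStar v p.1 p.2.2 p.2.1) +
    (paramMeasure.withDensity fun p => ‖gainKernel B v p‖ₑ).map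
      (fun p => postVelocity v p.1 p.2.2 p.2.1) +
    (paramMeasure.withDensity fun p => ‖lossKernel B v p‖ₑ).map fun p => p.1

theorem lintegral_collisionKernel (hB : Measurable (Function.uncurry B)) (v : Space)
    {h : Space → ℝ≥0∞} (hh : Measurable h) :
    ∫⁻ w, h w ∂collisionKernel B v =
      (∫⁻ p, ‖gainStarKernel B v p‖ₑ * h (postVelocityStar v p.1 p.2.2 p.2.1) ∂paramMeasure) +
      (∫⁻ p, ‖gainKernel B v p‖ₑ * h (postVelocity v p.1 p.2.2 p.2.1) ∂paramMeasure) +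
      ∫⁻ p, ‖lossKernel B v p‖ₑ * h p.1 ∂paramMeasure := by
  have hs : Measurable fun p : Space × ℝ × ℝ => postVelocityStar v p.1 p.2.2 p.2.1 :=
    measurable_star measurable_const measurable_id
  have hp : Measurable fun p : Space × ℝ × ℝ => postVelocity v p.1 p.2.2 p.2.1 :=
    measurable_post measurable_const measurable_id
  have m1 : Measurable (gainStarKernel B v) := (measurable_gainStarKernel hB).of_uncurry_left
  have m2 : Measurable (gainKernel B v) := (measurable_gainKernel hB).of_uncurry_left
  have m3 : Measurable (lossKernel B v) := (measurable_lossKernel hB).of_uncurry_left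
  rw [collisionKernel, lintegral_add_measure, lintegral_add_measure, lintegral_map hh hs,
    lintegral_map hh hp, lintegral_map hh measurable_fst]
  congr 1
  · congr 1
    · exact lintegral_withDensity_eq_lintegral_mul _ m1.enorm (hh.comp hs)
    · exact lintegral_withDensity_eq_lintegral_mul _ m2.enorm (hh.comp hp)
  · exact lintegral_withDensity_eq_lintegral_mul _ m3.enorm (hh.comp measurable_fst)

/-- Stated for differences so that one estimate serves twice: with `g = 0` for the size of `K f`,
and with two positions `x, y` for its spatial increments. -/
theorem enorm_collisionIntegral_sub_le (hB : AngularCutoff B γ) (hγ₀ : 0 ≤ γ) (hγ₁ : γ ≤ 1)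
    {f g : Space → ℝ} (hf : Measurable f) (hg : Measurable g) {C D : ℝ} (hC : ∀ w, |f w| ≤ C)
    (hD : ∀ w, |g w| ≤ D) (v : Space) :
    ‖collisionIntegral B f v - collisionIntegral B g v‖ₑ ≤
      ∫⁻ w, ‖f w - g w‖ₑ ∂collisionKernel B v := by
  have hm := hB.measurable
  have hp : Measurable fun p : Space × ℝ × ℝ => postVelocity v p.1 p.2.2 p.2.1 :=
    measurable_post measurable_const measurable_id
  have m2 : Measurable (gainKernel B v) := (measurable_gainKernel hm).of_uncurry_left
  have m3 : Measurable (lossKernel B v) := (measurable_lossKernel hm).of_uncurry_left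
  have hfg : Measurable fun w => ‖f w - g w‖ₑ := (hf.sub hg).enorm
  rw [lintegral_collisionKernel hm v hfg, collisionIntegral_eq hB hγ₀ hγ₁ hf hC,
    collisionIntegral_eq hB hγ₀ hγ₁ hg hD,
    ← integral_sub (integrable_collisionIntegrand hB hγ₀ hγ₁ hf hC v)
      (integrable_collisionIntegrand hB hγ₀ hγ₁ hg hD v)]
  refine (enorm_integral_le_lintegral_enorm _).trans ?_
  have k2 : Measurable fun p => ‖gainKernel B v p‖ₑ * ‖f (postVelocity v p.1 p.2.2 p.2.1) -
      g (postVelocity v p.1 p.2.2 p.2.1)‖ₑ := m2.enorm.mul (hfg.comp hp)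
  have k3 : Measurable fun p => ‖lossKernel B v p‖ₑ * ‖f p.1 - g p.1‖ₑ :=
    m3.enorm.mul (hfg.comp measurable_fst)
  rw [← lintegral_add_right _ k2, ← lintegral_add_right _ k3]
  refine lintegral_mono fun p => ?_
  simp only [← enorm_mul]
  have h : collisionIntegrand B f v p - collisionIntegrand B g v p =
      (gainStarKernel B v p * (f (postVelocityStar v p.1 p.2.2 p.2.1) -
        g (postVelocityStar v p.1 p.2.2 p.2.1)) +
      gainKernel B v p * (f (postVelocity v p.1 p.2.2 p.2.1) - g (postVelocity v p.1 p.2.2 p.2.1))) -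
      lossKernel B v p * (f p.1 - g p.1) := by
    simp only [collisionIntegrand]; ring
  rw [h]
  exact enorm_sub_le.trans (add_le_add_left (enorm_add_le _ _) _)

end Cutoff

/-- The weight `(1 + |v|^(-p)) exp(-b|v|²)`, infinite at `v = 0` when `p > 0`. -/
def singularGaussian (p b : ℝ) (v : Space) : ℝ≥0∞ :=
  (1 + ‖v‖ₑ ^ (-p)) * ENNReal.ofReal (Real.exp (-b * ‖v‖ ^ 2))

theorem measurable_singularGaussian (p b : ℝ) : Measurable (singularGaussian p b) := by
  unfold singularGaussian; fun_prop

theorem lintegral_ball_enorm_rpow_lt_top {p R : ℝ} (hp : p < 3) :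
    ∫⁻ u in Metric.ball (0 : Space) R, ‖u‖ₑ ^ (-p) < ∞ := by
  refine lt_of_le_of_lt (lintegral_mono_ae (ae_restrict_of_ae ?_)) (lintegral_ball_rpow_lt_top (R := R) hp)
  filter_upwards [compl_mem_ae_iff.2 (measure_singleton (0 : Space))] with u hu
  rw [← ofReal_norm, ENNReal.ofReal_rpow_of_pos (norm_pos_iff.2 hu)]

/-- Near `v` the weight is bounded and the power is integrable in dimension three; away from `v` the
power is at most 1 and the weight is integrable. -/
theorem exists_lintegral_velocityWeight_le {p : ℝ} (hp0 : 0 ≤ p) (hp : p < 3) :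
    ∃ K : ℝ≥0∞, K < ∞ ∧ ∀ v : Space,
      ∫⁻ u, ENNReal.ofReal (velocityWeight u) * (1 + ‖u - v‖ₑ ^ (-p)) ≤ K := by
  have h1 : ∫⁻ u, ENNReal.ofReal (velocityWeight u) < ∞ := integrable_velocityWeight.lintegral_lt_top
  have h2 := lintegral_ball_enorm_rpow_lt_top (R := 1) hp
  have hD : Measurable fun u => ENNReal.ofReal (velocityWeight u) :=
    continuous_velocityWeight.measurable.ennreal_ofReal
  have hmb : MeasurableSet (Metric.ball (0 : Space) 1) := measurableSet_ball
  refine ⟨(∫⁻ u, ENNReal.ofReal (velocityWeight u)) + (2 * (∫⁻ u in Metric.ball (0 : Space) 1,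
    ‖u‖ₑ ^ (-p)) + ∫⁻ u, ENNReal.ofReal (velocityWeight u)), ?_, fun v => ?_⟩
  · exact ENNReal.add_lt_top.2 ⟨h1, ENNReal.add_lt_top.2
      ⟨ENNReal.mul_lt_top (by simp) h2, h1⟩⟩
  have hpt : ∀ u, ENNReal.ofReal (velocityWeight u) * ‖u - v‖ₑ ^ (-p) ≤
      2 * (Metric.ball (0 : Space) 1).indicator (fun u => ‖u‖ₑ ^ (-p)) (u - v) +
        ENNReal.ofReal (velocityWeight u) := by
    intro u
    by_cases h : u - v ∈ Metric.ball (0 : Space) 1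
    · rw [indicator_of_mem h]
      refine le_trans ?_ le_self_add
      gcongr
      exact ENNReal.ofReal_le_of_le_toReal (by simpa using velocityWeight_le_two u)
    · refine le_trans (mul_le_of_le_one_right zero_le ?_) le_add_self
      have h1 : 1 ≤ ‖u - v‖ₑ := by
        rw [← ofReal_norm, ← ENNReal.ofReal_one]
        refine ENNReal.ofReal_le_ofReal ?_
        simpa using h
      rcases hp0.eq_or_lt with rfl | hp
      · simp
      · rw [ENNReal.rpow_neg]
        exact ENNReal.inv_le_one.2 (ENNReal.one_le_rpow h1 hp)
  simp_rw [mul_add, mul_one]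
  rw [lintegral_add_left hD]
  gcongr
  refine (lintegral_mono hpt).trans_eq ?_
  rw [lintegral_add_right _ hD, lintegral_const_mul' _ _ (by simp),
    lintegral_sub_right_eq_self (fun u => (Metric.ball (0 : Space) 1).indicator (fun u => ‖u‖ₑ ^ (-p)) u),
    lintegral_indicator hmb]

theorem lintegral_angleMeasure_le {S : ℝ → ℝ≥0∞} (hS : Measurable S) {R : ℝ≥0∞}
    (h : ∫⁻ θ in Ioc (0 : ℝ) (Real.pi / 2), ENNReal.ofReal (Real.cos θ * Real.sin θ) * S θ ≤ R) :
    ∫⁻ a, ENNReal.ofReal (Real.cos a.2 * Real.sin a.2) * (1 + S a.2) ∂angleMeasure ≤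
      ENNReal.ofReal (2 * Real.pi) * (ENNReal.ofReal (Real.pi / 2) + R) := by
  have hcs : Measurable fun θ : ℝ => ENNReal.ofReal (Real.cos θ * Real.sin θ) := by fun_prop
  have hm : Measurable fun a : ℝ × ℝ => ENNReal.ofReal (Real.cos a.2 * Real.sin a.2) * (1 + S a.2) :=
    (hcs.comp measurable_snd).mul (measurable_const.add (hS.comp measurable_snd))
  rw [angleMeasure, lintegral_prod _ hm.aemeasurable]
  simp only [lintegral_const, Measure.restrict_apply_univ, Real.volume_Ioc, sub_zero, mul_add, mul_one]
  rw [mul_comm, lintegral_add_left hcs, ← mul_add]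
  gcongr
  calc ∫⁻ θ in Ioc (0 : ℝ) (Real.pi / 2), ENNReal.ofReal (Real.cos θ * Real.sin θ)
      ≤ ∫⁻ θ in Ioc (0 : ℝ) (Real.pi / 2), 1 := by
        refine setLIntegral_mono' measurableSet_Ioc fun θ hθ => ?_
        rw [← ENNReal.ofReal_one]
        exact ENNReal.ofReal_le_ofReal (cos_mul_sin_mem hθ).2
    _ = _ := by simp

theorem lintegral_paramMeasure_le {v v₀ : Space} {p : ℝ} {Y : Space × ℝ × ℝ → ℝ≥0∞}
    (hY : Measurable Y) {K J : ℝ≥0∞}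
    (h : ∀ vs, vs ≠ v → ∫⁻ a, Y (vs, a) ∂angleMeasure ≤ K * (1 + ‖vs - v₀‖ₑ ^ (-p)))
    (hJ : ∫⁻ u, ENNReal.ofReal (velocityWeight u) * (1 + ‖u - v₀‖ₑ ^ (-p)) ≤ J) :
    ∫⁻ q, ENNReal.ofReal (velocityWeight q.1) * Y q ∂paramMeasure ≤ K * J := by
  have hD : Measurable fun q : Space × ℝ × ℝ => ENNReal.ofReal (velocityWeight q.1) :=
    (continuous_velocityWeight.measurable.comp measurable_fst).ennreal_ofReal
  have hDY : Measurable fun q : Space × ℝ × ℝ => ENNReal.ofReal (velocityWeight q.1) * Y q :=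
    hD.mul hY
  rw [paramMeasure, lintegral_prod _ hDY.aemeasurable]
  calc _ ≤ ∫⁻ u, K * (ENNReal.ofReal (velocityWeight u) * (1 + ‖u - v₀‖ₑ ^ (-p))) := by
        refine lintegral_mono_ae ?_
        filter_upwards [compl_mem_ae_iff.2 (measure_singleton v)] with u hu
        rw [lintegral_const_mul' _ _ ENNReal.ofReal_ne_top, mul_left_comm]
        gcongr
        exact h u hu
    _ = K * ∫⁻ u, ENNReal.ofReal (velocityWeight u) * (1 + ‖u - v₀‖ₑ ^ (-p)) :=
        lintegral_const_mul _ (by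
          have := continuous_velocityWeight.measurable
          fun_prop)
    _ ≤ _ := by gcongr

/-! ### Moments of the collision kernel against singular Gaussian weights -/

section Cutoff

variable {B : ℝ → ℝ → ℝ} {γ : ℝ}

/-- For `b ≤ 1/2` the factor `M^(1/2)(w')` is at most `exp(-b|w'|²)`, and energy conservation turns
`exp(-b(|w|² + |w'|²))` into at most `exp(-b|v|²)`. The Gaussian rate is thus passed through the
collision without loss. -/
theorem kernel_mul_gaussian_le {C b : ℝ} (hb0 : 0 ≤ b) (hb : b ≤ 1 / 2)
    {v vs w w' : Space} (hsum : ‖w‖ ^ 2 + ‖w'‖ ^ 2 = ‖v‖ ^ 2 + ‖vs‖ ^ 2) {β e : ℝ} (hβ0 : 0 ≤ β)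
    (hβ : β ≤ C * ((1 + ‖v‖) * (1 + ‖vs‖)) * e) :
    rootMaxwellian w' * rootMaxwellian vs * β * Real.exp (-b * ‖w‖ ^ 2) ≤
      C * ((1 + ‖v‖) * Real.exp (-b * ‖v‖ ^ 2)) * (velocityWeight vs * e) := by
  have h1 : rootMaxwellian w' * Real.exp (-b * ‖w‖ ^ 2) ≤ Real.exp (-b * ‖v‖ ^ 2) := by
    calc _ ≤ Real.exp (-b * ‖w'‖ ^ 2) * Real.exp (-b * ‖w‖ ^ 2) := by
          gcongr; exact rootMaxwellian_le_gaussian hb w'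
      _ ≤ Real.exp (-b * ‖v‖ ^ 2) := by
          rw [← Real.exp_add, Real.exp_le_exp]
          have : -b * ‖w'‖ ^ 2 + -b * ‖w‖ ^ 2 = -b * ‖v‖ ^ 2 - b * ‖vs‖ ^ 2 := by
            linear_combination (-b) * hsum
          rw [this]
          have : 0 ≤ b * ‖vs‖ ^ 2 := by positivity
          linarith
  have h2 := (rootMaxwellian_pos vs).le
  calc _ = (rootMaxwellian w' * Real.exp (-b * ‖w‖ ^ 2)) * (rootMaxwellian vs * β) := by ring
    _ ≤ Real.exp (-b * ‖v‖ ^ 2) * (rootMaxwellian vs * (C * ((1 + ‖v‖) * (1 + ‖vs‖)) * e)) := by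
      gcongr
    _ = _ := by rw [velocityWeight]; ring

theorem enorm_kernel_mul_singularGaussian_le {C b p : ℝ} (hC0 : 0 ≤ C) (hb0 : 0 ≤ b) (hb : b ≤ 1 / 2)
    (hp : 0 ≤ p) {v vs w w' : Space} (hsum : ‖w‖ ^ 2 + ‖w'‖ ^ 2 = ‖v‖ ^ 2 + ‖vs‖ ^ 2) {β e : ℝ}
    (hβ0 : 0 ≤ β) (hβ : β ≤ C * ((1 + ‖v‖) * (1 + ‖vs‖)) * e) {z : ℝ≥0∞} (hz : z ≤ ‖w‖ₑ) :
    ‖rootMaxwellian w' * rootMaxwellian vs * β‖ₑ * singularGaussian p b w ≤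
      ENNReal.ofReal (C * ((1 + ‖v‖) * Real.exp (-b * ‖v‖ ^ 2))) *
        (ENNReal.ofReal (velocityWeight vs) * (ENNReal.ofReal e * (1 + z ^ (-p)))) := by
  have h1 := kernel_mul_gaussian_le hb0 hb hsum hβ0 hβ
  have h2 := (rootMaxwellian_pos vs).le
  have h3 := (rootMaxwellian_pos w').le
  rw [Real.enorm_of_nonneg (by positivity), singularGaussian]
  calc _ = ENNReal.ofReal (rootMaxwellian w' * rootMaxwellian vs * β * Real.exp (-b * ‖w‖ ^ 2)) *
        (1 + ‖w‖ₑ ^ (-p)) := by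
        rw [ENNReal.ofReal_mul (p := rootMaxwellian w' * rootMaxwellian vs * β) (by positivity)]
        ring
    _ ≤ ENNReal.ofReal (C * ((1 + ‖v‖) * Real.exp (-b * ‖v‖ ^ 2)) * (velocityWeight vs * e)) *
        (1 + z ^ (-p)) := by
        gcongr ?_ * (1 + ?_)
        · exact ENNReal.ofReal_le_ofReal h1
        · rw [ENNReal.rpow_neg, ENNReal.rpow_neg, ENNReal.inv_le_inv]
          exact ENNReal.rpow_le_rpow hz hp
    _ = _ := by
        rw [ENNReal.ofReal_mul (by positivity), ENNReal.ofReal_mul (velocityWeight_nonneg vs)]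
        ring

/-- The estimate that closes the iteration. The singularity `|w|^(-p)` is first integrated over `θ`,
which needs `p < 1` and leaves `|v_* - v|^(-p)`, and then over `v_*`. No singularity at `v = 0`
survives. -/
theorem exists_lintegral_collisionKernel_le (hB : AngularCutoff B γ) (hγ₀ : 0 ≤ γ) (hγ₁ : γ ≤ 1)
    {p b : ℝ} (hp0 : 0 ≤ p) (hp : p < 1) (hb0 : 0 ≤ b) (hb : b ≤ 1 / 2) :
    ∃ K : ℝ≥0∞, K < ∞ ∧ ∀ v : Space, ∫⁻ w, singularGaussian p b w ∂collisionKernel B v ≤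
      K * ENNReal.ofReal ((1 + ‖v‖) * Real.exp (-b * ‖v‖ ^ 2)) := by
  obtain ⟨C, hC0, hC⟩ := hB.exists_bound hγ₀ hγ₁
  obtain ⟨J, hJ, hJv⟩ := exists_lintegral_velocityWeight_le hp0 (by linarith : p < 3)
  set I := (∫⁻ t in Icc (-1 : ℝ) 1, ‖t‖ₑ ^ (-p)) + 1 with hI
  have hItop : I < ∞ := ENNReal.add_lt_top.2 ⟨lintegral_abs_rpow_lt_top hp, by simp⟩
  set A := ENNReal.ofReal (2 * Real.pi) * (ENNReal.ofReal (Real.pi / 2) + I) with hA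
  have hAtop : A < ∞ := ENNReal.mul_lt_top ENNReal.ofReal_lt_top
    (ENNReal.add_lt_top.2 ⟨ENNReal.ofReal_lt_top, hItop⟩)
  refine ⟨ENNReal.ofReal C * (A * J + A * J + A * J), ?_, fun v => ?_⟩
  · have := ENNReal.mul_lt_top hAtop hJ
    exact ENNReal.mul_lt_top ENNReal.ofReal_lt_top
      (ENNReal.add_lt_top.2 ⟨ENNReal.add_lt_top.2 ⟨this, this⟩, this⟩)
  have hBm := hB.measurable
  rw [lintegral_collisionKernel hBm v (measurable_singularGaussian p b), mul_right_comm,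
    ← ENNReal.ofReal_mul hC0, mul_add, mul_add]
  have hcs : Measurable fun q : Space × ℝ × ℝ => ENNReal.ofReal (Real.cos q.2.2 * Real.sin q.2.2) := by
    fun_prop
  -- The three kernels differ only in the lower bound `z` for the modulus of the velocity at which
  -- the weight is evaluated, and in the point `v₀` where a singularity in `v_*` remains after the
  -- angular integration.
  have hmain : ∀ (k : Space × ℝ × ℝ → ℝ) (W : Space × ℝ × ℝ → Space) (z : Space × ℝ × ℝ → ℝ≥0∞)
      (v₀ : Space), Measurable z →
      (∀ q : Space × ℝ × ℝ, q.1 ≠ v → q.2.2 ∈ Ioc 0 (Real.pi / 2) →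
        ‖k q‖ₑ * singularGaussian p b (W q) ≤
          ENNReal.ofReal (C * ((1 + ‖v‖) * Real.exp (-b * ‖v‖ ^ 2))) *
            (ENNReal.ofReal (velocityWeight q.1) *
              (ENNReal.ofReal (Real.cos q.2.2 * Real.sin q.2.2) * (1 + z q ^ (-p))))) →
      (∀ vs, vs ≠ v → ∫⁻ a, ENNReal.ofReal (Real.cos a.2 * Real.sin a.2) * (1 + z (vs, a) ^ (-p))
        ∂angleMeasure ≤ A * (1 + ‖vs - v₀‖ₑ ^ (-p))) →
      ∫⁻ q, ‖k q‖ₑ * singularGaussian p b (W q) ∂paramMeasure ≤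
        ENNReal.ofReal (C * ((1 + ‖v‖) * Real.exp (-b * ‖v‖ ^ 2))) * (A * J) := by
    intro k W z v₀ hz h1 h2
    calc _ ≤ ∫⁻ q, ENNReal.ofReal (C * ((1 + ‖v‖) * Real.exp (-b * ‖v‖ ^ 2))) *
            (ENNReal.ofReal (velocityWeight q.1) *
              (ENNReal.ofReal (Real.cos q.2.2 * Real.sin q.2.2) * (1 + z q ^ (-p)))) ∂paramMeasure := by
          refine lintegral_mono_ae ?_
          filter_upwards [ae_paramMeasure v] with q hq
          exact h1 q hq.1 hq.2
      _ ≤ _ := by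
          rw [lintegral_const_mul' _ _ ENNReal.ofReal_ne_top]
          gcongr
          exact lintegral_paramMeasure_le (hcs.mul (measurable_const.add (hz.pow_const _))) h2 (hJv v₀)
  have haux : ∀ c x y : ℝ≥0∞, c + x * y ≤ (c + y) * (1 + x) := fun c x y => by
    rw [add_mul, mul_add, mul_add, mul_one, mul_one, mul_comm x]
    exact add_le_add le_self_add le_add_self
  have hangle : ∀ (vs : Space) (S : ℝ → ℝ≥0∞), Measurable S →
      ∫⁻ θ in Ioc (0 : ℝ) (Real.pi / 2), ENNReal.ofReal (Real.cos θ * Real.sin θ) * S θ ≤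
        ‖vs‖ₑ ^ (-p) * I →
      ∫⁻ a, ENNReal.ofReal (Real.cos a.2 * Real.sin a.2) * (1 + S a.2) ∂angleMeasure ≤
        A * (1 + ‖vs‖ₑ ^ (-p)) := by
    intro vs S hS h
    refine (lintegral_angleMeasure_le hS h).trans ?_
    rw [hA, mul_assoc]
    gcongr
    exact haux _ _ _
  have hsc : ∀ θ ∈ Ioc 0 (Real.pi / 2), 0 ≤ Real.cos θ ∧ 0 ≤ Real.sin θ := fun θ hθ =>
    ⟨Real.cos_nonneg_of_mem_Icc ⟨by linarith [hθ.1, Real.pi_pos], hθ.2⟩,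
      Real.sin_nonneg_of_nonneg_of_le_pi hθ.1.le (by linarith [hθ.2, Real.pi_pos])⟩
  gcongr ?_ + ?_ + ?_
  · refine hmain _ _ (fun q => ‖‖q.1 - v‖ * Real.sin q.2.2 - ‖v‖‖ₑ) v (by fun_prop) ?_ ?_
    · intro q hq hθ
      obtain ⟨hβ0, hβ⟩ := hC v q.1 hq _ hθ
      have hsum := norm_sq_postVelocity_add hq q.2.2 q.2.1
      rw [add_comm] at hsum
      exact enorm_kernel_mul_singularGaussian_le hC0 hb0 hb hp0 hsum hβ0 hβ
        (abs_sub_le_norm_postVelocityStar hq (hsc _ hθ).2 _)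
    · intro vs hvs
      refine hangle (vs - v) (fun θ => ‖‖vs - v‖ * Real.sin θ - ‖v‖‖ₑ ^ (-p)) (by fun_prop) ?_
      have := lintegral_sin_angle_le hp0 (norm_pos_iff.2 (sub_ne_zero.2 hvs)) ‖v‖
      rwa [enorm_norm] at this
  · refine hmain _ _ (fun q => ‖‖q.1 - v‖ * Real.cos q.2.2 - ‖v‖‖ₑ) v (by fun_prop) ?_ ?_
    · intro q hq hθ
      obtain ⟨hβ0, hβ⟩ := hC v q.1 hq _ hθ
      have hsum := norm_sq_postVelocity_add hq q.2.2 q.2.1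
      exact enorm_kernel_mul_singularGaussian_le hC0 hb0 hb hp0 hsum hβ0 hβ
        (abs_sub_le_norm_postVelocity hq (hsc _ hθ).1 _)
    · intro vs hvs
      refine hangle (vs - v) (fun θ => ‖‖vs - v‖ * Real.cos θ - ‖v‖‖ₑ ^ (-p)) (by fun_prop) ?_
      have := lintegral_cos_angle_le hp0 (norm_pos_iff.2 (sub_ne_zero.2 hvs)) ‖v‖
      rwa [enorm_norm] at this
  -- In the loss term the weight is evaluated at `v_*` itself: the angles play no role and the
  -- singularity sits at `v_* = 0`.
  · refine hmain _ _ (fun q => ‖q.1‖ₑ) 0 (by fun_prop) ?_ ?_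
    · intro q hq hθ
      obtain ⟨hβ0, hβ⟩ := hC v q.1 hq _ hθ
      exact enorm_kernel_mul_singularGaussian_le hC0 hb0 hb hp0 (add_comm _ _) hβ0 hβ le_rfl
    · intro vs _
      simp only
      rw [sub_zero, lintegral_mul_const _ (by fun_prop)]
      gcongr
      have := lintegral_angleMeasure_le (S := fun _ => 0) measurable_const (R := I) (by simp)
      simpa [hA] using this

theorem isFiniteMeasure_collisionKernel (hB : AngularCutoff B γ) (hγ₀ : 0 ≤ γ) (hγ₁ : γ ≤ 1) (v : Space) :
    IsFiniteMeasure (collisionKernel B v) := by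
  obtain ⟨K, hK, h⟩ := exists_lintegral_collisionKernel_le hB hγ₀ hγ₁ (p := 0) (b := 0) le_rfl
    one_pos le_rfl (by norm_num)
  refine ⟨lt_of_le_of_lt (b := K * ENNReal.ofReal ((1 + ‖v‖) * Real.exp (-0 * ‖v‖ ^ 2))) ?_
    (ENNReal.mul_lt_top hK ENNReal.ofReal_lt_top)⟩
  refine le_trans ?_ (h v)
  calc collisionKernel B v univ = ∫⁻ w, 1 ∂collisionKernel B v := by simp
    _ ≤ _ := by
      refine lintegral_mono fun w => ?_
      simp [singularGaussian]

/-- For `p = 1/2` the singular weight is infinite at 0 but has a finite integral, so 0 is not an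
atom. Hence `K` ignores the uncontrolled values at `v = 0`. -/
theorem collisionKernel_singleton_zero (hB : AngularCutoff B γ) (hγ₀ : 0 ≤ γ) (hγ₁ : γ ≤ 1)
    (v : Space) : collisionKernel B v {0} = 0 := by
  obtain ⟨K, hK, h⟩ := exists_lintegral_collisionKernel_le hB hγ₀ hγ₁ (p := 1 / 2) (b := 0) (by norm_num)
    (by norm_num) le_rfl (by norm_num)
  have hfin := (h v).trans_lt (ENNReal.mul_lt_top hK ENNReal.ofReal_lt_top)
  have := ae_lt_top (measurable_singularGaussian (1 / 2) 0) hfin.ne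
  rw [ae_iff] at this
  refine measure_mono_null (fun w hw => ?_) this
  rw [mem_singleton_iff] at hw
  simp [hw, singularGaussian]

end Cutoff

/-! ### The collision frequency and the damped transit time -/

section Frequency

variable {B : ℝ → ℝ → ℝ} {γ : ℝ}

theorem maxwellian_le_rootMaxwellian (v : Space) : maxwellian v ≤ rootMaxwellian v := by
  rw [← rootMaxwellian_mul_self]
  exact mul_le_of_le_one_right (rootMaxwellian_pos v).le (rootMaxwellian_le_one v)

theorem measurable_frequencyIntegrand (hB : Measurable (Function.uncurry B)) :
    Measurable fun z : Space × Space × ℝ × ℝ => maxwellian z.2.1 * B ‖z.1 - z.2.1‖ z.2.2.2 :=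
  (continuous_maxwellian.measurable.comp (measurable_fst.comp measurable_snd)).mul
    (measurable_crossSection hB measurable_fst (measurable_fst.comp measurable_snd)
      (measurable_snd.comp (measurable_snd.comp measurable_snd)))

theorem integrable_frequencyIntegrand (hB : AngularCutoff B γ) (hγ₀ : 0 ≤ γ) (hγ₁ : γ ≤ 1) (v : Space) :
    Integrable (fun p : Space × ℝ × ℝ => maxwellian p.1 * B ‖v - p.1‖ p.2.2) paramMeasure := by
  refine integrable_paramMeasure_of_bound hB hγ₀ hγ₁ v (c := 1)
    (Measurable.of_uncurry_left (x := v)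
      (f := fun v (p : Space × ℝ × ℝ) => maxwellian p.1 * B ‖v - p.1‖ p.2.2)
      (measurable_frequencyIntegrand hB.measurable)) fun p _ => ?_
  rw [abs_mul, abs_of_pos (maxwellian_pos _), one_mul]
  gcongr
  exact maxwellian_le_rootMaxwellian _

theorem collisionFrequency_eq (hB : AngularCutoff B γ) (hγ₀ : 0 ≤ γ) (hγ₁ : γ ≤ 1) (v : Space) :
    collisionFrequency B v = ∫ p, maxwellian p.1 * B ‖v - p.1‖ p.2.2 ∂paramMeasure :=
  intervalIntegral_eq_integral_paramMeasure (H := fun vs _ θ => maxwellian vs * B ‖v - vs‖ θ)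
    (integrable_frequencyIntegrand hB hγ₀ hγ₁ v)

theorem measurable_collisionFrequency (hB : AngularCutoff B γ) (hγ₀ : 0 ≤ γ) (hγ₁ : γ ≤ 1) :
    Measurable (collisionFrequency B) := by
  have h : collisionFrequency B =
      fun v => ∫ p, maxwellian p.1 * B ‖v - p.1‖ p.2.2 ∂paramMeasure :=
    funext (collisionFrequency_eq hB hγ₀ hγ₁)
  rw [h]
  exact (StronglyMeasurable.integral_prod_right'
    (measurable_frequencyIntegrand hB.measurable).stronglyMeasurable).measurable

theorem collisionFrequency_nonneg (hB : AngularCutoff B γ) (hγ₀ : 0 ≤ γ) (hγ₁ : γ ≤ 1) (v : Space) :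
    0 ≤ collisionFrequency B v := by
  obtain ⟨C, -, hC⟩ := hB.exists_bound hγ₀ hγ₁
  rw [collisionFrequency_eq hB hγ₀ hγ₁]
  refine integral_nonneg_of_ae ?_
  filter_upwards [ae_paramMeasure v] with p hp
  exact mul_nonneg (maxwellian_pos _).le (hC v p.1 hp.1 _ hp.2).1

theorem exists_collisionFrequency_le (hB : AngularCutoff B γ) (hγ₀ : 0 ≤ γ) (hγ₁ : γ ≤ 1) :
    ∃ N : ℝ, 0 ≤ N ∧ ∀ v, collisionFrequency B v ≤ N * (1 + ‖v‖) := by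
  obtain ⟨C, hC0, hC⟩ := hB.exists_bound hγ₀ hγ₁
  have hint : Integrable (fun p : Space × ℝ × ℝ => velocityWeight p.1) paramMeasure :=
    integrable_velocityWeight.comp_fst _
  refine ⟨C * ∫ p : Space × ℝ × ℝ, velocityWeight p.1 ∂paramMeasure,
    mul_nonneg hC0 (integral_nonneg fun p => velocityWeight_nonneg _), fun v => ?_⟩
  rw [collisionFrequency_eq hB hγ₀ hγ₁, mul_right_comm, ← integral_const_mul]
  refine integral_mono_ae (integrable_frequencyIntegrand hB hγ₀ hγ₁ v) (hint.const_mul _) ?_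
  filter_upwards [ae_paramMeasure v] with p hp
  obtain ⟨h0, h1⟩ := hC v p.1 hp.1 _ hp.2
  calc maxwellian p.1 * B ‖v - p.1‖ p.2.2
      ≤ rootMaxwellian p.1 * (C * ((1 + ‖v‖) * (1 + ‖p.1‖)) * 1) := by
        have := (cos_mul_sin_mem hp.2).2
        refine mul_le_mul (maxwellian_le_rootMaxwellian _) (h1.trans ?_) h0 (rootMaxwellian_pos _).le
        gcongr
    _ = C * (1 + ‖v‖) * velocityWeight p.1 := by rw [velocityWeight]; ring

theorem measurePreserving_sub_paramMeasure (v : Space) :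
    MeasurePreserving (fun p : Space × ℝ × ℝ => (v - p.1, p.2)) paramMeasure paramMeasure :=
  (Measure.measurePreserving_sub_left volume v).prod (MeasurePreserving.id angleMeasure)

/-- For `|v| ≤ 1` one has `|v_*|² ≤ 2 + 2|v - v_*|²`, so `ν(v)` is at least a constant times the
integral of `exp(-2|u|²) B(|u|,θ)`, which does not depend on `v`. If that integral vanishes, so does
`B` almost everywhere. -/
theorem exists_le_collisionFrequency_or (hB : AngularCutoff B γ) (hγ₀ : 0 ≤ γ) (hγ₁ : γ ≤ 1) :
    (∃ ν₀ : ℝ, 0 < ν₀ ∧ ∀ v, ‖v‖ ≤ 1 → ν₀ ≤ collisionFrequency B v) ∨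
      ∀ v : Space, ∀ᵐ p ∂paramMeasure, B ‖v - p.1‖ p.2.2 = 0 := by
  obtain ⟨C, -, hC⟩ := hB.exists_bound hγ₀ hγ₁
  set G : Space × ℝ × ℝ → ℝ := fun p => Real.exp (-2 * ‖p.1‖ ^ 2) * B ‖p.1‖ p.2.2 with hG
  have hBm : Measurable fun p : Space × ℝ × ℝ => B ‖p.1‖ p.2.2 :=
    hB.measurable.comp (measurable_fst.norm.prodMk (measurable_snd.comp measurable_snd))
  have hGm : Measurable G := by
    have : Measurable fun p : Space × ℝ × ℝ => Real.exp (-2 * ‖p.1‖ ^ 2) := by fun_prop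
    exact this.mul hBm
  rcases eq_or_ne (∫⁻ p, ENNReal.ofReal (G p) ∂paramMeasure) 0 with h0 | h0
  · right
    intro v
    rw [lintegral_eq_zero_iff hGm.ennreal_ofReal] at h0
    have h1 : ∀ᵐ p ∂paramMeasure, B ‖p.1‖ p.2.2 = 0 := by
      filter_upwards [h0, ae_paramMeasure 0] with p hp hq
      have hb := (hC 0 p.1 hq.1 _ hq.2).1
      rw [zero_sub, norm_neg] at hb
      have h2 : G p ≤ 0 := by simpa using hp
      have h3 : 0 < Real.exp (-2 * ‖p.1‖ ^ 2) := Real.exp_pos _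
      exact le_antisymm (nonpos_of_mul_nonpos_right h2 h3) hb
    exact (measurePreserving_sub_paramMeasure v).quasiMeasurePreserving.ae h1
  · left
    have hfin : ∫⁻ p, ENNReal.ofReal (G p) ∂paramMeasure ≠ ∞ := by
      refine (lt_of_le_of_lt (lintegral_mono_ae ?_)
        ((integrable_frequencyIntegrand hB hγ₀ hγ₁ 0).const_mul
          (Real.pi ^ (3 / 2 : ℝ))).lintegral_lt_top).ne
      filter_upwards [ae_paramMeasure 0] with p hp
      have hb := (hC 0 p.1 hp.1 _ hp.2).1
      rw [zero_sub, norm_neg] at hb ⊢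
      refine ENNReal.ofReal_le_ofReal ?_
      rw [hG, maxwellian, ← mul_assoc, ← mul_assoc, ← Real.rpow_add Real.pi_pos]
      norm_num
      gcongr
      nlinarith [sq_nonneg ‖p.1‖]
    set I := (∫⁻ p, ENNReal.ofReal (G p) ∂paramMeasure).toReal with hI
    have hIpos : 0 < I := ENNReal.toReal_pos h0 hfin
    set c : ℝ := Real.pi ^ (-(3 / 2) : ℝ) * Real.exp (-2) with hc
    have hc0 : 0 < c := by positivity
    refine ⟨c * I, by positivity, fun v hv => ?_⟩
    have h1 : ENNReal.ofReal (c * I) ≤ ENNReal.ofReal (collisionFrequency B v) := by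
      rw [collisionFrequency_eq hB hγ₀ hγ₁,
        ofReal_integral_eq_lintegral_ofReal (integrable_frequencyIntegrand hB hγ₀ hγ₁ v),
        ENNReal.ofReal_mul hc0.le, hI, ENNReal.ofReal_toReal hfin,
        ← (measurePreserving_sub_paramMeasure v).lintegral_comp hGm.ennreal_ofReal,
        ← lintegral_const_mul' _ _ ENNReal.ofReal_ne_top]
      · refine lintegral_mono_ae ?_
        filter_upwards [ae_paramMeasure v] with p hp
        have hb := (hC v p.1 hp.1 _ hp.2).1
        rw [← ENNReal.ofReal_mul hc0.le]
        refine ENNReal.ofReal_le_ofReal ?_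
        rw [hG, hc, maxwellian, ← mul_assoc]
        refine mul_le_mul_of_nonneg_right ?_ hb
        rw [mul_assoc, ← Real.exp_add]
        gcongr
        have h2 : ‖p.1‖ ≤ ‖v‖ + ‖v - p.1‖ := by
          have := norm_sub_le v (v - p.1); rwa [sub_sub_cancel] at this
        have h3 := norm_nonneg p.1
        have h4 := norm_nonneg v
        nlinarith [sq_nonneg (‖v‖ - ‖v - p.1‖)]
      · filter_upwards [ae_paramMeasure v] with p hp
        exact mul_nonneg (maxwellian_pos _).le (hC v p.1 hp.1 _ hp.2).1
    exact (ENNReal.ofReal_le_ofReal_iff (collisionFrequency_nonneg hB hγ₀ hγ₁ v)).1 h1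

theorem collisionIntegral_eq_zero (hB : AngularCutoff B γ) (hγ₀ : 0 ≤ γ) (hγ₁ : γ ≤ 1)
    {v : Space} (h0 : ∀ᵐ p ∂paramMeasure, B ‖v - p.1‖ p.2.2 = 0)
    {f : Space → ℝ} (hf : Measurable f) {C : ℝ} (hC : ∀ w, |f w| ≤ C) :
    collisionIntegral B f v = 0 := by
  rw [collisionIntegral_eq hB hγ₀ hγ₁ hf hC]
  refine integral_eq_zero_of_ae ?_
  filter_upwards [h0] with p hp
  simp [collisionIntegrand, gainStarKernel, gainKernel, lossKernel, hp]

theorem lintegral_exp_neg_mul_Ioc_le {ν L : ℝ} (hν : 0 < ν) :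
    ∫⁻ s in Ioc 0 L, ENNReal.ofReal (Real.exp (-ν * s)) ≤ ENNReal.ofReal (1 / ν) := by
  have hint := exp_neg_integrableOn_Ioi 0 hν
  calc _ ≤ ∫⁻ s in Ioi 0, ENNReal.ofReal (Real.exp (-ν * s)) := lintegral_mono_set Ioc_subset_Ioi_self
    _ = ENNReal.ofReal (∫ s in Ioi 0, Real.exp (-ν * s)) := by
      rw [ofReal_integral_eq_lintegral_ofReal hint (ae_of_all _ fun s => (Real.exp_pos _).le)]
    _ = _ := by rw [integral_exp_mul_Ioi (neg_lt_zero.2 hν)]; simp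

/-- `∫₀^{d/|v|} exp(-ν(v) s) ds` for `d` a bound on the diameter. -/
def transitTime (B : ℝ → ℝ → ℝ) (d : ℝ) (v : Space) : ℝ≥0∞ :=
  ∫⁻ s in Ioc 0 (d / ‖v‖), ENNReal.ofReal (Real.exp (-collisionFrequency B v * s))

/-- Slow particles are limited by the damping, `∫exp(-νs) ds ≤ 1/ν₀`, and fast ones by the crossing
time `d/|v|`. The resulting decay compensates the factor `1+|v|` produced by `K`. -/
theorem exists_transitTime_le (hB : AngularCutoff B γ) (hγ₀ : 0 ≤ γ) (hγ₁ : γ ≤ 1)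
    (h : ∃ ν₀ : ℝ, 0 < ν₀ ∧ ∀ v, ‖v‖ ≤ 1 → ν₀ ≤ collisionFrequency B v) {d : ℝ} (hd : 0 ≤ d) :
    ∃ T : ℝ, 0 ≤ T ∧ ∀ v : Space, transitTime B d v ≤ ENNReal.ofReal (T / (1 + ‖v‖)) := by
  obtain ⟨ν₀, hν₀, hν⟩ := h
  refine ⟨2 * d + 2 / ν₀, by positivity, fun v => ?_⟩
  rcases le_total ‖v‖ 1 with hv | hv
  · refine (lintegral_exp_neg_mul_Ioc_le (hν₀.trans_le (hν v hv))).trans (ENNReal.ofReal_le_ofReal ?_)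
    calc 1 / collisionFrequency B v ≤ 1 / ν₀ := one_div_le_one_div_of_le hν₀ (hν v hv)
      _ = (2 / ν₀) / 2 := by ring
      _ ≤ (2 * d + 2 / ν₀) / (1 + ‖v‖) := by
        gcongr
        · linarith
        · linarith
  · calc transitTime B d v ≤ ∫⁻ s in Ioc 0 (d / ‖v‖), 1 := by
          refine setLIntegral_mono' measurableSet_Ioc fun s hs => ?_
          rw [← ENNReal.ofReal_one]
          refine ENNReal.ofReal_le_ofReal (Real.exp_le_one_iff.2 ?_)
          have := mul_nonneg (collisionFrequency_nonneg hB hγ₀ hγ₁ v) hs.1.le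
          linarith
      _ = ENNReal.ofReal (d / ‖v‖) := by simp
      _ ≤ _ := by
        refine ENNReal.ofReal_le_ofReal ?_
        rw [div_le_div_iff₀ (by linarith) (by linarith)]
        have : 0 < 2 / ν₀ := by positivity
        nlinarith

end Frequency

/-- The measure `|x - y|^(-3-2s) dx dy` on `Ω × Ω`, whose `L²` norm of `f(x) - f(y)` is the
Slobodeckij seminorm of `f`. -/
def slobodeckijMeasure (Ω : Set Space) (s : ℝ) : Measure (Space × Space) :=
  (volume.restrict (Ω ×ˢ Ω)).withDensity fun z => ENNReal.ofReal (1 / ‖z.2 - z.1‖ ^ (3 + 2 * s))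

instance (Ω : Set Space) (s : ℝ) : SFinite (slobodeckijMeasure Ω s) := by
  unfold slobodeckijMeasure; infer_instance

theorem measurable_slobodeckijDensity (s : ℝ) :
    Measurable fun z : Space × Space => ENNReal.ofReal (1 / ‖z.2 - z.1‖ ^ (3 + 2 * s)) := by
  fun_prop

/-! ### Slobodeckij integrals and the chord modulus -/

section Slobodeckij

variable {Ω : Set Space} {s : ℝ}

theorem lintegral_slobodeckijMeasure {g : Space × Space → ℝ≥0∞} (hg : Measurable g) :
    ∫⁻ z, g z ∂slobodeckijMeasure Ω s =
      ∫⁻ z in Ω ×ˢ Ω, ENNReal.ofReal (1 / ‖z.2 - z.1‖ ^ (3 + 2 * s)) * g z :=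
  lintegral_withDensity_eq_lintegral_mul _ (measurable_slobodeckijDensity s) hg

theorem lintegral_slobodeckijMeasure_le (g : Space × Space → ℝ≥0∞) :
    ∫⁻ z, g z ∂slobodeckijMeasure Ω s ≤
      ∫⁻ y in Ω, ∫⁻ x in Ω, ENNReal.ofReal (1 / ‖x - y‖ ^ (3 + 2 * s)) * g (y, x) := by
  refine (lintegral_withDensity_le_lintegral_mul _ (measurable_slobodeckijDensity s) g).trans ?_
  rw [Measure.volume_eq_prod, ← Measure.prod_restrict]
  exact lintegral_prod_le _

theorem ae_slobodeckijMeasure (ho : IsOpen Ω) :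
    ∀ᵐ z ∂slobodeckijMeasure Ω s, z.1 ∈ Ω ∧ z.2 ∈ Ω :=
  (withDensity_absolutelyContinuous _ _).ae_le
    (ae_restrict_mem (ho.measurableSet.prod ho.measurableSet))

theorem lintegral_sq_sub_slobodeckijMeasure {f : Space → ℝ} (hf : Measurable f) :
    ∫⁻ z, ‖f z.2 - f z.1‖ₑ ^ 2 ∂slobodeckijMeasure Ω s =
      ∫⁻ y in Ω, ∫⁻ x in Ω, ENNReal.ofReal (|f x - f y| ^ 2 / ‖x - y‖ ^ (3 + 2 * s)) := by
  have hm : Measurable fun z : Space × Space => ‖f z.2 - f z.1‖ₑ ^ 2 := by fun_prop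
  have hm' : Measurable fun z : Space × Space =>
      ENNReal.ofReal (1 / ‖z.2 - z.1‖ ^ (3 + 2 * s)) * ‖f z.2 - f z.1‖ₑ ^ 2 :=
    (measurable_slobodeckijDensity s).mul hm
  rw [lintegral_slobodeckijMeasure hm, Measure.volume_eq_prod, ← Measure.prod_restrict,
    lintegral_prod _ hm'.aemeasurable]
  refine lintegral_congr fun y => lintegral_congr fun x => ?_
  simp only
  rw [← ofReal_norm, Real.norm_eq_abs, ← ENNReal.ofReal_pow (abs_nonneg _),
    ← ENNReal.ofReal_mul (by positivity), one_div_mul_eq_div]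

/-- The density depends only on `x - y`, so a common translation preserves it; the indicator keeps
just the pairs that are still in Ω after the shift. -/
theorem lintegral_slobodeckijMeasure_shift_le (ho : IsOpen Ω) (u : Space)
    {g : Space × Space → ℝ≥0∞} (hg : Measurable g) :
    ∫⁻ z, (Ω ×ˢ Ω).indicator g (z.1 - u, z.2 - u) ∂slobodeckijMeasure Ω s ≤
      ∫⁻ z, g z ∂slobodeckijMeasure Ω s := by
  have hΩ : MeasurableSet (Ω ×ˢ Ω) := ho.measurableSet.prod ho.measurableSet
  have hi : Measurable fun z : Space × Space => (Ω ×ˢ Ω).indicator g (z.1 - u, z.2 - u) :=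
    (hg.indicator hΩ).comp (by fun_prop)
  rw [lintegral_slobodeckijMeasure hi, lintegral_slobodeckijMeasure hg]
  refine (setLIntegral_le_lintegral _ _).trans ?_
  have h1 := lintegral_sub_right_eq_self (μ := (volume : Measure Space).prod (volume : Measure Space))
    (fun z => ENNReal.ofReal (1 / ‖z.2 - z.1‖ ^ (3 + 2 * s)) * (Ω ×ˢ Ω).indicator g z) (u, u)
  simp only [Prod.fst_sub, Prod.snd_sub, sub_sub_sub_cancel_right] at h1
  refine (h1.trans ?_).le
  rw [← lintegral_indicator hΩ]
  refine lintegral_congr fun z => ?_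
  by_cases hz : z ∈ Ω ×ˢ Ω <;> simp [hz]

/-- The bound `((1 + |v|)/|v| · (|v| |τ(x,v) - τ(y,v)| + |x - y|))^p` of the oscillation in space. -/
def chordModulus (Ω : Set Space) (p : ℝ) (v : Space) (z : Space × Space) : ℝ :=
  ((1 + ‖v‖) / ‖v‖ * (|exitTime Ω z.2 v - exitTime Ω z.1 v| * ‖v‖ + ‖z.2 - z.1‖)) ^ p

theorem chordModulus_nonneg (p : ℝ) (v : Space) (z : Space × Space) : 0 ≤ chordModulus Ω p v z := by
  unfold chordModulus; positivity

theorem ofReal_one_add_div_rpow_le {p : ℝ} (hp0 : 0 ≤ p) (hp : p ≤ 1) {v : Space} (hv : v ≠ 0) :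
    ENNReal.ofReal (((1 + ‖v‖) / ‖v‖) ^ p) ≤ 1 + ‖v‖ₑ ^ (-p) := by
  have hv0 : 0 < ‖v‖ := norm_pos_iff.2 hv
  rw [← ofReal_norm v, ENNReal.ofReal_rpow_of_pos hv0, ← ENNReal.ofReal_one,
    ← ENNReal.ofReal_add zero_le_one (by positivity)]
  refine ENNReal.ofReal_le_ofReal ?_
  calc ((1 + ‖v‖) / ‖v‖) ^ p = (1 + ‖v‖⁻¹) ^ p := by congr 1; field_simp; ring
    _ ≤ 1 ^ p + ‖v‖⁻¹ ^ p := Real.rpow_add_le_add_rpow zero_le_one (by positivity) hp0 hp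
    _ = 1 + ‖v‖ ^ (-p) := by rw [Real.one_rpow, Real.rpow_neg hv0.le, Real.inv_rpow hv0.le]

/-- By homogeneity `τ(x,v)|v|` is the exit time in the direction `v/|v|`. The modulus is therefore
the unit-speed quantity times `((1+|v|)/|v|)^p`, which is at most `1 + |v|^(-p)`. -/
theorem exists_lintegral_chordModulus_le (hΩ : IsPositivelyCurvedDomain Ω) {p : ℝ}
    (hs : 0 < s) (hsp : s < p) (hp : p < 1) :
    ∃ G : ℝ≥0∞, G < ∞ ∧ ∀ v : Space, v ≠ 0 →
      ∫⁻ z, ENNReal.ofReal (chordModulus Ω p v z) ^ 2 ∂slobodeckijMeasure Ω s ≤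
        G * (1 + ‖v‖ₑ ^ (-p)) ^ 2 := by
  obtain ⟨G, hG, h⟩ := exists_slobodeckij_exitTime_le hΩ hs hsp hp
  refine ⟨G, hG, fun v hv => ?_⟩
  have hv0 : 0 < ‖v‖ := norm_pos_iff.2 hv
  have hω : ‖‖v‖⁻¹ • v‖ = 1 := by
    rw [norm_smul, norm_inv, norm_norm, inv_mul_cancel₀ hv0.ne']
  have hτ : ∀ x ∈ Ω, exitTime Ω x v * ‖v‖ = exitTime Ω x (‖v‖⁻¹ • v) := by
    intro x hx
    rw [exitTime_smul hΩ.isOpen hΩ.convex hΩ.isBounded hx hv (inv_pos.2 hv0), div_inv_eq_mul]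
  set κ := ((1 + ‖v‖) / ‖v‖) ^ p with hκ
  have hκ0 : 0 ≤ κ := by positivity
  have hmod : ∀ y ∈ Ω, ∀ x ∈ Ω, ENNReal.ofReal (1 / ‖x - y‖ ^ (3 + 2 * s)) *
      ENNReal.ofReal (chordModulus Ω p v (y, x)) ^ 2 =
      ENNReal.ofReal κ ^ 2 * ENNReal.ofReal ((|exitTime Ω x (‖v‖⁻¹ • v) -
        exitTime Ω y (‖v‖⁻¹ • v)| + ‖x - y‖) ^ (2 * p) / ‖x - y‖ ^ (3 + 2 * s)) := by
    intro y hy x hx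
    rw [← ENNReal.ofReal_pow (chordModulus_nonneg _ _ _), ← ENNReal.ofReal_pow hκ0,
      ← ENNReal.ofReal_mul (by positivity), ← ENNReal.ofReal_mul (by positivity), chordModulus,
      Real.mul_rpow (by positivity) (by positivity), mul_pow, ← hκ]
    simp only
    rw [← abs_of_pos hv0, ← abs_mul, abs_of_pos hv0, sub_mul, hτ x hx, hτ y hy, mul_comm 2 p,
      Real.rpow_mul (by positivity)]
    congr 1
    norm_cast
    ring
  have hm := hΩ.isOpen.measurableSet
  calc _ ≤ ∫⁻ y in Ω, ∫⁻ x in Ω, ENNReal.ofReal (1 / ‖x - y‖ ^ (3 + 2 * s)) *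
        ENNReal.ofReal (chordModulus Ω p v (y, x)) ^ 2 := lintegral_slobodeckijMeasure_le _
    _ = ENNReal.ofReal κ ^ 2 * ∫⁻ y in Ω, ∫⁻ x in Ω, ENNReal.ofReal ((|exitTime Ω x (‖v‖⁻¹ • v) -
        exitTime Ω y (‖v‖⁻¹ • v)| + ‖x - y‖) ^ (2 * p) / ‖x - y‖ ^ (3 + 2 * s)) := by
      rw [← lintegral_const_mul' _ _ (by simp)]
      refine setLIntegral_congr_fun hm fun y hy => ?_
      rw [← lintegral_const_mul' _ _ (by simp)]
      exact setLIntegral_congr_fun hm fun x hx => hmod y hy x hx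
    _ ≤ (1 + ‖v‖ₑ ^ (-p)) ^ 2 * G := by
      gcongr
      · exact ofReal_one_add_div_rpow_le (hs.trans hsp).le hp.le hv
      · exact h _ hω
    _ = _ := mul_comm _ _

end Slobodeckij

/-! ### Function classes -/

/-- `f` on `Ω × (ℝ³ ∖ 0)`, extended by zero. -/
def phaseRestrict (Ω : Set Space) (f : Space → Space → ℝ) : Space × Space → ℝ :=
  (Ω ×ˢ ({0}ᶜ : Set Space)).indicator (Function.uncurry f)

section Classes

variable {Ω : Set Space} {f : Space → Space → ℝ} {x v : Space}

theorem phaseRestrict_of_mem (hx : x ∈ Ω) (hv : v ≠ 0) : phaseRestrict Ω f (x, v) = f x v :=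
  indicator_of_mem (s := Ω ×ˢ ({0}ᶜ : Set Space)) (mk_mem_prod hx hv) _

theorem phaseRestrict_of_notMem (hx : x ∉ Ω) : phaseRestrict Ω f (x, v) = 0 :=
  indicator_of_notMem (fun h => hx h.1) _

theorem phaseRestrict_zero : phaseRestrict Ω f (x, 0) = 0 :=
  indicator_of_notMem (fun h => h.2 rfl) _

theorem measurable_phaseRestrict_of_eq (ho : IsOpen Ω) {F : Space × Space → ℝ} (hF : Measurable F)
    (h : ∀ x ∈ Ω, ∀ v ≠ 0, f x v = F (x, v)) : Measurable (phaseRestrict Ω f) := by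
  have : phaseRestrict Ω f = (Ω ×ˢ ({0}ᶜ : Set Space)).indicator F :=
    indicator_congr fun z hz => h z.1 hz.1 z.2 hz.2
  rw [this]
  exact hF.indicator (ho.measurableSet.prod (measurableSet_singleton 0).compl)

/-- Measurable functions on `Ω × (ℝ³ ∖ 0)` bounded by a multiple of `w(v)`. -/
structure IsWeightBounded (Ω : Set Space) (w : Space → ℝ) (f : Space → Space → ℝ) : Prop where
  measurable : Measurable (phaseRestrict Ω f)
  bound : ∃ C : ℝ, 0 ≤ C ∧ ∀ x ∈ Ω, ∀ v ≠ 0, |f x v| ≤ C * w v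

/-- Functions whose squared Slobodeckij seminorm in `x` is at most a multiple of `w(v)²`. -/
def HasSlobodeckijBound (Ω : Set Space) (s : ℝ) (w : Space → ℝ≥0∞) (f : Space → Space → ℝ) : Prop :=
  ∃ c : ℝ≥0∞, c < ∞ ∧ ∀ v ≠ 0, ∫⁻ z, ‖f z.2 v - f z.1 v‖ₑ ^ 2 ∂slobodeckijMeasure Ω s ≤ c * w v ^ 2

theorem HasSlobodeckijBound.phaseRestrict_le {s : ℝ} {w : Space → ℝ≥0∞} (ho : IsOpen Ω)
    (h : HasSlobodeckijBound Ω s w f) :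
    ∃ c : ℝ≥0∞, c < ∞ ∧ c ≠ 0 ∧ ∀ v ≠ 0, ∫⁻ z, ‖phaseRestrict Ω f (z.2, v) -
      phaseRestrict Ω f (z.1, v)‖ₑ ^ 2 ∂slobodeckijMeasure Ω s ≤ (c * w v) ^ 2 := by
  obtain ⟨c, hc, h⟩ := h
  -- `c + 1` is nonzero, as Minkowski's inequality requires of its majorant, and its square
  -- dominates `c`.
  refine ⟨c + 1, ENNReal.add_lt_top.2 ⟨hc, ENNReal.one_lt_top⟩, by simp, fun v hv => ?_⟩
  calc _ = ∫⁻ z, ‖f z.2 v - f z.1 v‖ₑ ^ 2 ∂slobodeckijMeasure Ω s := by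
        refine lintegral_congr_ae ?_
        filter_upwards [ae_slobodeckijMeasure ho] with z hz
        rw [phaseRestrict_of_mem hz.1 hv, phaseRestrict_of_mem hz.2 hv]
    _ ≤ c * w v ^ 2 := h v hv
    _ ≤ (c + 1) ^ 2 * w v ^ 2 := by
      gcongr
      calc c ≤ (c + 1) * 1 := by rw [mul_one]; exact le_self_add
        _ ≤ (c + 1) * (c + 1) := by gcongr; exact le_add_self
        _ = _ := (sq _).symm
    _ = _ := (mul_pow _ _ _).symm

/-- The Gaussian weight `exp(-b|v|²)`. -/
def gaussianWeight (b : ℝ) (v : Space) : ℝ := Real.exp (-b * ‖v‖ ^ 2)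

/-- The weight `(1 + |v|) exp(-b|v|²)`. -/
def linearGaussianWeight (b : ℝ) (v : Space) : ℝ := (1 + ‖v‖) * Real.exp (-b * ‖v‖ ^ 2)

variable {B : ℝ → ℝ → ℝ} {γ b : ℝ}

theorem IsWeightBounded.exists_bound (hf : IsWeightBounded Ω (gaussianWeight b) f) :
    ∃ C : ℝ, 0 ≤ C ∧ ∀ x v, |phaseRestrict Ω f (x, v)| ≤ C * gaussianWeight b v := by
  obtain ⟨C, hC0, hC⟩ := hf.bound
  refine ⟨C, hC0, fun x v => ?_⟩
  have h0 : 0 ≤ C * gaussianWeight b v := mul_nonneg hC0 (Real.exp_pos _).le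
  by_cases hx : x ∈ Ω
  · by_cases hv : v = 0
    · rw [hv, phaseRestrict_zero, abs_zero]; rwa [hv] at h0
    · rw [phaseRestrict_of_mem hx hv]; exact hC x hx v hv
  · rw [phaseRestrict_of_notMem hx, abs_zero]; exact h0

theorem gaussianWeight_le_one (hb : 0 ≤ b) (v : Space) : gaussianWeight b v ≤ 1 := by
  refine Real.exp_le_one_iff.2 ?_
  have := mul_nonneg hb (sq_nonneg ‖v‖)
  linarith

/-- Only `f(x,0)` can differ between the two sides, and `κ_v` has no atom at 0. Changing one value
keeps `f(x,·)` measurable and bounded, so the difference estimate for `K` applies. -/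
theorem opK_eq_phaseRestrict (hB : AngularCutoff B γ) (hγ₀ : 0 ≤ γ) (hγ₁ : γ ≤ 1) (hb : 0 ≤ b)
    (hf : IsWeightBounded Ω (gaussianWeight b) f) (hx : x ∈ Ω) (v : Space) :
    opK B f x v = collisionIntegral B (fun w => phaseRestrict Ω f (x, w)) v := by
  obtain ⟨C, hC0, hC⟩ := hf.exists_bound
  have hC' : ∀ w, |phaseRestrict Ω f (x, w)| ≤ C := fun w =>
    (hC x w).trans (mul_le_of_le_one_right hC0 (gaussianWeight_le_one hb w))
  have hm : Measurable fun w => phaseRestrict Ω f (x, w) := hf.measurable.comp measurable_prodMk_left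
  have hfx : f x = fun w => if w = 0 then f x 0 else phaseRestrict Ω f (x, w) := by
    funext w
    by_cases hw : w = 0
    · simp [hw]
    · simp [hw, phaseRestrict_of_mem hx hw]
  have hfm : Measurable (f x) := by
    rw [hfx]
    exact Measurable.ite (measurableSet_singleton 0) measurable_const hm
  have hfb : ∀ w, |f x w| ≤ max C |f x 0| := by
    intro w
    by_cases hw : w = 0
    · rw [hw]; exact le_max_right _ _
    · rw [← phaseRestrict_of_mem (f := f) hx hw]; exact (hC' w).trans (le_max_left _ _)
  have h := enorm_collisionIntegral_sub_le hB hγ₀ hγ₁ hfm hm hfb hC' v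
  have h0 : ∫⁻ w, ‖f x w - phaseRestrict Ω f (x, w)‖ₑ ∂collisionKernel B v = 0 := by
    refine lintegral_eq_zero_of_ae_eq_zero ?_
    filter_upwards [compl_mem_ae_iff.2 (collisionKernel_singleton_zero hB hγ₀ hγ₁ v)] with w hw
    rw [phaseRestrict_of_mem hx hw, sub_self]
    simp
  rw [h0, nonpos_iff_eq_zero, enorm_eq_zero, sub_eq_zero] at h
  exact h

theorem collisionIntegral_zero : collisionIntegral B (fun _ => 0) v = 0 := by
  simp [collisionIntegral, collisionGain, collisionLoss, weighted]

theorem IsWeightBounded.opK (hB : AngularCutoff B γ) (hγ₀ : 0 ≤ γ) (hγ₁ : γ ≤ 1) (ho : IsOpen Ω)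
    (hb0 : 0 ≤ b) (hb : b ≤ 1 / 2) (hf : IsWeightBounded Ω (gaussianWeight b) f) :
    IsWeightBounded Ω (linearGaussianWeight b) (opK B f) := by
  obtain ⟨C, hC0, hC⟩ := hf.exists_bound
  have hC' : ∀ x w, |phaseRestrict Ω f (x, w)| ≤ C := fun x w =>
    (hC x w).trans (mul_le_of_le_one_right hC0 (gaussianWeight_le_one hb0 w))
  obtain ⟨K, hK, hKv⟩ := exists_lintegral_collisionKernel_le hB hγ₀ hγ₁ (p := 0) le_rfl one_pos hb0 hb
  constructor
  · exact measurable_phaseRestrict_of_eq ho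
      (measurable_collisionIntegral hB hγ₀ hγ₁ (f := fun x w => phaseRestrict Ω f (x, w))
        hf.measurable hC')
      fun x hx v _ => opK_eq_phaseRestrict hB hγ₀ hγ₁ hb0 hf hx v
  · refine ⟨(ENNReal.ofReal C * K).toReal, ENNReal.toReal_nonneg, fun x hx v _ => ?_⟩
    have hm : Measurable fun w => phaseRestrict Ω f (x, w) := hf.measurable.comp measurable_prodMk_left
    have hfin : ENNReal.ofReal C * K ≠ ∞ := (ENNReal.mul_lt_top ENNReal.ofReal_lt_top hK).ne
    have hw0 : 0 ≤ linearGaussianWeight b v := by unfold linearGaussianWeight; positivity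
    have h := enorm_collisionIntegral_sub_le hB hγ₀ hγ₁ hm measurable_const (hC' x)
      (fun _ => (abs_zero (α := ℝ)).le) v
    rw [collisionIntegral_zero, sub_zero, ← opK_eq_phaseRestrict hB hγ₀ hγ₁ hb0 hf hx] at h
    have h2 : ‖StationaryBoltzmann.opK B f x v‖ₑ ≤
        ENNReal.ofReal ((ENNReal.ofReal C * K).toReal * linearGaussianWeight b v) := by
      refine h.trans ?_
      rw [ENNReal.ofReal_mul ENNReal.toReal_nonneg, ENNReal.ofReal_toReal hfin]
      calc _ ≤ ∫⁻ w, ENNReal.ofReal C * singularGaussian 0 b w ∂collisionKernel B v := by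
            refine lintegral_mono fun w => ?_
            rw [sub_zero, ← ofReal_norm, Real.norm_eq_abs]
            refine (ENNReal.ofReal_le_ofReal (hC x w)).trans ?_
            rw [ENNReal.ofReal_mul hC0]
            gcongr
            exact le_mul_of_one_le_left zero_le le_self_add
        _ = ENNReal.ofReal C * ∫⁻ w, singularGaussian 0 b w ∂collisionKernel B v :=
            lintegral_const_mul' _ _ ENNReal.ofReal_ne_top
        _ ≤ ENNReal.ofReal C * (K * ENNReal.ofReal ((1 + ‖v‖) * Real.exp (-b * ‖v‖ ^ 2))) := by
            gcongr; exact hKv v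
        _ = _ := (mul_assoc _ _ _).symm
    rw [← ofReal_norm, ENNReal.ofReal_le_ofReal_iff (by positivity)] at h2
    exact h2

/-- The increment of `K f` is at most the `κ_v`-integral of the increments of `f`. Minkowski's
inequality bounds its seminorm by the `κ_v`-integral of the singular weight. -/
theorem HasSlobodeckijBound.opK (hB : AngularCutoff B γ) (hγ₀ : 0 ≤ γ) (hγ₁ : γ ≤ 1) (ho : IsOpen Ω)
    (hb0 : 0 ≤ b) (hb : b ≤ 1 / 2) (hf : IsWeightBounded Ω (gaussianWeight b) f) {s p : ℝ}
    (hp0 : 0 ≤ p) (hp : p < 1) (hs : HasSlobodeckijBound Ω s (singularGaussian p b) f) :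
    HasSlobodeckijBound Ω s (fun v => ENNReal.ofReal (linearGaussianWeight b v)) (opK B f) := by
  obtain ⟨C, hC0, hC⟩ := hf.exists_bound
  have hC' : ∀ x w, |phaseRestrict Ω f (x, w)| ≤ C := fun x w =>
    (hC x w).trans (mul_le_of_le_one_right hC0 (gaussianWeight_le_one hb0 w))
  obtain ⟨K, hK, hKv⟩ := exists_lintegral_collisionKernel_le hB hγ₀ hγ₁ hp0 hp hb0 hb
  obtain ⟨c, hc, hcne, hcv⟩ := hs.phaseRestrict_le ho
  refine ⟨(c * K) ^ 2, ENNReal.pow_lt_top (ENNReal.mul_lt_top hc hK), fun v _ => ?_⟩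
  have := isFiniteMeasure_collisionKernel hB hγ₀ hγ₁ v
  have hm : ∀ x, Measurable fun w => phaseRestrict Ω f (x, w) := fun x =>
    hf.measurable.comp measurable_prodMk_left
  calc _ ≤ ∫⁻ z, (∫⁻ w, ‖phaseRestrict Ω f (z.2, w) - phaseRestrict Ω f (z.1, w)‖ₑ
          ∂collisionKernel B v) ^ 2 ∂slobodeckijMeasure Ω s := by
        refine lintegral_mono_ae ?_
        filter_upwards [ae_slobodeckijMeasure ho] with z hz
        rw [opK_eq_phaseRestrict hB hγ₀ hγ₁ hb0 hf hz.1, opK_eq_phaseRestrict hB hγ₀ hγ₁ hb0 hf hz.2]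
        gcongr
        exact enorm_collisionIntegral_sub_le hB hγ₀ hγ₁ (hm _) (hm _) (hC' _) (hC' _) v
    _ ≤ (∫⁻ w, c * singularGaussian p b w ∂collisionKernel B v) ^ 2 := by
        refine lintegral_sq_lintegral_le ?_
          ((measurable_singularGaussian p b).const_mul c).aemeasurable (fun w => ?_) ?_
        · have h1 : Measurable fun q : Space × Space × Space => phaseRestrict Ω f (q.2.2, q.1) :=
            hf.measurable.comp (by fun_prop)
          have h2 : Measurable fun q : Space × Space × Space => phaseRestrict Ω f (q.2.1, q.1) :=
            hf.measurable.comp (by fun_prop)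
          exact (h1.sub h2).enorm
        · refine mul_ne_zero hcne (mul_ne_zero (by simp) ?_)
          exact (ENNReal.ofReal_pos.2 (Real.exp_pos _)).ne'
        · filter_upwards [compl_mem_ae_iff.2 (collisionKernel_singleton_zero hB hγ₀ hγ₁ v)] with w hw
          exact hcv w hw
    _ ≤ (c * (K * ENNReal.ofReal (linearGaussianWeight b v))) ^ 2 := by
        rw [lintegral_const_mul' _ _ hc.ne]
        gcongr
        exact hKv v
    _ = _ := by ring

end Classes

/-! ### Interpolation and functions controlled by the chord modulus -/

section Transport

variable {Ω : Set Space} {B : ℝ → ℝ → ℝ} {γ b d T s p : ℝ} {f h : Space → Space → ℝ} {x v : Space}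

theorem singularGaussian_eq (p b : ℝ) (v : Space) :
    singularGaussian p b v = (1 + ‖v‖ₑ ^ (-p)) * ENNReal.ofReal (gaussianWeight b v) := rfl

theorem lintegral_sq_gaussianWeight_mul_chordModulus_le {G : ℝ≥0∞} {v : Space} {C : ℝ} (hC : 0 ≤ C)
    (hG : ∫⁻ z, ENNReal.ofReal (chordModulus Ω p v z) ^ 2 ∂slobodeckijMeasure Ω s ≤
      G * (1 + ‖v‖ₑ ^ (-p)) ^ 2) :
    ∫⁻ z, ENNReal.ofReal (C * gaussianWeight b v * chordModulus Ω p v z) ^ 2 ∂slobodeckijMeasure Ω s ≤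
      ENNReal.ofReal C ^ 2 * G * singularGaussian p b v ^ 2 := by
  have hw : 0 ≤ gaussianWeight b v := (Real.exp_pos _).le
  calc _ = ∫⁻ z, (ENNReal.ofReal C * ENNReal.ofReal (gaussianWeight b v)) ^ 2 *
          ENNReal.ofReal (chordModulus Ω p v z) ^ 2 ∂slobodeckijMeasure Ω s := by
        refine lintegral_congr fun z => ?_
        rw [ENNReal.ofReal_mul (mul_nonneg hC hw), ENNReal.ofReal_mul hC, mul_pow]
    _ = (ENNReal.ofReal C * ENNReal.ofReal (gaussianWeight b v)) ^ 2 *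
          ∫⁻ z, ENNReal.ofReal (chordModulus Ω p v z) ^ 2 ∂slobodeckijMeasure Ω s :=
        lintegral_const_mul' _ _
          (ENNReal.pow_lt_top (ENNReal.mul_lt_top ENNReal.ofReal_lt_top ENNReal.ofReal_lt_top)).ne
    _ ≤ (ENNReal.ofReal C * ENNReal.ofReal (gaussianWeight b v)) ^ 2 *
          (G * (1 + ‖v‖ₑ ^ (-p)) ^ 2) := by gcongr
    _ = _ := by rw [singularGaussian_eq]; ring

theorem hasSlobodeckijBound_of_le_chordModulus (hΩ : IsPositivelyCurvedDomain Ω)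
    (hs : 0 < s) (hsp : s < p) (hp : p < 1) {C : ℝ} (hC : 0 ≤ C)
    (h : ∀ v ≠ 0, ∀ x ∈ Ω, ∀ y ∈ Ω,
      |f y v - f x v| ≤ C * gaussianWeight b v * chordModulus Ω p v (x, y)) :
    HasSlobodeckijBound Ω s (singularGaussian p b) f := by
  obtain ⟨G, hG, hGv⟩ := exists_lintegral_chordModulus_le hΩ hs hsp hp
  refine ⟨ENNReal.ofReal C ^ 2 * G,
    ENNReal.mul_lt_top (ENNReal.pow_lt_top ENNReal.ofReal_lt_top) hG, fun v hv => ?_⟩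
  refine le_trans (lintegral_mono_ae ?_)
    (lintegral_sq_gaussianWeight_mul_chordModulus_le hC (hGv v hv))
  filter_upwards [ae_slobodeckijMeasure hΩ.isOpen] with z hz
  rw [← ofReal_norm, Real.norm_eq_abs]
  gcongr
  exact h v hv _ hz.1 _ hz.2

/-- Interpolation: a Lipschitz bound is traded for its power `p`, while the fraction `1 - p` of a
size bound is kept. The power `p < 1` is what the chord estimates can integrate. -/
theorem min_le_rpow_mul_rpow {X Y : ℝ} (hX : 0 ≤ X) (hY : 0 ≤ Y) (hp0 : 0 ≤ p) (hp : p ≤ 1) :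
    min X Y ≤ X ^ p * Y ^ (1 - p) := by
  have hm : 0 ≤ min X Y := le_min hX hY
  calc min X Y = min X Y ^ p * min X Y ^ (1 - p) := by
        rw [← Real.rpow_add_of_nonneg hm hp0 (by linarith), add_sub_cancel, Real.rpow_one]
    _ ≤ _ := by
        gcongr
        · exact min_le_left _ _
        · exact min_le_right _ _

/-! ### The incoming data -/

theorem abs_exp_neg_sub_exp_neg_le_rpow {α β : ℝ} (hα : 0 ≤ α) (hβ : 0 ≤ β) (hp0 : 0 ≤ p) (hp : p ≤ 1) :
    |Real.exp (-α) - Real.exp (-β)| ≤ |α - β| ^ p := by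
  have key : ∀ α β : ℝ, 0 ≤ α → α ≤ β → |Real.exp (-α) - Real.exp (-β)| ≤ min |α - β| 1 := by
    intro α β hα hαβ
    have h1 : Real.exp (-β) ≤ Real.exp (-α) := Real.exp_le_exp.2 (by linarith)
    have h2 : Real.exp (-α) ≤ 1 := Real.exp_le_one_iff.2 (by linarith)
    have h3 := Real.exp_pos (-β)
    rw [abs_of_nonneg (by linarith), abs_of_nonpos (by linarith)]
    refine le_min ?_ (by linarith)
    have h4 : Real.exp (-β) = Real.exp (-α) * Real.exp (α - β) := by rw [← Real.exp_add]; ring_nf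
    have h5 := Real.add_one_le_exp (α - β)
    have h6 := Real.exp_pos (-α)
    nlinarith
  have h : |Real.exp (-α) - Real.exp (-β)| ≤ min |α - β| 1 := by
    rcases le_total α β with h | h
    · exact key α β hα h
    · rw [abs_sub_comm, abs_sub_comm α β]; exact key β α hβ h
  refine h.trans ((min_le_rpow_mul_rpow (abs_nonneg _) zero_le_one hp0 hp).trans_eq ?_)
  rw [Real.one_rpow, mul_one]

theorem measurable_phaseRestrict_opJ (hB : AngularCutoff B γ) (hγ₀ : 0 ≤ γ) (hγ₁ : γ ≤ 1)
    (hΩ : IsPositivelyCurvedDomain Ω) {g : Space → Space → ℝ} {a C : ℝ} (hg : IsIncomingData Ω g a C) :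
    Measurable (phaseRestrict Ω (opJ B Ω g)) := by
  set E : Set (Space × Space) := Ω ×ˢ ({0}ᶜ : Set Space) with hE
  have hEm : MeasurableSet E := hΩ.isOpen.measurableSet.prod (measurableSet_singleton 0).compl
  set τ : Space × Space → ℝ := E.indicator fun p => exitTime Ω p.1 p.2 with hτ
  have hτm : Measurable τ := measurable_indicator_exitTime hΩ.isOpen hΩ.convex hΩ.isBounded
  have hτe : ∀ z : E, τ z = exitTime Ω z.1.1 z.1.2 := fun z => indicator_of_mem z.2 _
  have hmem : ∀ z : E, (z.1.1 - τ z • z.1.2, z.1.2) ∈ incomingBoundary Ω := by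
    intro z
    rw [hτe]
    exact exitPoint_mem_incomingBoundary hΩ z.2.1 z.2.2
  have hτm' : Measurable fun z : E => τ z := hτm.comp measurable_subtype_coe
  have h1 : Measurable fun z : E => (z.1.1 - τ z • z.1.2, z.1.2) := by
    have : Measurable fun z : E => z.1 := measurable_subtype_coe
    fun_prop
  have h2 : Measurable fun z : E => g (z.1.1 - τ z • z.1.2) z.1.2 :=
    hg.measurable.comp (h1.subtype_mk (h := hmem))
  have hν := measurable_collisionFrequency hB hγ₀ hγ₁
  have h3 : Measurable fun z : E => Real.exp (-collisionFrequency B z.1.2 * τ z) := by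
    have : Measurable fun z : E => collisionFrequency B z.1.2 :=
      hν.comp (measurable_snd.comp measurable_subtype_coe)
    fun_prop
  refine measurable_of_restrict_of_restrict_compl hEm ?_ ?_
  · have h4 : E.domRestrict (phaseRestrict Ω (opJ B Ω g)) = fun z : E =>
        Real.exp (-collisionFrequency B z.1.2 * τ z) * g (z.1.1 - τ z • z.1.2) z.1.2 := by
      funext z
      rw [hτe, domRestrict_apply, phaseRestrict, indicator_of_mem z.2]
      rfl
    rw [h4]
    exact h3.mul h2
  · have h4 : Eᶜ.domRestrict (phaseRestrict Ω (opJ B Ω g)) = fun _ => 0 := by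
      funext z
      rw [domRestrict_apply, phaseRestrict, indicator_of_notMem z.2]
    rw [h4]
    exact measurable_const

theorem abs_opJ_le (hB : AngularCutoff B γ) (hγ₀ : 0 ≤ γ) (hγ₁ : γ ≤ 1)
    (hΩ : IsPositivelyCurvedDomain Ω) {g : Space → Space → ℝ} {a C : ℝ} (hg : IsIncomingData Ω g a C)
    (hx : x ∈ Ω) (hv : v ≠ 0) : |opJ B Ω g x v| ≤ C * gaussianWeight a v := by
  have h1 := hg.gaussian_bound _ _ (exitPoint_mem_incomingBoundary hΩ hx hv)
  have h2 : Real.exp (-collisionFrequency B v * exitTime Ω x v) ≤ 1 := by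
    refine Real.exp_le_one_iff.2 ?_
    have := mul_nonneg (collisionFrequency_nonneg hB hγ₀ hγ₁ v)
      (exitTime_pos hΩ.isOpen hΩ.convex hΩ.isBounded hx hv).le
    linarith
  rw [opJ, abs_mul, abs_of_pos (Real.exp_pos _)]
  exact (mul_le_of_le_one_left (abs_nonneg _) h2).trans h1

theorem gaussianWeight_anti {a : ℝ} (hba : b ≤ a) (v : Space) :
    gaussianWeight a v ≤ gaussianWeight b v := by
  unfold gaussianWeight
  gcongr

theorem isWeightBounded_opJ (hB : AngularCutoff B γ) (hγ₀ : 0 ≤ γ) (hγ₁ : γ ≤ 1)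
    (hΩ : IsPositivelyCurvedDomain Ω) {g : Space → Space → ℝ} {a C : ℝ} (hC : 0 ≤ C)
    (hg : IsIncomingData Ω g a C) (hba : b ≤ a) :
    IsWeightBounded Ω (gaussianWeight b) (opJ B Ω g) := by
  refine ⟨measurable_phaseRestrict_opJ hB hγ₀ hγ₁ hΩ hg, C, hC, fun x hx v hv =>
    (abs_opJ_le hB hγ₀ hγ₁ hΩ hg hx hv).trans ?_⟩
  gcongr
  exact gaussianWeight_anti hba v

/-- The Lipschitz bound on `g` has no decay in `v`, so it is interpolated with `2C exp(-a|v|²)`; the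
decay left is `exp(-a(1-p)|v|²)`, whence `b ≤ a(1-p)`. The exponential factor varies by at most
`(ν|τ_y - τ_x|)^p` with `ν ≤ N(1+|v|)`, which accounts for the prefactor `(1+|v|)/|v|` of the
modulus. -/
theorem hasSlobodeckijBound_opJ (hB : AngularCutoff B γ) (hγ₀ : 0 ≤ γ) (hγ₁ : γ ≤ 1)
    (hΩ : IsPositivelyCurvedDomain Ω) {g : Space → Space → ℝ} {a C : ℝ} (ha : 0 ≤ a) (hC : 0 ≤ C)
    (hg : IsIncomingData Ω g a C) (hs : 0 < s) (hsp : s < p) (hp : p < 1) (hba : b ≤ a * (1 - p)) :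
    HasSlobodeckijBound Ω s (singularGaussian p b) (opJ B Ω g) := by
  obtain ⟨N, hN0, hN⟩ := exists_collisionFrequency_le hB hγ₀ hγ₁
  have hp0 : 0 < p := hs.trans hsp
  refine hasSlobodeckijBound_of_le_chordModulus hΩ hs hsp hp
    (C := N ^ p * C + C ^ p * (2 * C) ^ (1 - p)) (by positivity) fun v hv x hx y hy => ?_
  have hv0 : 0 < ‖v‖ := norm_pos_iff.2 hv
  have hν0 := collisionFrequency_nonneg hB hγ₀ hγ₁ v
  have hτ : ∀ x ∈ Ω, 0 ≤ exitTime Ω x v := fun x hx =>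
    (exitTime_pos hΩ.isOpen hΩ.convex hΩ.isBounded hx hv).le
  have hq : ∀ x ∈ Ω, (exitPoint Ω x v, v) ∈ incomingBoundary Ω := fun x hx =>
    exitPoint_mem_incomingBoundary hΩ hx hv
  have hw0 : 0 ≤ gaussianWeight b v := (Real.exp_pos _).le
  have hwa0 : 0 ≤ gaussianWeight a v := (Real.exp_pos _).le
  have hwab : gaussianWeight a v ≤ gaussianWeight b v :=
    gaussianWeight_anti (hba.trans (mul_le_of_le_one_right ha (by linarith))) v
  set Δ := |exitTime Ω y v - exitTime Ω x v| * ‖v‖ + ‖y - x‖ with hΔ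
  have hΔ0 : 0 ≤ Δ := by positivity
  have hmod : chordModulus Ω p v (x, y) = ((1 + ‖v‖) / ‖v‖ * Δ) ^ p := rfl
  have hmod0 := chordModulus_nonneg (Ω := Ω) p v (x, y)
  set eX := Real.exp (-collisionFrequency B v * exitTime Ω x v) with heX
  set eY := Real.exp (-collisionFrequency B v * exitTime Ω y v) with heY
  have he : |eY - eX| ≤ N ^ p * chordModulus Ω p v (x, y) := by
    have h1 := abs_exp_neg_sub_exp_neg_le_rpow (mul_nonneg hν0 (hτ y hy)) (mul_nonneg hν0 (hτ x hx))
      hp0.le hp.le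
    rw [← neg_mul, ← neg_mul, ← mul_sub, abs_mul, abs_of_nonneg hν0] at h1
    refine h1.trans ?_
    rw [hmod, ← Real.mul_rpow hN0 (by positivity)]
    refine Real.rpow_le_rpow (by positivity) ?_ hp0.le
    calc collisionFrequency B v * |exitTime Ω y v - exitTime Ω x v|
        ≤ N * (1 + ‖v‖) * |exitTime Ω y v - exitTime Ω x v| := by gcongr; exact hN v
      _ = N * ((1 + ‖v‖) / ‖v‖ * (|exitTime Ω y v - exitTime Ω x v| * ‖v‖)) := by field_simp
      _ ≤ _ := by
        gcongr
        exact le_add_of_nonneg_right (norm_nonneg _)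
  have hgd : |g (exitPoint Ω y v) v - g (exitPoint Ω x v) v| ≤
      C ^ p * (2 * C) ^ (1 - p) * gaussianWeight b v * chordModulus Ω p v (x, y) := by
    have hlip := hg.lipschitz _ _ _ (hq y hy) (hq x hx)
    have hqd : ‖exitPoint Ω y v - exitPoint Ω x v‖ ≤ Δ := by
      have : exitPoint Ω y v - exitPoint Ω x v =
          (y - x) - (exitTime Ω y v - exitTime Ω x v) • v := by
        simp only [exitPoint]; module
      rw [this, hΔ, add_comm, ← Real.norm_eq_abs, ← norm_smul]
      exact norm_sub_le _ _
    have hbd : |g (exitPoint Ω y v) v - g (exitPoint Ω x v) v| ≤ 2 * C * gaussianWeight a v := by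
      refine (abs_sub _ _).trans ?_
      have h1 := hg.gaussian_bound _ _ (hq y hy)
      have h2 := hg.gaussian_bound _ _ (hq x hx)
      change _ ≤ C * gaussianWeight a v at h1 h2
      linarith
    have h1 : |g (exitPoint Ω y v) v - g (exitPoint Ω x v) v| ≤
        min (C * Δ) (2 * C * gaussianWeight a v) :=
      le_min (hlip.trans (by gcongr)) hbd
    refine h1.trans ((min_le_rpow_mul_rpow (by positivity) (by positivity) hp0.le hp.le).trans ?_)
    have hwp : gaussianWeight a v ^ (1 - p) ≤ gaussianWeight b v := by
      rw [gaussianWeight, gaussianWeight, ← Real.exp_mul, Real.exp_le_exp]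
      nlinarith [sq_nonneg ‖v‖, mul_le_mul_of_nonneg_right hba (sq_nonneg ‖v‖)]
    have hΔp : Δ ^ p ≤ chordModulus Ω p v (x, y) := by
      rw [hmod]
      refine Real.rpow_le_rpow hΔ0 (le_mul_of_one_le_left hΔ0 ?_) hp0.le
      rw [one_le_div hv0]; linarith
    rw [Real.mul_rpow hC hΔ0, Real.mul_rpow (by positivity) hwa0]
    calc C ^ p * Δ ^ p * ((2 * C) ^ (1 - p) * gaussianWeight a v ^ (1 - p))
        ≤ C ^ p * chordModulus Ω p v (x, y) * ((2 * C) ^ (1 - p) * gaussianWeight b v) := by gcongr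
      _ = _ := by ring
  have heX1 : 0 ≤ eX ∧ eX ≤ 1 := by
    refine ⟨(Real.exp_pos _).le, Real.exp_le_one_iff.2 ?_⟩
    have := mul_nonneg hν0 (hτ x hx)
    linarith
  have hgy : |g (exitPoint Ω y v) v| ≤ C * gaussianWeight b v :=
    (hg.gaussian_bound _ _ (hq y hy)).trans (by gcongr; exact hwab)
  calc |opJ B Ω g y v - opJ B Ω g x v|
      = |(eY - eX) * g (exitPoint Ω y v) v +
          eX * (g (exitPoint Ω y v) v - g (exitPoint Ω x v) v)| := by
        simp only [opJ, ← heX, ← heY]; congr 1; ring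
    _ ≤ |eY - eX| * |g (exitPoint Ω y v) v| +
          eX * |g (exitPoint Ω y v) v - g (exitPoint Ω x v) v| := by
        refine (abs_add_le _ _).trans ?_
        rw [abs_mul, abs_mul, abs_of_nonneg heX1.1]
    _ ≤ N ^ p * chordModulus Ω p v (x, y) * (C * gaussianWeight b v) +
          1 * (C ^ p * (2 * C) ^ (1 - p) * gaussianWeight b v * chordModulus Ω p v (x, y)) := by
        gcongr
        exact heX1.2
    _ = _ := by ring

end Transport

/-! ### The transport operator `S_Ω` -/

section Duhamel

variable {Ω : Set Space} {B : ℝ → ℝ → ℝ} {γ b d T s p : ℝ} {h : Space → Space → ℝ} {x v : Space}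

/-- The integrand of `S_Ω h`, with `h` extended by zero. -/
def transportIntegrand (B : ℝ → ℝ → ℝ) (Ω : Set Space) (h : Space → Space → ℝ) (x v : Space) (t : ℝ) :
    ℝ :=
  Real.exp (-collisionFrequency B v * t) * phaseRestrict Ω h (x - t • v, v)

theorem measurable_transportIntegrand (hB : AngularCutoff B γ) (hγ₀ : 0 ≤ γ) (hγ₁ : γ ≤ 1)
    (hm : Measurable (phaseRestrict Ω h)) :
    Measurable fun q : (Space × Space) × ℝ => transportIntegrand B Ω h q.1.1 q.1.2 q.2 := by
  have hν : Measurable fun q : (Space × Space) × ℝ => collisionFrequency B q.1.2 :=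
    (measurable_collisionFrequency hB hγ₀ hγ₁).comp (measurable_snd.comp measurable_fst)
  have h1 : Measurable fun q : (Space × Space) × ℝ => Real.exp (-collisionFrequency B q.1.2 * q.2) := by
    fun_prop
  have h2 : Measurable fun q : (Space × Space) × ℝ => (q.1.1 - q.2 • q.1.2, q.1.2) := by
    fun_prop
  exact h1.mul (hm.comp h2)

/-- With `h` extended by zero, the integrand vanishes after the exit time. The domain of integration
can then be chosen independent of `x`: the half-line for measurability, `(0, d/|v|]` for comparing
two positions. -/
theorem opS_eq_setIntegral (ho : IsOpen Ω) (hc : Convex ℝ Ω) (hb : Bornology.IsBounded Ω)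
    (hx : x ∈ Ω) (hv : v ≠ 0) {R : Set ℝ} (hR : MeasurableSet R) (hR1 : Ioo 0 (exitTime Ω x v) ⊆ R)
    (hR2 : R ⊆ Ioi 0) :
    opS B Ω h x v = ∫ t in R, transportIntegrand B Ω h x v t := by
  rw [opS, intervalIntegral.integral_of_le (exitTime_pos ho hc hb hx hv).le,
    setIntegral_congr_set Ioo_ae_eq_Ioc.symm,
    setIntegral_eq_of_subset_of_forall_sdiff_eq_zero hR hR1 fun t ht => ?_]
  · refine setIntegral_congr_fun measurableSet_Ioo fun t ht => ?_
    simp only [transportIntegrand]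
    rw [phaseRestrict_of_mem ((sub_smul_mem_iff_lt_exitTime ho hc hb hx hv ht.1.le).2 ht.2) hv]
  · have ht0 : 0 < t := hR2 ht.1
    have hn : x - t • v ∉ Ω := fun hmem =>
      ht.2 ⟨ht0, (sub_smul_mem_iff_lt_exitTime ho hc hb hx hv ht0.le).1 hmem⟩
    rw [transportIntegrand, phaseRestrict_of_notMem hn, mul_zero]

theorem measurable_phaseRestrict_opS (hB : AngularCutoff B γ) (hγ₀ : 0 ≤ γ) (hγ₁ : γ ≤ 1)
    (ho : IsOpen Ω) (hc : Convex ℝ Ω) (hb : Bornology.IsBounded Ω) (hm : Measurable (phaseRestrict Ω h)) :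
    Measurable (phaseRestrict Ω (opS B Ω h)) := by
  refine measurable_phaseRestrict_of_eq ho (F := fun z : Space × Space =>
    ∫ t in Ioi 0, transportIntegrand B Ω h z.1 z.2 t) ?_ fun x hx v hv =>
      opS_eq_setIntegral ho hc hb hx hv measurableSet_Ioi Ioo_subset_Ioi_self subset_rfl
  exact (StronglyMeasurable.integral_prod_right'
    (measurable_transportIntegrand hB hγ₀ hγ₁ hm).stronglyMeasurable).measurable

theorem linearGaussianWeight_nonneg (b : ℝ) (v : Space) : 0 ≤ linearGaussianWeight b v := by
  unfold linearGaussianWeight; positivity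

theorem abs_phaseRestrict_le {C : ℝ} (hC0 : 0 ≤ C)
    (hC : ∀ x ∈ Ω, ∀ v ≠ 0, |h x v| ≤ C * linearGaussianWeight b v) (x v : Space) :
    |phaseRestrict Ω h (x, v)| ≤ C * linearGaussianWeight b v := by
  have h0 : 0 ≤ C * linearGaussianWeight b v := mul_nonneg hC0 (linearGaussianWeight_nonneg b v)
  by_cases hx : x ∈ Ω
  · by_cases hv : v = 0
    · rw [hv, phaseRestrict_zero, abs_zero]; rwa [hv] at h0
    · rw [phaseRestrict_of_mem hx hv]; exact hC x hx v hv
  · rw [phaseRestrict_of_notMem hx, abs_zero]; exact h0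

theorem linearGaussianWeight_mul_div (b T : ℝ) (v : Space) :
    T / (1 + ‖v‖) * linearGaussianWeight b v = T * gaussianWeight b v := by
  have : 0 < 1 + ‖v‖ := by positivity
  rw [linearGaussianWeight, gaussianWeight]; field_simp

theorem enorm_transportIntegrand (t : ℝ) : ‖transportIntegrand B Ω h x v t‖ₑ =
    ENNReal.ofReal (Real.exp (-collisionFrequency B v * t)) * ‖phaseRestrict Ω h (x - t • v, v)‖ₑ := by
  rw [transportIntegrand, enorm_mul, Real.enorm_of_nonneg (Real.exp_pos _).le]

theorem isWeightBounded_opS (hB : AngularCutoff B γ) (hγ₀ : 0 ≤ γ) (hγ₁ : γ ≤ 1)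
    (ho : IsOpen Ω) (hc : Convex ℝ Ω) (hb : Bornology.IsBounded Ω)
    (hd : ∀ x ∈ Ω, ∀ v ≠ 0, exitTime Ω x v ≤ d / ‖v‖) (hT0 : 0 ≤ T)
    (hT : ∀ v, transitTime B d v ≤ ENNReal.ofReal (T / (1 + ‖v‖)))
    (hh : IsWeightBounded Ω (linearGaussianWeight b) h) :
    IsWeightBounded Ω (gaussianWeight b) (opS B Ω h) := by
  obtain ⟨C, hC0, hC⟩ := hh.bound
  refine ⟨measurable_phaseRestrict_opS hB hγ₀ hγ₁ ho hc hb hh.measurable, C * T, by positivity,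
    fun x hx v hv => ?_⟩
  have hle := abs_phaseRestrict_le hC0 hC
  have h1 : ‖opS B Ω h x v‖ₑ ≤ ENNReal.ofReal (C * T * gaussianWeight b v) := by
    rw [opS_eq_setIntegral ho hc hb hx hv measurableSet_Ioc
      (Ioo_subset_Ioc_self.trans (Ioc_subset_Ioc_right (hd x hx v hv))) Ioc_subset_Ioi_self]
    calc _ ≤ ∫⁻ t in Ioc 0 (d / ‖v‖), ‖transportIntegrand B Ω h x v t‖ₑ :=
          enorm_integral_le_lintegral_enorm _
      _ ≤ ∫⁻ t in Ioc 0 (d / ‖v‖), ENNReal.ofReal (Real.exp (-collisionFrequency B v * t)) *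
            ENNReal.ofReal (C * linearGaussianWeight b v) := by
          refine lintegral_mono fun t => ?_
          rw [enorm_transportIntegrand, ← ofReal_norm, Real.norm_eq_abs]
          gcongr
          exact hle _ _
      _ = transitTime B d v * ENNReal.ofReal (C * linearGaussianWeight b v) :=
          lintegral_mul_const' _ _ ENNReal.ofReal_ne_top
      _ ≤ ENNReal.ofReal (T / (1 + ‖v‖)) * ENNReal.ofReal (C * linearGaussianWeight b v) := by
          gcongr; exact hT v
      _ = _ := by
          rw [← ENNReal.ofReal_mul (by positivity), mul_left_comm, linearGaussianWeight_mul_div,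
            mul_assoc]
  have h0 : 0 ≤ C * T * gaussianWeight b v := mul_nonneg (by positivity) (Real.exp_pos _).le
  rwa [← ofReal_norm, ENNReal.ofReal_le_ofReal_iff h0] at h1

theorem add_sq_le_four_mul (a b : ℝ≥0∞) : (a + b) ^ 2 ≤ 4 * (a ^ 2 + b ^ 2) := by
  calc (a + b) ^ 2 ≤ (2 * max a b) ^ 2 := by
        rw [two_mul]
        gcongr
        · exact le_max_left _ _
        · exact le_max_right _ _
    _ = 4 * max a b ^ 2 := by ring
    _ ≤ _ := by
        gcongr
        rcases max_cases a b with h | h <;> rw [h.1]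
        · exact le_self_add
        · exact le_add_self

/-- Difference of `h` along parallel characteristics staying in `Ω`. -/
def interiorDifference (Ω : Set Space) (h : Space → Space → ℝ) (v : Space) (t : ℝ)
    (z : Space × Space) : ℝ≥0∞ :=
  (Ω ×ˢ Ω).indicator (fun z => ‖phaseRestrict Ω h (z.2, v) - phaseRestrict Ω h (z.1, v)‖ₑ)
    (z.1 - t • v, z.2 - t • v)

theorem measurable_interiorDifference (ho : IsOpen Ω) (hm : Measurable (phaseRestrict Ω h)) (v : Space) :
    Measurable fun q : ℝ × Space × Space => interiorDifference Ω h v q.1 q.2 := by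
  have h0 : Measurable fun z : Space × Space =>
      ‖phaseRestrict Ω h (z.2, v) - phaseRestrict Ω h (z.1, v)‖ₑ := by
    have h1 : Measurable fun z : Space × Space => phaseRestrict Ω h (z.2, v) := hm.comp (by fun_prop)
    have h2 : Measurable fun z : Space × Space => phaseRestrict Ω h (z.1, v) := hm.comp (by fun_prop)
    exact (h1.sub h2).enorm
  have h3 : Measurable fun q : ℝ × Space × Space => (q.2.1 - q.1 • v, q.2.2 - q.1 • v) := by fun_prop
  exact (h0.indicator (ho.measurableSet.prod ho.measurableSet)).comp h3

/-- At time `t` either both backward characteristics are in Ω, or both have left, or exactly one has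
left. In the last case `t` lies between the two exit times and only the size of `h` is available. -/
theorem enorm_transportIntegrand_sub_le (ho : IsOpen Ω) (hc : Convex ℝ Ω) (hb : Bornology.IsBounded Ω)
    {C : ℝ} (hC0 : 0 ≤ C) (hC : ∀ x ∈ Ω, ∀ v ≠ 0, |h x v| ≤ C * linearGaussianWeight b v)
    {y : Space} (hx : x ∈ Ω) (hy : y ∈ Ω) (hv : v ≠ 0) {t : ℝ} (ht : 0 ≤ t) :
    ‖transportIntegrand B Ω h y v t - transportIntegrand B Ω h x v t‖ₑ ≤
      ENNReal.ofReal (Real.exp (-collisionFrequency B v * t)) * interiorDifference Ω h v t (x, y) +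
      (Ico (min (exitTime Ω x v) (exitTime Ω y v)) (max (exitTime Ω x v) (exitTime Ω y v))).indicator
        (fun t => ENNReal.ofReal (Real.exp (-collisionFrequency B v * t)) *
          ENNReal.ofReal (C * linearGaussianWeight b v)) t := by
  have hle := abs_phaseRestrict_le hC0 hC
  have hsub : ‖transportIntegrand B Ω h y v t - transportIntegrand B Ω h x v t‖ₑ =
      ENNReal.ofReal (Real.exp (-collisionFrequency B v * t)) *
        ‖phaseRestrict Ω h (y - t • v, v) - phaseRestrict Ω h (x - t • v, v)‖ₑ := by
    rw [transportIntegrand, transportIntegrand, ← mul_sub, enorm_mul,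
      Real.enorm_of_nonneg (Real.exp_pos _).le]
  have hex := sub_smul_mem_iff_lt_exitTime ho hc hb hx hv ht
  have hey := sub_smul_mem_iff_lt_exitTime ho hc hb hy hv ht
  have henorm : ∀ z, ‖phaseRestrict Ω h (z, v)‖ₑ ≤ ENNReal.ofReal (C * linearGaussianWeight b v) := by
    intro z
    rw [← ofReal_norm, Real.norm_eq_abs]
    exact ENNReal.ofReal_le_ofReal (hle _ _)
  rw [hsub]
  by_cases h1 : x - t • v ∈ Ω <;> by_cases h2 : y - t • v ∈ Ω
  · refine le_trans (le_of_eq ?_) le_self_add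
    rw [interiorDifference, indicator_of_mem (mk_mem_prod h1 h2)]
  · refine le_trans ?_ le_add_self
    rw [indicator_of_mem, phaseRestrict_of_notMem h2, zero_sub, enorm_neg]
    · gcongr; exact henorm _
    · exact ⟨(min_le_right _ _).trans (not_lt.1 fun hlt => h2 (hey.2 hlt)),
        (hex.1 h1).trans_le (le_max_left _ _)⟩
  · refine le_trans ?_ le_add_self
    rw [indicator_of_mem, phaseRestrict_of_notMem h1, sub_zero]
    · gcongr; exact henorm _
    · exact ⟨(min_le_left _ _).trans (not_lt.1 fun hlt => h1 (hex.2 hlt)),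
        (hey.1 h2).trans_le (le_max_right _ _)⟩
  · rw [phaseRestrict_of_notMem h1, phaseRestrict_of_notMem h2, sub_zero, enorm_zero, mul_zero]
    exact zero_le

/-- The time between the exits is at most `δ = |τ_y - τ_x|`, and its damped measure at most
`T/(1+|v|)`. Interpolating gives `δ^p (T/(1+|v|))^(1-p)`; multiplied by the weight's factor `1+|v|`,
this leaves exactly `((1+|v|)δ)^p`. -/
theorem lintegral_exitTime_gap_le (hB : AngularCutoff B γ) (hγ₀ : 0 ≤ γ) (hγ₁ : γ ≤ 1)
    (hp0 : 0 ≤ p) (hp : p ≤ 1) (hT0 : 0 ≤ T) (hT : transitTime B d v ≤ ENNReal.ofReal (T / (1 + ‖v‖)))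
    {C : ℝ} (hC0 : 0 ≤ C) (hv : v ≠ 0) (x y : Space) :
    ∫⁻ t in Ioc 0 (d / ‖v‖),
      (Ico (min (exitTime Ω x v) (exitTime Ω y v)) (max (exitTime Ω x v) (exitTime Ω y v))).indicator
        (fun t => ENNReal.ofReal (Real.exp (-collisionFrequency B v * t)) *
          ENNReal.ofReal (C * linearGaussianWeight b v)) t ≤
      ENNReal.ofReal (C * T ^ (1 - p) * gaussianWeight b v * chordModulus Ω p v (x, y)) := by
  have hv0 : 0 < ‖v‖ := norm_pos_iff.2 hv
  set I := Ico (min (exitTime Ω x v) (exitTime Ω y v)) (max (exitTime Ω x v) (exitTime Ω y v)) with hI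
  set E : ℝ → ℝ≥0∞ := fun t => ENNReal.ofReal (Real.exp (-collisionFrequency B v * t)) with hE
  set δ := |exitTime Ω y v - exitTime Ω x v| with hδ
  have hw0 := linearGaussianWeight_nonneg b v
  have h1 : ∫⁻ t in Ioc 0 (d / ‖v‖), I.indicator E t ≤ ENNReal.ofReal (T / (1 + ‖v‖)) :=
    (lintegral_mono fun t => indicator_le_self _ _ _).trans hT
  have h2 : ∫⁻ t in Ioc 0 (d / ‖v‖), I.indicator E t ≤ ENNReal.ofReal δ := by
    calc _ ≤ ∫⁻ t in Ioc 0 (d / ‖v‖), I.indicator 1 t := by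
          refine setLIntegral_mono' measurableSet_Ioc fun t ht => ?_
          refine indicator_le_indicator ?_
          rw [hE, Pi.one_apply, ← ENNReal.ofReal_one]
          refine ENNReal.ofReal_le_ofReal (Real.exp_le_one_iff.2 ?_)
          have := mul_nonneg (collisionFrequency_nonneg hB hγ₀ hγ₁ v) ht.1.le
          linarith
      _ ≤ ∫⁻ t, I.indicator 1 t := setLIntegral_le_lintegral _ _
      _ = ENNReal.ofReal δ := by
          rw [lintegral_indicator_one measurableSet_Ico, Real.volume_Ico, max_sub_min_eq_abs']
          rw [hδ, abs_sub_comm]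
  have h3 : ∫⁻ t in Ioc 0 (d / ‖v‖), I.indicator E t ≤
      ENNReal.ofReal (δ ^ p * (T / (1 + ‖v‖)) ^ (1 - p)) := by
    refine (le_min h2 h1).trans ?_
    rw [← ENNReal.ofReal_min]
    exact ENNReal.ofReal_le_ofReal (min_le_rpow_mul_rpow (abs_nonneg _) (by positivity) hp0 hp)
  calc _ = (∫⁻ t in Ioc 0 (d / ‖v‖), I.indicator E t) *
          ENNReal.ofReal (C * linearGaussianWeight b v) := by
        rw [← lintegral_mul_const' _ _ ENNReal.ofReal_ne_top]
        refine lintegral_congr fun t => ?_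
        by_cases ht : t ∈ I <;> simp [hE, ht]
    _ ≤ ENNReal.ofReal (δ ^ p * (T / (1 + ‖v‖)) ^ (1 - p)) *
          ENNReal.ofReal (C * linearGaussianWeight b v) := by gcongr
    _ = ENNReal.ofReal (δ ^ p * (T / (1 + ‖v‖)) ^ (1 - p) * (C * linearGaussianWeight b v)) :=
        (ENNReal.ofReal_mul (by positivity)).symm
    _ ≤ _ := by
        refine ENNReal.ofReal_le_ofReal ?_
        have hq : (1 + ‖v‖) ^ p * (1 + ‖v‖) ^ (1 - p) = 1 + ‖v‖ := by
          rw [← Real.rpow_add (by positivity), add_sub_cancel, Real.rpow_one]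
        have hq0 : 0 < (1 + ‖v‖) ^ (1 - p) := by positivity
        have hg0 : 0 ≤ gaussianWeight b v := (Real.exp_pos _).le
        calc δ ^ p * (T / (1 + ‖v‖)) ^ (1 - p) * (C * linearGaussianWeight b v)
            = C * T ^ (1 - p) * gaussianWeight b v * ((1 + ‖v‖) * δ) ^ p := by
              have hw : linearGaussianWeight b v =
                  (1 + ‖v‖) ^ p * (1 + ‖v‖) ^ (1 - p) * gaussianWeight b v := by rw [hq]; rfl
              rw [Real.div_rpow hT0 (by positivity), Real.mul_rpow (by positivity) (abs_nonneg _), hw]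
              field_simp
              rw [← hδ]
              ring
          _ ≤ _ := by
              gcongr
              refine Real.rpow_le_rpow (by positivity) ?_ hp0
              calc (1 + ‖v‖) * δ = (1 + ‖v‖) / ‖v‖ * (δ * ‖v‖) := by field_simp
                _ ≤ _ := by
                  gcongr
                  exact le_add_of_nonneg_right (norm_nonneg _)

theorem enorm_opS_sub_le (hB : AngularCutoff B γ) (hγ₀ : 0 ≤ γ) (hγ₁ : γ ≤ 1)
    (ho : IsOpen Ω) (hc : Convex ℝ Ω) (hb : Bornology.IsBounded Ω)
    (hd : ∀ x ∈ Ω, ∀ v ≠ 0, exitTime Ω x v ≤ d / ‖v‖)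
    (hp0 : 0 ≤ p) (hp : p ≤ 1) (hT0 : 0 ≤ T) (hT : transitTime B d v ≤ ENNReal.ofReal (T / (1 + ‖v‖)))
    (hm : Measurable (phaseRestrict Ω h))
    {C : ℝ} (hC0 : 0 ≤ C) (hC : ∀ x ∈ Ω, ∀ v ≠ 0, |h x v| ≤ C * linearGaussianWeight b v)
    {y : Space} (hx : x ∈ Ω) (hy : y ∈ Ω) (hv : v ≠ 0) :
    ‖opS B Ω h y v - opS B Ω h x v‖ₑ ≤
      (∫⁻ t in Ioc 0 (d / ‖v‖), ENNReal.ofReal (Real.exp (-collisionFrequency B v * t)) *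
        interiorDifference Ω h v t (x, y)) +
      ENNReal.ofReal (C * T ^ (1 - p) * gaussianWeight b v * chordModulus Ω p v (x, y)) := by
  have hint : ∀ x, IntegrableOn (transportIntegrand B Ω h x v) (Ioc 0 (d / ‖v‖)) := by
    intro x
    have hmx : Measurable (transportIntegrand B Ω h x v) :=
      Measurable.of_uncurry_left (x := (x, v))
        (f := fun (q : Space × Space) t => transportIntegrand B Ω h q.1 q.2 t)
        (measurable_transportIntegrand hB hγ₀ hγ₁ hm)
    refine Measure.integrableOn_of_bounded (M := C * linearGaussianWeight b v) (by simp)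
      hmx.aestronglyMeasurable ?_
    refine (ae_restrict_iff' measurableSet_Ioc).2 (ae_of_all _ fun t ht => ?_)
    rw [transportIntegrand, Real.norm_eq_abs, abs_mul, abs_of_pos (Real.exp_pos _)]
    refine le_trans (mul_le_of_le_one_left (abs_nonneg _) (Real.exp_le_one_iff.2 ?_))
      (abs_phaseRestrict_le hC0 hC _ _)
    have := mul_nonneg (collisionFrequency_nonneg hB hγ₀ hγ₁ v) ht.1.le
    linarith
  have heq : ∀ x ∈ Ω, opS B Ω h x v = ∫ t in Ioc 0 (d / ‖v‖), transportIntegrand B Ω h x v t :=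
    fun x hx => opS_eq_setIntegral ho hc hb hx hv measurableSet_Ioc
      (Ioo_subset_Ioc_self.trans (Ioc_subset_Ioc_right (hd x hx v hv))) Ioc_subset_Ioi_self
  have hmt : Measurable fun t : ℝ => ENNReal.ofReal (Real.exp (-collisionFrequency B v * t)) *
      interiorDifference Ω h v t (x, y) := by
    have h1 : Measurable fun t : ℝ => ENNReal.ofReal (Real.exp (-collisionFrequency B v * t)) := by
      fun_prop
    have h2 : Measurable fun t : ℝ => interiorDifference Ω h v t (x, y) :=
      Measurable.of_uncurry_right (y := (x, y)) (f := fun t z => interiorDifference Ω h v t z)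
        (measurable_interiorDifference ho hm v)
    exact h1.mul h2
  rw [heq x hx, heq y hy, ← integral_sub (hint y) (hint x)]
  calc _ ≤ ∫⁻ t in Ioc 0 (d / ‖v‖), ‖transportIntegrand B Ω h y v t - transportIntegrand B Ω h x v t‖ₑ :=
        enorm_integral_le_lintegral_enorm _
    _ ≤ _ := setLIntegral_mono' measurableSet_Ioc fun t ht =>
        enorm_transportIntegrand_sub_le ho hc hb hC0 hC hx hy hv ht.1.le
    _ = _ := lintegral_add_left hmt _
    _ ≤ _ := by
        gcongr
        exact lintegral_exitTime_gap_le hB hγ₀ hγ₁ hp0 hp hT0 hT hC0 hv x y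

/-- For the interior part, Minkowski in `t` and translation invariance bound each time slice by the
seminorm of `h`; summing costs the transit time, which absorbs the factor `1+|v|`. The singular
factor `1 + |v|^(-p)` comes from the part between the exit times. -/
theorem hasSlobodeckijBound_opS (hB : AngularCutoff B γ) (hγ₀ : 0 ≤ γ) (hγ₁ : γ ≤ 1)
    (hΩ : IsPositivelyCurvedDomain Ω) (hs : 0 < s) (hsp : s < p) (hp : p < 1)
    (hd : ∀ x ∈ Ω, ∀ v ≠ 0, exitTime Ω x v ≤ d / ‖v‖) (hT0 : 0 ≤ T)
    (hT : ∀ v, transitTime B d v ≤ ENNReal.ofReal (T / (1 + ‖v‖)))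
    (hh : IsWeightBounded Ω (linearGaussianWeight b) h)
    (hsl : HasSlobodeckijBound Ω s (fun v => ENNReal.ofReal (linearGaussianWeight b v)) h) :
    HasSlobodeckijBound Ω s (singularGaussian p b) (opS B Ω h) := by
  have ho := hΩ.isOpen
  have hp0 : 0 < p := hs.trans hsp
  obtain ⟨C, hC0, hC⟩ := hh.bound
  obtain ⟨G, hG, hGv⟩ := exists_lintegral_chordModulus_le hΩ hs hsp hp
  obtain ⟨c, hc, hc0, hcv⟩ := hsl.phaseRestrict_le ho
  have hCT : 0 ≤ C * T ^ (1 - p) := by positivity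
  refine ⟨4 * ((c * ENNReal.ofReal T) ^ 2 + ENNReal.ofReal (C * T ^ (1 - p)) ^ 2 * G), ?_,
    fun v hv => ?_⟩
  · exact ENNReal.mul_lt_top (by simp) (ENNReal.add_lt_top.2
      ⟨ENNReal.pow_lt_top (ENNReal.mul_lt_top hc ENNReal.ofReal_lt_top),
        ENNReal.mul_lt_top (ENNReal.pow_lt_top ENNReal.ofReal_lt_top) hG⟩)
  set E : ℝ → ℝ≥0∞ := fun t => ENNReal.ofReal (Real.exp (-collisionFrequency B v * t)) with hE
  have hEm : Measurable E := by rw [hE]; fun_prop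
  have hE0 : ∀ t, E t ≠ 0 := fun t => (ENNReal.ofReal_pos.2 (Real.exp_pos _)).ne'
  have hdm : Measurable (Function.uncurry fun t (z : Space × Space) =>
      E t * interiorDifference Ω h v t z) :=
    (hEm.comp measurable_fst).mul (measurable_interiorDifference ho hh.measurable v)
  have hA : Measurable fun z : Space × Space =>
      (∫⁻ t in Ioc 0 (d / ‖v‖), E t * interiorDifference Ω h v t z) ^ 2 :=
    (Measurable.lintegral_prod_left' hdm).pow_const 2
  have hw0 := linearGaussianWeight_nonneg b v
  have hwpos : 0 < linearGaussianWeight b v := by unfold linearGaussianWeight; positivity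
  have h1 : ∫⁻ z, (∫⁻ t in Ioc 0 (d / ‖v‖), E t * interiorDifference Ω h v t z) ^ 2
      ∂slobodeckijMeasure Ω s ≤ (c * ENNReal.ofReal T) ^ 2 * singularGaussian p b v ^ 2 := by
    calc _ ≤ (∫⁻ t in Ioc 0 (d / ‖v‖), E t * (c * ENNReal.ofReal (linearGaussianWeight b v))) ^ 2 := by
          refine lintegral_sq_lintegral_le hdm (hEm.mul_const _).aemeasurable (fun t => ?_)
            (ae_of_all _ fun t => ?_)
          · exact mul_ne_zero (hE0 t) (mul_ne_zero hc0 (ENNReal.ofReal_pos.2 hwpos).ne')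
          · have hg : Measurable fun z : Space × Space =>
                ‖phaseRestrict Ω h (z.2, v) - phaseRestrict Ω h (z.1, v)‖ₑ ^ 2 := by
              have h1 : Measurable fun z : Space × Space => phaseRestrict Ω h (z.2, v) :=
                hh.measurable.comp (by fun_prop)
              have h2 : Measurable fun z : Space × Space => phaseRestrict Ω h (z.1, v) :=
                hh.measurable.comp (by fun_prop)
              exact (h1.sub h2).enorm.pow_const 2
            have hsh := (lintegral_slobodeckijMeasure_shift_le (s := s) ho (t • v) hg).trans (hcv v hv)
            calc _ = E t ^ 2 * ∫⁻ z, (Ω ×ˢ Ω).indicator (fun z => ‖phaseRestrict Ω h (z.2, v) -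
                    phaseRestrict Ω h (z.1, v)‖ₑ ^ 2) (z.1 - t • v, z.2 - t • v)
                    ∂slobodeckijMeasure Ω s := by
                  rw [← lintegral_const_mul' _ _ (ENNReal.pow_lt_top ENNReal.ofReal_lt_top).ne]
                  refine lintegral_congr fun z => ?_
                  rw [mul_pow, interiorDifference]
                  congr 1
                  by_cases hz : (z.1 - t • v, z.2 - t • v) ∈ Ω ×ˢ Ω
                  · rw [indicator_of_mem hz, indicator_of_mem hz]
                  · rw [indicator_of_notMem hz, indicator_of_notMem hz, zero_pow two_ne_zero]
              _ ≤ E t ^ 2 * (c * ENNReal.ofReal (linearGaussianWeight b v)) ^ 2 := by gcongr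
              _ = _ := (mul_pow _ _ _).symm
      _ = (transitTime B d v * (c * ENNReal.ofReal (linearGaussianWeight b v))) ^ 2 := by
          rw [lintegral_mul_const _ hEm]; rfl
      _ ≤ (ENNReal.ofReal (T / (1 + ‖v‖)) * (c * ENNReal.ofReal (linearGaussianWeight b v))) ^ 2 := by
          gcongr; exact hT v
      _ = (c * ENNReal.ofReal T) ^ 2 * ENNReal.ofReal (gaussianWeight b v) ^ 2 := by
          rw [mul_left_comm, ← ENNReal.ofReal_mul (by positivity), linearGaussianWeight_mul_div,
            ENNReal.ofReal_mul hT0]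
          ring
      _ ≤ _ := by
          gcongr
          rw [singularGaussian_eq]
          exact le_mul_of_one_le_left zero_le le_self_add
  have h2 := lintegral_sq_gaussianWeight_mul_chordModulus_le (b := b) hCT (hGv v hv)
  calc _ ≤ ∫⁻ z, 4 * ((∫⁻ t in Ioc 0 (d / ‖v‖), E t * interiorDifference Ω h v t z) ^ 2 +
          ENNReal.ofReal (C * T ^ (1 - p) * gaussianWeight b v * chordModulus Ω p v z) ^ 2)
          ∂slobodeckijMeasure Ω s := by
        refine lintegral_mono_ae ?_
        filter_upwards [ae_slobodeckijMeasure ho] with z hz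
        refine le_trans ?_ (add_sq_le_four_mul _ _)
        gcongr
        exact enorm_opS_sub_le hB hγ₀ hγ₁ ho hΩ.convex hΩ.isBounded hd hp0.le hp.le hT0 (hT v)
          hh.measurable hC0 hC hz.1 hz.2 hv
    _ ≤ 4 * ((c * ENNReal.ofReal T) ^ 2 * singularGaussian p b v ^ 2 +
          ENNReal.ofReal (C * T ^ (1 - p)) ^ 2 * G * singularGaussian p b v ^ 2) := by
        rw [lintegral_const_mul' _ _ (by simp), lintegral_add_left hA]
        gcongr
    _ = _ := by ring

end Duhamel

/-! ### Induction on the iterates -/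

section Iteration

variable {Ω : Set Space} {B : ℝ → ℝ → ℝ} {γ b s p : ℝ} {f : Space → Space → ℝ} {x v : Space}

theorem opS_eq_zero (ho : IsOpen Ω) (hc : Convex ℝ Ω) (hb : Bornology.IsBounded Ω)
    {h : Space → Space → ℝ} (h0 : ∀ x ∈ Ω, ∀ v, h x v = 0) (hx : x ∈ Ω) (hv : v ≠ 0) :
    opS B Ω h x v = 0 := by
  rw [opS_eq_setIntegral ho hc hb hx hv measurableSet_Ioi Ioo_subset_Ioi_self subset_rfl]
  refine integral_eq_zero_of_ae (ae_of_all _ fun t => ?_)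
  rw [transportIntegrand]
  by_cases hm : x - t • v ∈ Ω
  · rw [phaseRestrict_of_mem hm hv, h0 _ hm, mul_zero]; rfl
  · rw [phaseRestrict_of_notMem hm, mul_zero]; rfl

theorem isWeightBounded_of_eq_zero (ho : IsOpen Ω) (h0 : ∀ x ∈ Ω, ∀ v ≠ 0, f x v = 0)
    (w : Space → ℝ) : IsWeightBounded Ω w f :=
  ⟨measurable_phaseRestrict_of_eq ho (F := fun _ => 0) measurable_const h0, 0, le_rfl,
    fun x hx v hv => by rw [h0 x hx v hv, abs_zero, zero_mul]⟩

theorem hasSlobodeckijBound_of_eq_zero (ho : IsOpen Ω) (h0 : ∀ x ∈ Ω, ∀ v ≠ 0, f x v = 0)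
    (w : Space → ℝ≥0∞) : HasSlobodeckijBound Ω s w f := by
  refine ⟨0, ENNReal.zero_lt_top, fun v hv => ?_⟩
  rw [zero_mul, nonpos_iff_eq_zero]
  refine lintegral_eq_zero_of_ae_eq_zero ?_
  filter_upwards [ae_slobodeckijMeasure ho] with z hz
  simp [h0 _ hz.1 v hv, h0 _ hz.2 v hv]

theorem exists_exitTime_le (ho : IsOpen Ω) (hc : Convex ℝ Ω) (hb : Bornology.IsBounded Ω) :
    ∃ d : ℝ, 0 ≤ d ∧ ∀ x ∈ Ω, ∀ v ≠ 0, exitTime Ω x v ≤ d / ‖v‖ := by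
  refine ⟨Metric.diam (closure Ω), Metric.diam_nonneg, fun x hx v hv => ?_⟩
  rw [le_div_iff₀ (norm_pos_iff.2 hv)]
  refine exitTime_mul_norm_le ho hc hb hx hv fun y hy z hz => ?_
  rw [← dist_eq_norm]
  exact Metric.dist_le_diam_of_mem hb.closure hy hz

/-- The inductive step. If `ν` is bounded below near `v = 0`, the loss of `1+|v|` in `K` and its
gain in `S_Ω` cancel; otherwise the cross-section vanishes almost everywhere and the new iterate is
zero on Ω for `v ≠ 0`. -/
theorem opS_opK_bounds (hB : AngularCutoff B γ) (hγ₀ : 0 ≤ γ) (hγ₁ : γ ≤ 1)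
    (hΩ : IsPositivelyCurvedDomain Ω) (hb0 : 0 ≤ b) (hb : b ≤ 1 / 2)
    (hf : IsWeightBounded Ω (gaussianWeight b) f) :
    IsWeightBounded Ω (gaussianWeight b) (opS B Ω (opK B f)) ∧
      ∀ s p : ℝ, 0 < s → s < p → p < 1 → HasSlobodeckijBound Ω s (singularGaussian p b) f →
        HasSlobodeckijBound Ω s (singularGaussian p b) (opS B Ω (opK B f)) := by
  have ho := hΩ.isOpen
  have hbd := hΩ.isBounded
  have hc := hΩ.convex
  obtain ⟨d, hd0, hd⟩ := exists_exitTime_le ho hc hbd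
  rcases exists_le_collisionFrequency_or hB hγ₀ hγ₁ with hν | h0
  · obtain ⟨T, hT0, hT⟩ := exists_transitTime_le hB hγ₀ hγ₁ hν hd0
    have hK := hf.opK hB hγ₀ hγ₁ ho hb0 hb
    exact ⟨isWeightBounded_opS hB hγ₀ hγ₁ ho hc hbd hd hT0 hT hK, fun s p hs hsp hp hsl =>
      hasSlobodeckijBound_opS hB hγ₀ hγ₁ hΩ hs hsp hp hd hT0 hT hK
        (hsl.opK hB hγ₀ hγ₁ ho hb0 hb hf (hs.trans hsp).le hp)⟩
  · obtain ⟨C, hC0, hC⟩ := hf.exists_bound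
    have hz : ∀ x ∈ Ω, ∀ v ≠ 0, opS B Ω (opK B f) x v = 0 := fun x hx v hv =>
      opS_eq_zero ho hc hbd (fun x hx v => by
        rw [opK_eq_phaseRestrict hB hγ₀ hγ₁ hb0 hf hx]
        exact collisionIntegral_eq_zero hB hγ₀ hγ₁ (h0 v) (hf.measurable.comp measurable_prodMk_left)
          (fun w => (hC x w).trans (mul_le_of_le_one_right hC0 (gaussianWeight_le_one hb0 w)))) hx hv
    exact ⟨isWeightBounded_of_eq_zero ho hz _, fun _ _ _ _ _ _ => hasSlobodeckijBound_of_eq_zero ho hz _⟩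

theorem boundaryIterate_succ (g : Space → Space → ℝ) (i : ℕ) :
    boundaryIterate B Ω g (i + 1) = opS B Ω (opK B (boundaryIterate B Ω g i)) :=
  Function.iterate_succ_apply' _ _ _

theorem isWeightBounded_boundaryIterate (hB : AngularCutoff B γ) (hγ₀ : 0 ≤ γ) (hγ₁ : γ ≤ 1)
    (hΩ : IsPositivelyCurvedDomain Ω) {g : Space → Space → ℝ} {a C : ℝ} (hC : 0 ≤ C)
    (hg : IsIncomingData Ω g a C) (hb0 : 0 ≤ b) (hba : b ≤ a) (hb : b ≤ 1 / 2) (i : ℕ) :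
    IsWeightBounded Ω (gaussianWeight b) (boundaryIterate B Ω g i) := by
  induction i with
  | zero => exact isWeightBounded_opJ hB hγ₀ hγ₁ hΩ hC hg hba
  | succ i ih =>
    rw [boundaryIterate_succ]
    exact (opS_opK_bounds hB hγ₀ hγ₁ hΩ hb0 hb ih).1

theorem hasSlobodeckijBound_boundaryIterate (hB : AngularCutoff B γ) (hγ₀ : 0 ≤ γ) (hγ₁ : γ ≤ 1)
    (hΩ : IsPositivelyCurvedDomain Ω) {g : Space → Space → ℝ} {a C : ℝ} (ha : 0 ≤ a) (hC : 0 ≤ C)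
    (hg : IsIncomingData Ω g a C) (hs : 0 < s) (hsp : s < p) (hp : p < 1) (hb0 : 0 ≤ b)
    (hba : b ≤ a * (1 - p)) (hb : b ≤ 1 / 2) (i : ℕ) :
    HasSlobodeckijBound Ω s (singularGaussian p b) (boundaryIterate B Ω g i) := by
  have hba' : b ≤ a := hba.trans (mul_le_of_le_one_right ha (by linarith))
  induction i with
  | zero => exact hasSlobodeckijBound_opJ hB hγ₀ hγ₁ hΩ ha hC hg hs hsp hp hba
  | succ i ih =>
    rw [boundaryIterate_succ]
    exact (opS_opK_bounds hB hγ₀ hγ₁ hΩ hb0 hb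
      (isWeightBounded_boundaryIterate hB hγ₀ hγ₁ hΩ hC hg hb0 hba' hb i)).2 s p hs hsp hp ih

/-! ### Membership in the mixed Sobolev space -/

theorem IsWeightBounded.memLp_two (ho : IsOpen Ω) (hbd : Bornology.IsBounded Ω) (hb : 0 < b)
    (hf : IsWeightBounded Ω (gaussianWeight b) f) :
    MemLp (Function.uncurry f) 2 (((volume : Measure Space).restrict Ω).prod volume) := by
  obtain ⟨C, hC0, hC⟩ := hf.exists_bound
  have : IsFiniteMeasure ((volume : Measure Space).restrict Ω) := ⟨by
    rw [Measure.restrict_apply_univ]; exact hbd.measure_lt_top⟩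
  have hae : phaseRestrict Ω f =ᵐ[((volume : Measure Space).restrict Ω).prod volume]
      Function.uncurry f := by
    have h1 : ∀ᵐ z ∂((volume : Measure Space).restrict Ω).prod (volume : Measure Space), z.1 ∈ Ω :=
      Measure.quasiMeasurePreserving_fst.ae (ae_restrict_mem ho.measurableSet)
    have h2 : ∀ᵐ z ∂((volume : Measure Space).restrict Ω).prod (volume : Measure Space), z.2 ≠ 0 :=
      Measure.quasiMeasurePreserving_snd.ae (compl_mem_ae_iff.2 (measure_singleton (0 : Space)))
    filter_upwards [h1, h2] with z hz1 hz2
    exact phaseRestrict_of_mem hz1 hz2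
  have hgm : Measurable fun z : Space × Space => C * gaussianWeight b z.2 := by
    unfold gaussianWeight; fun_prop
  have hdom : MemLp (fun z : Space × Space => C * gaussianWeight b z.2) 2
      (((volume : Measure Space).restrict Ω).prod volume) := by
    rw [memLp_two_iff_integrable_sq hgm.aestronglyMeasurable]
    have hint := ((integrable_gaussian (b := 2 * b) (by positivity)).const_mul (C ^ 2)).comp_snd
      ((volume : Measure Space).restrict Ω)
    refine hint.congr (ae_of_all _ fun z => ?_)
    simp only [gaussianWeight, mul_pow]
    rw [← Real.exp_nat_mul]
    congr 2
    push_cast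
    ring
  refine (hdom.mono hf.measurable.aestronglyMeasurable (ae_of_all _ fun z => ?_)).ae_eq hae
  exact (hC z.1 z.2).trans (le_abs_self _)

/-- In the unit ball the square is at most `4|v|^(-2p)`, integrable since `2p < 3`; outside it the
singular factor is at most 2 and the Gaussian takes over. -/
theorem lintegral_singularGaussian_sq_lt_top (hp0 : 0 ≤ p) (hp : p < 1) (hb : 0 < b) :
    ∫⁻ v, singularGaussian p b v ^ 2 < ∞ := by
  have h1 := lintegral_ball_enorm_rpow_lt_top (p := 2 * p) (R := 1) (by linarith)
  have h2 : ∫⁻ v : Space, ENNReal.ofReal (gaussianWeight b v) < ∞ :=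
    (integrable_gaussian hb).lintegral_lt_top
  have hm : Measurable fun v : Space => ENNReal.ofReal (gaussianWeight b v) := by
    unfold gaussianWeight; fun_prop
  have hmb : MeasurableSet (Metric.ball (0 : Space) 1) := measurableSet_ball
  have hpt : ∀ v : Space, singularGaussian p b v ^ 2 ≤
      4 * (Metric.ball (0 : Space) 1).indicator (fun v => ‖v‖ₑ ^ (-(2 * p))) v +
        4 * ENNReal.ofReal (gaussianWeight b v) := by
    intro v
    have hw1 : ENNReal.ofReal (gaussianWeight b v) ≤ 1 := by
      rw [← ENNReal.ofReal_one]; exact ENNReal.ofReal_le_ofReal (gaussianWeight_le_one hb.le v)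
    have hfour : ∀ X : ℝ≥0∞, (X + X) ^ 2 = 4 * X ^ 2 := fun X => by rw [← two_mul]; ring
    rw [singularGaussian_eq]
    by_cases h : v ∈ Metric.ball (0 : Space) 1
    · rw [indicator_of_mem h]
      refine le_trans ?_ le_self_add
      have hX : 1 ≤ ‖v‖ₑ ^ (-p) := by
        rw [ENNReal.rpow_neg, ENNReal.one_le_inv]
        refine ENNReal.rpow_le_one ?_ hp0
        rw [← ofReal_norm, ← ENNReal.ofReal_one]
        exact ENNReal.ofReal_le_ofReal (mem_ball_zero_iff.1 h).le
      calc _ ≤ ((‖v‖ₑ ^ (-p) + ‖v‖ₑ ^ (-p)) * 1) ^ 2 := by gcongr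
        _ = 4 * ‖v‖ₑ ^ (-(2 * p)) := by
          rw [mul_one, hfour, ← ENNReal.rpow_mul_natCast]
          congr 2
          push_cast
          ring
    · refine le_trans ?_ le_add_self
      have hX : ‖v‖ₑ ^ (-p) ≤ 1 := by
        rw [ENNReal.rpow_neg, ENNReal.inv_le_one]
        rcases hp0.eq_or_lt with rfl | hp
        · simp
        · refine ENNReal.one_le_rpow ?_ hp
          rw [← ofReal_norm, ← ENNReal.ofReal_one]
          exact ENNReal.ofReal_le_ofReal (by simpa using h)
      calc _ ≤ ((1 + 1) * ENNReal.ofReal (gaussianWeight b v)) ^ 2 := by gcongr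
        _ = 4 * (ENNReal.ofReal (gaussianWeight b v) * ENNReal.ofReal (gaussianWeight b v)) := by ring
        _ ≤ _ := by gcongr; exact mul_le_of_le_one_right zero_le hw1
  refine lt_of_le_of_lt (lintegral_mono hpt) ?_
  rw [lintegral_add_right _ (hm.const_mul 4), lintegral_const_mul' _ _ (by simp),
    lintegral_const_mul' _ _ (by simp), lintegral_indicator hmb]
  exact ENNReal.add_lt_top.2 ⟨ENNReal.mul_lt_top (by simp) h1, ENNReal.mul_lt_top (by simp) h2⟩

theorem memMixedSobolev_of_bounds (ho : IsOpen Ω) (hbd : Bornology.IsBounded Ω) (hb : 0 < b)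
    (hp0 : 0 ≤ p) (hp : p < 1) (hf : IsWeightBounded Ω (gaussianWeight b) f)
    (hs : HasSlobodeckijBound Ω s (singularGaussian p b) f) : MemMixedSobolev Ω s f := by
  refine ⟨hf.memLp_two ho hbd hb, ?_⟩
  obtain ⟨c, hc, -, hcv⟩ := hs.phaseRestrict_le ho
  have hle : ∀ᵐ v : Space, ∫⁻ y in Ω, ∫⁻ x in Ω,
      ENNReal.ofReal (|f x v - f y v| ^ 2 / ‖x - y‖ ^ (3 + 2 * s)) ≤
        c ^ 2 * singularGaussian p b v ^ 2 := by
    filter_upwards [compl_mem_ae_iff.2 (measure_singleton (0 : Space))] with v hv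
    rw [← mul_pow]
    refine le_trans (le_of_eq ?_) (hcv v hv)
    rw [lintegral_sq_sub_slobodeckijMeasure (f := fun x => phaseRestrict Ω f (x, v))
      (hf.measurable.comp measurable_prodMk_right)]
    refine setLIntegral_congr_fun ho.measurableSet fun y hy =>
      setLIntegral_congr_fun ho.measurableSet fun x hx => ?_
    rw [phaseRestrict_of_mem hx hv, phaseRestrict_of_mem hy hv]
  refine lt_of_le_of_lt (lintegral_mono_ae hle) ?_
  have hc2 : c ^ 2 < ∞ := ENNReal.pow_lt_top hc
  rw [lintegral_const_mul' _ _ hc2.ne]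
  exact ENNReal.mul_lt_top hc2 (lintegral_singularGaussian_sq_lt_top hp0 hp hb)

end Iteration

end StationaryBoltzmann

end

/-! ### Conclusion: choice of the exponents -/

theorem mainTheorem9 (Ω : Set StationaryBoltzmann.Space)
    (hΩ : StationaryBoltzmann.IsPositivelyCurvedDomain Ω)
    (B : ℝ → ℝ → ℝ) (γ : ℝ) (hγ₀ : 0 ≤ γ) (hγ₁ : γ ≤ 1)
    (hB : StationaryBoltzmann.AngularCutoff B γ)
    (g : StationaryBoltzmann.Space → StationaryBoltzmann.Space → ℝ) (a C : ℝ)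
    (ha : 0 < a) (hC : 0 < C) (hg : StationaryBoltzmann.IsIncomingData Ω g a C) (i : ℕ) :
    (∀ ε : ℝ, 0 < ε → ε < 1 →
      StationaryBoltzmann.MemMixedSobolev Ω (1 - ε)
        (StationaryBoltzmann.boundaryIterate B Ω g i)) ∧
    (∀ b : ℝ, 0 < b → b ≤ a → b < 1 / 4 → ∃ C' : ℝ, 0 < C' ∧
      ∀ x ∈ Ω, ∀ v : StationaryBoltzmann.Space, v ≠ 0 →
        |StationaryBoltzmann.boundaryIterate B Ω g i x v| ≤ C' * Real.exp (-b * ‖v‖ ^ 2)) := by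
  refine ⟨fun ε hε0 hε1 => ?_, fun b hb0 hba hb => ?_⟩
  -- With `s = 1 - ε`, any `p` strictly between `s` and 1 would do; `p = 1 - ε/2` is the midpoint.
  · have hp : 1 - ε / 2 < 1 := by linarith
    have hsp : 1 - ε < 1 - ε / 2 := by linarith
    -- The decay rate is free in the first claim: it must be positive, at most `a(1-p)` for the
    -- interpolation of the data, and at most `1/2` for the collision kernel.
    have hb0 : 0 < min (a * (1 - (1 - ε / 2))) (1 / 2) :=
      lt_min (mul_pos ha (by linarith)) (by norm_num)
    have hba : min (a * (1 - (1 - ε / 2))) (1 / 2) ≤ a * (1 - (1 - ε / 2)) := min_le_left _ _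
    exact StationaryBoltzmann.memMixedSobolev_of_bounds hΩ.isOpen hΩ.isBounded hb0 (by linarith) hp
      (StationaryBoltzmann.isWeightBounded_boundaryIterate hB hγ₀ hγ₁ hΩ hC.le hg hb0.le
        (hba.trans (mul_le_of_le_one_right ha.le (by linarith))) (min_le_right _ _) i)
      (StationaryBoltzmann.hasSlobodeckijBound_boundaryIterate hB hγ₀ hγ₁ hΩ ha.le hC.le hg
        (by linarith) hsp hp hb0.le hba (min_le_right _ _) i)
  · obtain ⟨D, hD0, hD⟩ := (StationaryBoltzmann.isWeightBounded_boundaryIterate hB hγ₀ hγ₁ hΩ hC.le hg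
      hb0.le hba (by linarith) i).bound
    -- `D` is only known to be nonnegative, while the constant must be positive.
    refine ⟨D + 1, by linarith, fun x hx v hv => (hD x hx v hv).trans ?_⟩
    exact mul_le_mul_of_nonneg_right (by linarith) (Real.exp_pos _).le
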